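/- An \emph{arena} $\mathcal A=(V,V_0,V_1,E,w,c)$ consists of a finite directed graph $(V,E)$ in which every vertex has an outgoing edge, a partition $V=V_0\uplus V_1$, a weight function $w\colon E\to\mathbb N$ (nonnegative integers) and a colouring $c\colon V\to C$, where $C$ is a finite set of colours. Weights are added up along paths, and $c$ is extended letterwise to paths. A \emph{play} is an infinite path $\rho=v_0v_1v_2\cdots$. A \emph{strategy} for Player $0$ is a map $\sigma\colon V^*V_0\to V$ with $(v_j,\sigma(v_0\cdots v_j))\in E$ for all $v_0\cdots v_j\in V^*V_0$; a play is \emph{consistent} with $\sigma$ if $v_{j+1}=\sigma(v_0\cdots v_j)$ whenever $v_j\in V_0$. The strategy is \emph{finite-state} if there are a finite set $M$ and maps $\mathrm{init}\colon V\to M$, $\mathrm{upd}\colon M\times V\to M$, $\mathrm{Nxt}\colon V_0\times M\to V$ with $(v,\mathrm{Nxt}(v,m))\in E$ for all $v\in V_0$, $m\in M$, such that $\sigma(v_0\cdots v_j)=\mathrm{Nxt}(v_j,\mathrm{upd}^*(v_0\cdots v_j))$, where $\mathrm{upd}^*(v)=\mathrm{init}(v)$ and $\mathrm{upd}^*(xv)=\mathrm{upd}(\mathrm{upd}^*(x),v)$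 for nonempty $x$. Let $\mathfrak A=(Q,C,q_I,\delta,F)$ be a deterministic finite automaton with language $L(\mathfrak A)$. The \emph{regular weighted limit game} $(\mathcal A,\lim(L(\mathfrak A)))$ has as winning condition for Player $0$ the set $\lim(L(\mathfrak A))$ of infinite words over $C$ with infinitely many nonempty prefixes in $L(\mathfrak A)$, and a play $\rho=v_0v_1\cdots$ has the value \[ \mathrm{val}(\rho)=\sup_{j\in\mathbb N}\ \min\{\,w(v_j\cdots v_{j'}) : j'>j,\ c(v_0\cdots v_{j'})\in L(\mathfrak A)\,\}\in\mathbb N\cup\{\infty\},\qquad \min\emptyset=\infty . \] For a strategy $\sigma$ for Player $0$ and a vertex $v$, let $\mathrm{val}(\sigma,v)$ be the supremum of $\mathrm{val}(\rho)$ over all plays $\rho$ that start in $v$ and are consistent with $\sigma$. The strategy $\sigma$ is \emph{optimal} if $\mathrm{val}(\sigma,v)\le\mathrm{val}(\sigma',v)$ for every strategy $\sigma'$ for Player $0$ and every vertex $v$. \textbf{Theorem.} \begin{enumerate} \item In every regular weighted limit game, Player $0$ has an optimal finite-state strategy. \item The problem ``given an arena $\mathcal A$ with $V\neq\emptyset$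 and a DFA $\mathfrak A$, compute an optimal strategy for Player $0$ in $(\mathcal A,\lim(L(\mathfrak A)))$'' is solvable in time $O\big(|V|^3\cdot|E|\cdot|Q|^2\cdot\max\{1,|F|\}^2\big)$ in the unit-cost model. That is, there are one program of a random access machine on natural numbers (each addition, truncated subtraction, comparison, copy and memory access takes one step) and one constant $K$ such that on every input, with the edges of $\mathcal A$ given as a list in any order and the transition function of $\mathfrak A$ as a table, the program halts within $K\cdot|V|^3\cdot|E|\cdot|Q|^2\cdot\max\{1,|F|\}^2$ steps and outputs the tables of $\mathrm{init}$, $\mathrm{upd}$ and $\mathrm{Nxt}$ of an optimal finite-state strategy. \end{enumerate} -/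

import Mathlib

noncomputable section

namespace WeightedLimit

/-! ### Arenas, plays, strategies -/

/-- A weighted and coloured arena with vertices `V` and colours `C`. The vertex set is partitioned
by `owner` into the vertices of Player `0` and of Player `1`. Only the values of `weight` on edges
are ever used. -/
structure Arena (V C : Type*) where
  owner : V → Fin 2
  edge : V → V → Prop
  weight : V → V → ℕ
  color : V → C
  exists_edge : ∀ v, ∃ v', edge v v'

/-- A strategy for Player `i`: a map `V^* V_i → V` that follows edges. `next w v` is the vertex
chosen after the word `w v`, where `w` is listed in chronological order. -/
structure Strategy {V C : Type*} (A : Arena V C) (i : Fin 2) where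
  next : List V → {v : V // A.owner v = i} → V
  edge_next : ∀ (w : List V) (v : {v : V // A.owner v = i}), A.edge v (next w v)

/-- A play: an infinite path through the arena. -/
def IsPlay {V C : Type*} (A : Arena V C) (ρ : ℕ → V) : Prop :=
  ∀ j, A.edge (ρ j) (ρ (j + 1))

/-- `pre x j` is the finite word `x 0, …, x (j - 1)`. -/
def pre {X : Type*} (x : ℕ → X) (j : ℕ) : List X :=
  (List.range j).map x

/-- The play `ρ` is consistent with the strategy `σ` for Player `i`. -/
def Strategy.Consistent {V C : Type*} {A : Arena V C} {i : Fin 2} (σ : Strategy A i)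
    (ρ : ℕ → V) : Prop :=
  ∀ (j : ℕ) (h : A.owner (ρ j) = i), ρ (j + 1) = σ.next (pre ρ j) ⟨ρ j, h⟩

/-! ### Memory structures and finite-state strategies -/

/-- A memory structure with memory states `M` (finiteness of `M` is required where it is used). -/
structure MemoryStructure (V M : Type*) where
  init : V → M
  upd : M → V → M

/-- `updStar w v` is the memory state reached on the nonempty word `w v`. -/
def MemoryStructure.updStar {V M : Type*} (𝓜 : MemoryStructure V M) : List V → V → M
  | [], v => 𝓜.init v
  | u :: w, v => 𝓜.upd (w.foldl 𝓜.upd (𝓜.init u)) v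

/-- A next-move function for Player `i`. -/
structure NextMove {V C : Type*} (A : Arena V C) (i : Fin 2) (M : Type*) where
  nxt : {v : V // A.owner v = i} → M → V
  edge_nxt : ∀ (v : {v : V // A.owner v = i}) (m : M), A.edge v (nxt v m)

/-- The strategy induced by a memory structure and a next-move function. -/
def NextMove.toStrategy {V C M : Type*} {A : Arena V C} {i : Fin 2} (N : NextMove A i M)
    (𝓜 : MemoryStructure V M) : Strategy A i where
  next w v := N.nxt v (𝓜.updStar w v)
  edge_next w v := N.edge_nxt v (𝓜.updStar w v)

/-- A strategy is finite-state if it is implemented by a memory structure with finitely many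
memory states. -/
def Strategy.IsFiniteState {V C : Type*} {A : Arena V C} {i : Fin 2} (σ : Strategy A i) : Prop :=
  ∃ (M : Type) (_ : Finite M) (𝓜 : MemoryStructure V M) (N : NextMove A i M), σ = N.toStrategy 𝓜

/-! ### Regular weighted limit games -/

/-- The limit of a language: the infinite words with infinitely many prefixes
`α 0 ⋯ α j` in `K`. -/
def limitLanguage {C : Type*} (K : Language C) : Set (ℕ → C) :=
  {α | {j : ℕ | pre α (j + 1) ∈ K}.Infinite}

/-- A regular weighted limit game: an arena and a DFA, both over the colours `C`. -/
structure RegularLimitGame (V C Q : Type*) where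
  arena : Arena V C
  dfa : DFA C Q

namespace RegularLimitGame

variable {V C Q : Type*}

/-- The qualitative winning condition `lim (L(𝔄))` of the game. -/
def Win (G : RegularLimitGame V C Q) : Set (ℕ → C) :=
  limitLanguage G.dfa.accepts

/-- The weight of the infix `ρ j, …, ρ j'` of a play. -/
def infixWeight (G : RegularLimitGame V C Q) (ρ : ℕ → V) (j j' : ℕ) : ℕ :=
  ∑ i ∈ Finset.Ico j j', G.arena.weight (ρ i) (ρ (i + 1))

/-- The value of a play: the supremum over all positions `j` of the least weight of an infix
`ρ j, …, ρ j'` with `j' > j` such that the colour sequence of `ρ 0, …, ρ j'` is accepted; the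
minimum over the empty set is `∞`. -/
def playValue (G : RegularLimitGame V C Q) (ρ : ℕ → V) : ℕ∞ :=
  ⨆ j : ℕ, ⨅ j' : ℕ, ⨅ _ : j < j' ∧ (pre ρ (j' + 1)).map G.arena.color ∈ G.dfa.accepts,
    (G.infixWeight ρ j j' : ℕ∞)

/-- The value of a strategy for Player `0` from the vertex `v`. -/
def value (G : RegularLimitGame V C Q) (σ : Strategy G.arena 0) (v : V) : ℕ∞ :=
  ⨆ ρ : ℕ → V, ⨆ _ : IsPlay G.arena ρ ∧ ρ 0 = v ∧ σ.Consistent ρ, G.playValue ρ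

/-- Optimality of a strategy for Player `0`, uniformly in the initial vertex. -/
def IsOptimal (G : RegularLimitGame V C Q) (σ : Strategy G.arena 0) : Prop :=
  ∀ (σ' : Strategy G.arena 0) (v : V), G.value σ v ≤ G.value σ' v

end RegularLimitGame

/-! ### Unit-cost random access machines -/

/-- Programs of a random access machine, with structured control flow. A program refers to finitely
many registers `0, 1, 2, …`; registers and memory cells hold natural numbers. -/
inductive Prog : Type
  /-- do nothing -/
  | skip
  /-- `R[r] := c` -/
  | const (r c : ℕ)
  /-- `R[r] := R[a]` -/
  | copy (r a : ℕ)
  /-- `R[r] := R[a] + R[b]` -/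
  | add (r a b : ℕ)
  /-- `R[r] := max (R[a] - R[b]) 0` -/
  | sub (r a b : ℕ)
  /-- `R[r] := Mem[R[a]]` -/
  | load (r a : ℕ)
  /-- `Mem[R[a]] := R[b]` -/
  | store (a b : ℕ)
  /-- `P; P'` -/
  | seq (P P' : Prog)
  /-- `if R[a] < R[b] then P else P'` -/
  | ifLt (a b : ℕ) (P P' : Prog)
  /-- `while R[a] < R[b] do P` -/
  | whileLt (a b : ℕ) (P : Prog)

/-- Machine states: registers and random access memory. -/
structure MState where
  reg : ℕ → ℕ
  mem : ℕ → ℕ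

/-- Overwrite the register `r`. -/
def MState.setReg (S : MState) (r x : ℕ) : MState :=
  { S with reg := Function.update S.reg r x }

/-- Overwrite the memory cell with address `a`. -/
def MState.setMem (S : MState) (a x : ℕ) : MState :=
  { S with mem := Function.update S.mem a x }

/-- `Exec P S t S'`: started in `S`, the program `P` halts after exactly `t` steps in `S'`. In the
unit-cost model every arithmetic operation, memory access and comparison takes one step. -/
inductive Exec : Prog → MState → ℕ → MState → Prop
  | skip (S) : Exec .skip S 1 S
  | const (r c S) : Exec (.const r c) S 1 (S.setReg r c)
  | copy (r a S) : Exec (.copy r a) S 1 (S.setReg r (S.reg a))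
  | add (r a b S) : Exec (.add r a b) S 1 (S.setReg r (S.reg a + S.reg b))
  | sub (r a b S) : Exec (.sub r a b) S 1 (S.setReg r (S.reg a - S.reg b))
  | load (r a S) : Exec (.load r a) S 1 (S.setReg r (S.mem (S.reg a)))
  | store (a b S) : Exec (.store a b) S 1 (S.setMem (S.reg a) (S.reg b))
  | seq {P P' S S' S'' t t'} : Exec P S t S' → Exec P' S' t' S'' →
      Exec (.seq P P') S (t + t') S''
  | ifTrue {a b P P' S S' t} : S.reg a < S.reg b → Exec P S t S' →
      Exec (.ifLt a b P P') S (t + 1) S'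
  | ifFalse {a b P P' S S' t} : ¬ S.reg a < S.reg b → Exec P' S t S' →
      Exec (.ifLt a b P P') S (t + 1) S'
  | whileTrue {a b P S S' S'' t t'} : S.reg a < S.reg b → Exec P S t S' →
      Exec (.whileLt a b P) S' t' S'' → Exec (.whileLt a b P) S (t + t' + 1) S''
  | whileFalse {a b P S} : ¬ S.reg a < S.reg b → Exec (.whileLt a b P) S 1 S

/-! ### Inputs and outputs -/

/-- `L` lists every edge of the arena exactly once (in an arbitrary order). -/
def IsEdgeList {V C : Type*} (A : Arena V C) (L : List (V × V)) : Prop :=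
  L.Nodup ∧ ∀ u v, (u, v) ∈ L ↔ A.edge u v

open Classical in
/-- The encoding of an arena with vertices `0, …, n - 1` and colours `0, …, k - 1`, given with a list
`L` of its edges, and of a DFA with states `0, …, s - 1`: the sizes `n`, `k`, `s`, `|E|`, the initial
state, the owners and the colours of the vertices, the acceptance flags of the states, the
edges as triples of source, target and weight, and the transition table, row by row. -/
def encode {n k s : ℕ} (G : RegularLimitGame (Fin n) (Fin k) (Fin s))
    (L : List (Fin n × Fin n)) : List ℕ :=
  [n, k, s, L.length, (G.dfa.start : ℕ)] ++
  List.ofFn (fun v : Fin n => (G.arena.owner v : ℕ)) ++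
  List.ofFn (fun v : Fin n => (G.arena.color v : ℕ)) ++
  List.ofFn (fun q : Fin s => if q ∈ G.dfa.accept then 1 else 0) ++
  L.flatMap (fun p => [(p.1 : ℕ), (p.2 : ℕ), G.arena.weight p.1 p.2]) ++
  (List.finRange s).flatMap (fun q => List.ofFn fun c : Fin k => (G.dfa.step q c : ℕ))

/-- The initial machine state: all registers are `0`, and the memory holds the input from address
`0` on, followed by zeros. -/
def inputState (w : List ℕ) : MState where
  reg _ := 0
  mem a := w.getD a 0

/-- The memory holds, from the address in register `0` on, a finite-state strategy for
Player `0` with memory states `0, …, m - 1`: the number `m`, the table of the initialization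
function, the table of the update function, and the table of the next-move function. The entries
of the latter at vertices of Player `1` are irrelevant. -/
def Outputs {n m : ℕ} {C : Type*} {A : Arena (Fin n) C} (S : MState)
    (𝓜 : MemoryStructure (Fin n) (Fin m)) (N : NextMove A 0 (Fin m)) : Prop :=
  S.mem (S.reg 0) = m ∧
  (∀ v : Fin n, S.mem (S.reg 0 + 1 + v) = 𝓜.init v) ∧
  (∀ (x : Fin m) (v : Fin n), S.mem (S.reg 0 + 1 + n + x * n + v) = 𝓜.upd x v) ∧
  (∀ (x : Fin m) (v : {v : Fin n // A.owner v = 0}),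
    S.mem (S.reg 0 + 1 + n + m * n + x * n + (v : Fin n)) = N.nxt v x)

/-- The program `P`, run on the encoded game, halts within `T` steps and outputs a finite-state
strategy for Player `0` that is optimal. -/
def ComputesOptimal {n k s : ℕ} (P : Prog) (G : RegularLimitGame (Fin n) (Fin k) (Fin s))
    (L : List (Fin n × Fin n)) (T : ℕ) : Prop :=
  ∃ (t : ℕ) (S : MState), Exec P (inputState (encode G L)) t S ∧ t ≤ T ∧
    ∃ (m : ℕ) (𝓜 : MemoryStructure (Fin n) (Fin m)) (N : NextMove G.arena 0 (Fin m)),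
      Outputs S 𝓜 N ∧ G.IsOptimal (N.toStrategy 𝓜)

end WeightedLimit

end

open WeightedLimit

/-!
The game is played on the product of the arena with the automaton: its positions are pairs of a
vertex and the state reached after this vertex is read, and its targets are the positions with an
accepting state. The value of a play is the supremum, over all times, of the weight until the next
target. For a set `T` of targets, let `d x` be the least weight within which Player `0` can
enforce a nonempty path from `x` to `T`. If `D` is the maximum of `d` on `T`, then from `x` on
Player `0` can keep the value of a play at most `max D (d x)`, with a positional strategy on the
product (`IsUpperDist.playValue_le`). To stay close to targets, it may however be better to do
without those targets from which the next target is far away. So let `T 0` be the set of all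
targets, and obtain `T (i + 1)` from `T i` by removing a target of maximal distance to `T i`. For
every initial vertex `v` some level `ℓ v` of this chain minimizes the bound, and Player `0` plays
the corresponding positional strategy forever; the memory stores the level and the state of the
automaton.

This is optimal (`IsLevelChain.isOptimal`): let `σ'` be another strategy of finite value `W` from
`v`, and let `R` be the set of targets that occur after the start in some play consistent with
`σ'`. Consider the last level `i` with `R ⊆ T i`. The target removed from `T i` lies in `R`, so
some consistent play visits it, and from there Player `1` could enforce more than `W` before the
next target if its distance exceeded `W` (`IsLowerDist.le_of_value_le`). Hence the maximal
distance of level `i` is at most `W`, and so is the distance from the start, for the same reason.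

The distances of one level are computed as in Dijkstra's algorithm, adapted to two players: in
each of `N` phases, with `N` the number of positions, all edges are relaxed, and among the
positions that are not settled one of least cost is settled (`EdgeGraph.SettleInv`). Weights may
be `0`, so a rank, the phase in which a position is settled, witnesses that the strategy makes
progress. There are `1 + |V| * |F|` levels, which gives the claimed running time.

The program is written in a small language with bounded loops and arrays, whose statements denote
total functions on stores, and whose running time is bounded by a syntactic expression in the loop
bounds. Its translation into machine programs is correct and respects the bound
(`Stmt.exec_comp`). Arrays whose sizes are not known in advance are interleaved in memory behind
the input; at the end the output array is copied to consecutive cells.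

The existence of finite-state optimal strategies for arbitrary finite games follows by renaming
vertices and states into numbers, where each vertex serves as its own colour.
-/

namespace WeightedLimit

namespace RegularLimitGame

variable {V C Q : Type*}

/-! ### The product of the arena with the automaton -/

/-- The state of the automaton after it has read the colours of `ρ 0, …, ρ j`. -/
def run (G : RegularLimitGame V C Q) (ρ : ℕ → V) (j : ℕ) : Q :=
  G.dfa.eval ((pre ρ (j + 1)).map G.arena.color)

/-- The position of the product of arena and automaton in which a play starts at `v`. -/
def startPos (G : RegularLimitGame V C Q) (v : V) : V × Q :=
  (v, G.dfa.step G.dfa.start (G.arena.color v))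

/-- The position of the product reached from `x` by a move to the vertex `v`. -/
def succPos (G : RegularLimitGame V C Q) (x : V × Q) (v : V) : V × Q :=
  (v, G.dfa.step x.2 (G.arena.color v))

/-- The position of the product at time `j` of the play `ρ`. -/
def pos (G : RegularLimitGame V C Q) (ρ : ℕ → V) (j : ℕ) : V × Q :=
  (ρ j, G.run ρ j)

/-- The target positions, in which the automaton accepts. -/
def target (G : RegularLimitGame V C Q) : Set (V × Q) :=
  {x | x.2 ∈ G.dfa.accept}

end RegularLimitGame

lemma pre_succ {X : Type*} (x : ℕ → X) (j : ℕ) : pre x (j + 1) = pre x j ++ [x j] := by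
  simp [pre, List.range_succ]

@[simp] lemma length_pre {X : Type*} (x : ℕ → X) (j : ℕ) : (pre x j).length = j := by
  simp [pre]

lemma pre_congr {X : Type*} {x y : ℕ → X} {j : ℕ} (h : ∀ i < j, x i = y i) :
    pre x j = pre y j := by
  unfold pre
  exact List.map_congr_left fun i hi => h i (List.mem_range.1 hi)

/-- Every rule that extends finite words by one letter generates an infinite word. -/
lemma exists_seq_of_rule {X : Type*} (f : List X → X → X) (x₀ : X) :
    ∃ x : ℕ → X, x 0 = x₀ ∧ ∀ j, x (j + 1) = f (pre x j) (x j) := by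
  -- Iterate on pairs of a word and its successor letter.
  let step : List X × X → List X × X := fun p => (p.1 ++ [p.2], f p.1 p.2)
  let s : ℕ → List X × X := fun j => step^[j] ([], x₀)
  have hs : ∀ j, s (j + 1) = step (s j) := fun j => Function.iterate_succ_apply' _ _ _
  have hpre : ∀ j, (s j).1 = pre (fun i => (s i).2) j := by
    intro j
    induction j with
    | zero => rfl
    | succ j ih => rw [hs, pre_succ, ← ih]
  refine ⟨fun j => (s j).2, rfl, fun j => ?_⟩
  change (s (j + 1)).2 = _
  rw [hs, ← hpre]

namespace RegularLimitGame

variable {V C Q : Type*} (G : RegularLimitGame V C Q)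

@[simp] lemma pos_zero (ρ : ℕ → V) : G.pos ρ 0 = G.startPos (ρ 0) := rfl

@[simp] lemma pos_succ (ρ : ℕ → V) (j : ℕ) :
    G.pos ρ (j + 1) = G.succPos (G.pos ρ j) (ρ (j + 1)) := by
  simp [pos, succPos, run, pre_succ ρ (j + 1), DFA.eval_append_singleton]

lemma pos_congr {ρ ρ' : ℕ → V} {j : ℕ} (h : ∀ i ≤ j, ρ i = ρ' i) : G.pos ρ j = G.pos ρ' j := by
  simp only [pos, run, h j le_rfl, pre_congr fun i (hi : i < j + 1) => h i (by omega)]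

lemma mem_accepts_iff (ρ : ℕ → V) (j : ℕ) :
    (pre ρ (j + 1)).map G.arena.color ∈ G.dfa.accepts ↔ G.pos ρ j ∈ G.target := by
  rfl

lemma infixWeight_succ (ρ : ℕ → V) {j k : ℕ} (h : j ≤ k) :
    G.infixWeight ρ j (k + 1) = G.infixWeight ρ j k + G.arena.weight (ρ k) (ρ (k + 1)) := by
  simp [infixWeight, Finset.sum_Ico_succ_top h]

lemma infixWeight_head (ρ : ℕ → V) {j k : ℕ} (h : j < k) :
    G.infixWeight ρ j k = G.arena.weight (ρ j) (ρ (j + 1)) + G.infixWeight ρ (j + 1) k := by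
  simp [infixWeight, Finset.sum_eq_sum_Ico_succ_bot h]

lemma playValue_le {ρ : ℕ → V} {B : ℕ∞}
    (h : ∀ j, ∃ k, j < k ∧ G.pos ρ k ∈ G.target ∧ (G.infixWeight ρ j k : ℕ∞) ≤ B) :
    G.playValue ρ ≤ B := by
  refine iSup_le fun j => ?_
  obtain ⟨k, hjk, hk, hB⟩ := h j
  exact (iInf₂_le k ⟨hjk, (G.mem_accepts_iff ρ k).2 hk⟩).trans hB

lemma exists_target_of_playValue_le {ρ : ℕ → V} {W : ℕ} (h : G.playValue ρ ≤ W) (j : ℕ) :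
    ∃ k, j < k ∧ G.pos ρ k ∈ G.target ∧ G.infixWeight ρ j k ≤ W := by
  have h' := (le_iSup (fun j => ⨅ k : ℕ, ⨅ _ : j < k ∧
    (pre ρ (k + 1)).map G.arena.color ∈ G.dfa.accepts, (G.infixWeight ρ j k : ℕ∞)) j).trans h
  have h'' := lt_of_le_of_lt h' (show (W : ℕ∞) < (W + 1 : ℕ) by exact_mod_cast Nat.lt_succ_self W)
  simp only [iInf_lt_iff] at h''
  obtain ⟨k, ⟨hjk, hk⟩, hlt⟩ := h''
  exact ⟨k, hjk, (G.mem_accepts_iff ρ k).1 hk, Nat.lt_succ_iff.1 (by exact_mod_cast hlt)⟩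

lemma playValue_le_value {σ : Strategy G.arena 0} {ρ : ℕ → V} (hp : IsPlay G.arena ρ)
    (hc : σ.Consistent ρ) : G.playValue ρ ≤ G.value σ (ρ 0) :=
  le_iSup₂ (f := fun (ρ' : ℕ → V) (_ : IsPlay G.arena ρ' ∧ ρ' 0 = ρ 0 ∧ σ.Consistent ρ') =>
    G.playValue ρ') ρ ⟨hp, rfl, hc⟩

/-! ### Distances to a set of positions -/

open Classical in
/-- The cost of reaching `T` that remains on arrival in `y`: nothing if `y` lies in `T`. As `d` is
about nonempty paths, it may be positive on `T`. -/
noncomputable def costTo (T : Set (V × Q)) (d : V × Q → ℕ∞) (y : V × Q) : ℕ∞ :=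
  if y ∈ T then 0 else d y

/-- `d` is a lower bound for the weight that Player `1` can enforce before `T` is reached by a
nonempty path. -/
structure IsLowerDist (T : Set (V × Q)) (d : V × Q → ℕ∞) : Prop where
  le_of_owner_eq : ∀ x : V × Q, G.arena.owner x.1 = 0 → ∀ v, G.arena.edge x.1 v →
    d x ≤ G.arena.weight x.1 v + costTo T d (G.succPos x v)
  exists_le_of_owner_ne : ∀ x : V × Q, G.arena.owner x.1 ≠ 0 → ∃ v, G.arena.edge x.1 v ∧
    d x ≤ G.arena.weight x.1 v + costTo T d (G.succPos x v)

/-- From every position `x` with `d x ≠ ⊤`, the positional strategy `ch` of Player `0` reaches `T`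
by a nonempty path of weight at most `d x`; the rank `r` witnesses that `T` is reached at all, which
the weights do not, as they may be `0`. -/
structure IsUpperDist (T : Set (V × Q)) (d : V × Q → ℕ∞) (ch : V × Q → V) (r : V × Q → ℕ) :
    Prop where
  le_of_owner_eq : ∀ x : V × Q, d x ≠ ⊤ → G.arena.owner x.1 = 0 →
    G.arena.weight x.1 (ch x) + costTo T d (G.succPos x (ch x)) ≤ d x ∧
      (G.succPos x (ch x) ∈ T ∨ r (G.succPos x (ch x)) < r x)
  le_of_owner_ne : ∀ x : V × Q, d x ≠ ⊤ → G.arena.owner x.1 ≠ 0 → ∀ v, G.arena.edge x.1 v →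
    G.arena.weight x.1 v + costTo T d (G.succPos x v) ≤ d x ∧
      (G.succPos x v ∈ T ∨ r (G.succPos x v) < r x)

variable {G}

lemma IsUpperDist.step {T : Set (V × Q)} {d : V × Q → ℕ∞} {ch : V × Q → V} {r : V × Q → ℕ}
    (hd : G.IsUpperDist T d ch r) {ρ : ℕ → V} (hp : IsPlay G.arena ρ)
    (hch : ∀ j, G.arena.owner (ρ j) = 0 → ρ (j + 1) = ch (G.pos ρ j)) {j : ℕ}
    (hj : d (G.pos ρ j) ≠ ⊤) :
    G.arena.weight (ρ j) (ρ (j + 1)) + costTo T d (G.pos ρ (j + 1)) ≤ d (G.pos ρ j) ∧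
      (G.pos ρ (j + 1) ∈ T ∨ r (G.pos ρ (j + 1)) < r (G.pos ρ j)) := by
  rw [pos_succ]
  by_cases ho : G.arena.owner (ρ j) = 0
  · rw [hch j ho]
    exact hd.le_of_owner_eq _ hj ho
  · exact hd.le_of_owner_ne _ hj ho _ (hp j)

lemma IsUpperDist.exists_mem {T : Set (V × Q)} {d : V × Q → ℕ∞} {ch : V × Q → V}
    {r : V × Q → ℕ} (hd : G.IsUpperDist T d ch r) {ρ : ℕ → V} (hp : IsPlay G.arena ρ)
    (hch : ∀ j, G.arena.owner (ρ j) = 0 → ρ (j + 1) = ch (G.pos ρ j)) :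
    ∀ (m j : ℕ), r (G.pos ρ j) = m → d (G.pos ρ j) ≠ ⊤ →
      ∃ k, j < k ∧ G.pos ρ k ∈ T ∧ (G.infixWeight ρ j k : ℕ∞) ≤ d (G.pos ρ j) := by
  intro m
  induction m using Nat.strong_induction_on with
  | _ m ih =>
    intro j hm hj
    obtain ⟨hle, hor⟩ := hd.step hp hch hj
    by_cases hT : G.pos ρ (j + 1) ∈ T
    · refine ⟨j + 1, by omega, hT, ?_⟩
      simpa [infixWeight_succ, infixWeight] using le_self_add.trans hle
    · have hlt := hor.resolve_left hT
      rw [costTo, if_neg hT] at hle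
      obtain ⟨k, hjk, hk, hw⟩ := ih _ (hm ▸ hlt) (j + 1) rfl
        (ne_top_of_le_ne_top hj (le_add_self.trans hle))
      refine ⟨k, by omega, hk, le_trans ?_ hle⟩
      rw [G.infixWeight_head ρ (by omega : j < k)]
      push_cast
      gcongr

/-- Player `0` keeps every segment between visits to `T` below `B` if every distance from
`T` is at most `B`. -/
lemma IsUpperDist.playValue_le {T : Set (V × Q)} {d : V × Q → ℕ∞} {ch : V × Q → V}
    {r : V × Q → ℕ} (hd : G.IsUpperDist T d ch r) (hT : T ⊆ G.target) {ρ : ℕ → V}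
    (hp : IsPlay G.arena ρ)
    (hch : ∀ j, G.arena.owner (ρ j) = 0 → ρ (j + 1) = ch (G.pos ρ j)) {B : ℕ∞}
    (hB : ∀ x ∈ T, d x ≤ B) (h0 : d (G.pos ρ 0) ≤ B) : G.playValue ρ ≤ B := by
  by_cases hBt : B = ⊤
  · simp [hBt]
  have hdB : ∀ j, d (G.pos ρ j) ≤ B := by
    intro j
    induction j with
    | zero => exact h0
    | succ j ih =>
      by_cases hx : G.pos ρ (j + 1) ∈ T
      · exact hB _ hx
      · have := (hd.step hp hch (ne_top_of_le_ne_top hBt ih)).1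
        rw [costTo, if_neg hx] at this
        exact (le_add_self.trans this).trans ih
  refine G.playValue_le fun j => ?_
  obtain ⟨k, hjk, hk, hw⟩ := hd.exists_mem hp hch _ j rfl (ne_top_of_le_ne_top hBt (hdB j))
  exact ⟨k, hjk, hT hk, hw.trans (hdB j)⟩

/-- Against a strategy of value at most `W` Player `1` cannot enforce more than `W` before the
next target, provided that all targets that may occur lie in `T`. Otherwise, moves of Player `1`
witnessing the lower bound yield a play with an infix that is too heavy. -/
lemma IsLowerDist.le_of_value_le {T : Set (V × Q)} {d : V × Q → ℕ∞} (hd : G.IsLowerDist T d)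
    {σ : Strategy G.arena 0} {v : V} {W : ℕ} (hW : G.value σ v ≤ W)
    (hT : ∀ ρ, IsPlay G.arena ρ → ρ 0 = v → σ.Consistent ρ → ∀ k, 0 < k →
      G.pos ρ k ∈ G.target → G.pos ρ k ∈ T)
    {ρ : ℕ → V} (hp : IsPlay G.arena ρ) (h0 : ρ 0 = v) (hc : σ.Consistent ρ) (j : ℕ) :
    d (G.pos ρ j) ≤ W := by
  classical
  by_contra! hlt
  have : Nonempty V := ⟨v⟩
  choose! α hαe hαd using hd.exists_le_of_owner_ne
  -- Follow `ρ` up to position `j`; from there on, Player `1` moves according to `α`.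
  obtain ⟨ρ', hρ0, hρ⟩ := exists_seq_of_rule (fun w u =>
    if w.length < j then ρ (w.length + 1)
    else if h : G.arena.owner u = 0 then σ.next w ⟨u, h⟩
    else α (u, G.dfa.eval ((w ++ [u]).map G.arena.color))) (ρ 0)
  have heq : ∀ i ≤ j, ρ' i = ρ i := by
    intro i
    induction i with
    | zero => exact fun _ => hρ0
    | succ i ih => intro hi; rw [hρ, length_pre, if_pos (by omega)]
  have hown : ∀ k, j ≤ k → ∀ h : G.arena.owner (ρ' k) = 0,
      ρ' (k + 1) = σ.next (pre ρ' k) ⟨ρ' k, h⟩ := by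
    intro k hk h
    rw [hρ, length_pre, if_neg (by omega), dif_pos h]
  have hadv : ∀ k, j ≤ k → G.arena.owner (ρ' k) ≠ 0 → ρ' (k + 1) = α (G.pos ρ' k) := by
    intro k hk h
    rw [hρ, length_pre, if_neg (by omega), dif_neg h, ← pre_succ]
    rfl
  have hp' : IsPlay G.arena ρ' := by
    intro k
    by_cases hk : j ≤ k
    · by_cases h : G.arena.owner (ρ' k) = 0
      · rw [hown k hk h]
        exact σ.edge_next _ ⟨ρ' k, h⟩
      · rw [hadv k hk h]
        exact hαe (G.pos ρ' k) h
    · rw [heq k (by omega), heq (k + 1) (by omega)]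
      exact hp k
  have hc' : σ.Consistent ρ' := by
    intro k h
    by_cases hk : j ≤ k
    · exact hown k hk h
    · have h' : G.arena.owner (ρ k) = 0 := by rw [← heq k (by omega)]; exact h
      rw [heq (k + 1) (by omega), hc k h', pre_congr fun i hi => (heq i (by omega)).symm]
      congr 2
      exact (heq k (by omega)).symm
  have hstep : ∀ k, j ≤ k → d (G.pos ρ' k) ≤
      G.arena.weight (ρ' k) (ρ' (k + 1)) + costTo T d (G.pos ρ' (k + 1)) := by
    intro k hk
    rw [pos_succ]
    by_cases h : G.arena.owner (ρ' k) = 0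
    · exact hd.le_of_owner_eq _ h _ (hp' k)
    · rw [hadv k hk h]
      exact hαd (G.pos ρ' k) h
  have hinv : ∀ k, j ≤ k →
      (W : ℕ∞) < G.infixWeight ρ' j (k + 1) + costTo T d (G.pos ρ' (k + 1)) := by
    intro k hk
    induction k, hk using Nat.le_induction with
    | base =>
      rw [← G.pos_congr heq] at hlt
      simpa [infixWeight_succ, infixWeight] using hlt.trans_le (hstep j le_rfl)
    | succ k hk ih =>
      rw [G.infixWeight_succ ρ' (by omega : j ≤ k + 1)]
      by_cases hx : G.pos ρ' (k + 1) ∈ T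
      · rw [costTo, if_pos hx, add_zero] at ih
        push_cast
        rw [add_assoc]
        exact ih.trans_le le_self_add
      · rw [costTo, if_neg hx] at ih
        refine ih.trans_le ?_
        push_cast
        rw [add_assoc]
        gcongr
        exact hstep (k + 1) (by omega)
  have h0' : ρ' 0 = v := hρ0.trans h0
  obtain ⟨k, hjk, hk, hw⟩ := G.exists_target_of_playValue_le
    ((G.playValue_le_value hp' hc').trans (h0' ▸ hW)) j
  have hkT := hT ρ' hp' h0' hc' k (by omega) hk
  obtain ⟨k, rfl⟩ : ∃ i, k = i + 1 := ⟨k - 1, by omega⟩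
  have := hinv k (by omega)
  rw [costTo, if_pos hkT, add_zero] at this
  exact absurd hw (by simpa using this)

/-! ### Optimality of the strategy given by a descending chain of target sets -/

/-- A chain of `J + 1` sets of targets, from all targets down to the empty set, where each set
arises from the one before by removing the position `t i` of maximal distance `D i` to that set.
The level `ℓ v` minimises the bound guaranteed from `v`. -/
structure IsLevelChain (G : RegularLimitGame V C Q) (J : ℕ) (T : ℕ → Set (V × Q))
    (d : ℕ → V × Q → ℕ∞) (D : ℕ → ℕ∞) (t : ℕ → V × Q) (ch : ℕ → V × Q → V) (ℓ : V → ℕ) :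
    Prop where
  zero : T 0 = G.target
  succ : ∀ i < J, T (i + 1) = T i \ {t i}
  last : T J = ∅
  lower : ∀ i ≤ J, G.IsLowerDist (T i) (d i)
  upper : ∀ i ≤ J, ∃ r, G.IsUpperDist (T i) (d i) (ch i) r
  le : ∀ i ≤ J, ∀ x ∈ T i, d i x ≤ D i
  eq : ∀ i ≤ J, t i ∈ T i → d i (t i) = D i
  level_le : ∀ v, ℓ v ≤ J
  min : ∀ v, ∀ i ≤ J, max (D (ℓ v)) (d (ℓ v) (G.startPos v)) ≤ max (D i) (d i (G.startPos v))

lemma exists_consistent_play (σ : Strategy G.arena 0) (v : V) :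
    ∃ ρ, IsPlay G.arena ρ ∧ ρ 0 = v ∧ σ.Consistent ρ := by
  classical
  choose f hf using G.arena.exists_edge
  obtain ⟨ρ, h0, hρ⟩ := exists_seq_of_rule (fun w u =>
    if h : G.arena.owner u = 0 then σ.next w ⟨u, h⟩ else f u) v
  refine ⟨ρ, fun j => ?_, h0, fun j h => by rw [hρ, dif_pos h]⟩
  rw [hρ]
  split_ifs with h
  · exact σ.edge_next _ ⟨ρ j, h⟩
  · exact hf _

/-- A strategy that plays, from each initial vertex `v`, the attracting moves of the level `ℓ v`
forever, is optimal: the last set of the chain that contains all targets reachable under another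
strategy `σ'` loses one of them, so its maximal distance is at most the value of `σ'`. -/
theorem IsLevelChain.isOptimal {J : ℕ} {T : ℕ → Set (V × Q)} {d : ℕ → V × Q → ℕ∞}
    {D : ℕ → ℕ∞} {t : ℕ → V × Q} {ch : ℕ → V × Q → V} {ℓ : V → ℕ}
    (h : IsLevelChain G J T d D t ch ℓ) {σ : Strategy G.arena 0}
    (hσ : ∀ ρ, IsPlay G.arena ρ → σ.Consistent ρ →
      ∀ j, G.arena.owner (ρ j) = 0 → ρ (j + 1) = ch (ℓ (ρ 0)) (G.pos ρ j)) :
    G.IsOptimal σ := by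
  intro σ' v
  have hsub : ∀ i ≤ J, T i ⊆ G.target := by
    intro i hi
    induction i with
    | zero => rw [h.zero]
    | succ i ih =>
      rw [h.succ i (by omega)]
      exact Set.sdiff_subset.trans (ih (by omega))
  have hup : G.value σ v ≤ max (D (ℓ v)) (d (ℓ v) (G.startPos v)) := by
    refine iSup₂_le fun ρ ⟨hp, h0, hc⟩ => ?_
    obtain ⟨r, hr⟩ := h.upper _ (h.level_le v)
    refine hr.playValue_le (hsub _ (h.level_le v)) hp (h0 ▸ hσ ρ hp hc)
      (fun x hx => le_max_of_le_left (h.le _ (h.level_le v) x hx)) ?_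
    rw [pos_zero, h0]
    exact le_max_right _ _
  by_cases hWt : G.value σ' v = ⊤
  · simp [hWt]
  obtain ⟨W, hW⟩ := ENat.ne_top_iff_exists.1 hWt
  refine hup.trans ?_
  rw [← hW]
  let R : Set (V × Q) := {x | ∃ ρ, IsPlay G.arena ρ ∧ ρ 0 = v ∧ σ'.Consistent ρ ∧
    ∃ k, 0 < k ∧ G.pos ρ k ∈ G.target ∧ G.pos ρ k = x}
  obtain ⟨ρ, hp, h0, hc⟩ := exists_consistent_play σ' v
  have hR : R.Nonempty := by
    obtain ⟨k, hk, hkT, -⟩ := G.exists_target_of_playValue_le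
      ((G.playValue_le_value hp hc).trans (h0 ▸ hW.ge)) 0
    exact ⟨_, ρ, hp, h0, hc, k, hk, hkT, rfl⟩
  -- `i` is the last index with `R ⊆ T i`.
  obtain ⟨i, hi, hRi, hRi'⟩ : ∃ i < J, R ⊆ T i ∧ ¬ R ⊆ T (i + 1) := by
    by_contra! hcon
    have : ∀ i ≤ J, R ⊆ T i := by
      intro i hi
      induction i with
      | zero =>
        rw [h.zero]
        rintro x ⟨ρ, -, -, -, k, -, hk, rfl⟩
        exact hk
      | succ i ih => exact hcon i (by omega) (ih (by omega))
    have hJ := this J le_rfl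
    rw [h.last, Set.subset_empty_iff] at hJ
    exact hR.ne_empty hJ
  have hti : t i ∈ R := by
    by_contra hn
    refine hRi' fun x hx => ?_
    rw [h.succ i hi]
    exact ⟨hRi hx, fun hxt => hn (hxt ▸ hx)⟩
  have hT : ∀ ρ, IsPlay G.arena ρ → ρ 0 = v → σ'.Consistent ρ → ∀ k, 0 < k →
      G.pos ρ k ∈ G.target → G.pos ρ k ∈ T i := fun ρ hp h0 hc k hk hkT =>
    hRi ⟨ρ, hp, h0, hc, k, hk, hkT, rfl⟩
  have hlow := fun ρ hp h0 hc j =>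
    (h.lower i hi.le).le_of_value_le (ρ := ρ) hW.ge hT hp h0 hc j
  refine (h.min v i hi.le).trans (max_le ?_ ?_)
  · rw [← h.eq i hi.le (hRi hti)]
    obtain ⟨ρ', hp', h0', hc', k, -, -, hx⟩ := hti
    exact hx ▸ hlow ρ' hp' h0' hc' k
  · simpa [h0] using hlow ρ hp h0 hc 0

end RegularLimitGame

/-! ### A language with bounded loops and arrays, and its translation to machine programs -/

/-- The program variables. The input gives the sizes `n`, `k`, `s` and `ne` (the number of edges),
the initial state `qI`, and the addresses `cb`, `ab`, `eb`, `tb` of the tables of colours,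
acceptance flags, edges and transitions. The product has `N` positions and `PE` edges; there are
`J` levels, and `W` and `INF` bound single weights and finite distances. The output is written at
the indices `o1` and `o2` of its array. The other variables are counters and intermediate results.
-/
inductive Var
  | n | k | s | ne | qI | cb | ab | eb | tb | N | PE | J | W | INF | qn | rb | ep | pe | m | mn | is
  | o1 | o2 | q | v | j | e | u | i | ph | z | val | best | bx | Dm | tx | bd
  deriving DecidableEq

/-- The program arrays: the multiples `mul` of `n`; for each position of the product, the state
`stq` reached from its state by reading its vertex, the owner `own` and the target flag `tgt`; for
each edge of the product, source `src`, target `dst`, weight `wgt` and target vertex `dsv`; for each position, the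
distance `dis` to the targets, the cost `rem` that remains on arrival, the cost `acc` of the best
move, this move `cho`, and the move `nxt` of the strategy; for each initial vertex, the best bound
`bes` so far and the offset `lev` of its level; and the output `out`. -/
inductive Arr
  | mul | stq | own | tgt | src | dst | wgt | dsv | dis | rem | acc | cho | nxt | bes | lev | out
  deriving DecidableEq

/-- The register that holds a variable. -/
def Var.reg (x : Var) : ℕ := 2 * x.ctorIdx + 2

lemma Var.reg_inj {x y : Var} : x.reg = y.reg ↔ x = y := by
  constructor
  · intro h
    have : x.ctorIdx = y.ctorIdx := by unfold Var.reg at h; omega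
    rw [← Var.ofNat_ctorIdx x, this, Var.ofNat_ctorIdx]
  · rintro rfl; rfl

lemma Arr.ctorIdx_lt (a : Arr) : a.ctorIdx < 16 := by cases a <;> decide

lemma Arr.ctorIdx_inj {a b : Arr} : a.ctorIdx = b.ctorIdx ↔ a = b := by
  constructor
  · intro h
    rw [← Arr.ofNat_ctorIdx a, h, Arr.ofNat_ctorIdx]
  · rintro rfl; rfl

/-- The values of the variables and the contents of the (unbounded) arrays. -/
structure Store where
  var : Var → ℕ
  arr : Arr → ℕ → ℕ

namespace Store

/-- Assign to a variable. -/
def set (σ : Store) (x : Var) (c : ℕ) : Store := { σ with var := Function.update σ.var x c }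

/-- Assign to an array cell. -/
def put (σ : Store) (a : Arr) (i c : ℕ) : Store :=
  { σ with arr := Function.update σ.arr a (Function.update (σ.arr a) i c) }

variable (σ : Store)

@[simp] lemma set_arr (x : Var) (c : ℕ) : (σ.set x c).arr = σ.arr := rfl
@[simp] lemma put_var (a : Arr) (i c : ℕ) : (σ.put a i c).var = σ.var := rfl
@[simp] lemma set_var_self (x : Var) (c : ℕ) : (σ.set x c).var x = c := by simp [set]
@[simp] lemma set_var_of_ne {x y : Var} (c : ℕ) (h : y ≠ x) : (σ.set x c).var y = σ.var y := by
  simp [set, h]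
@[simp] lemma put_arr_self (a : Arr) (i c : ℕ) :
    (σ.put a i c).arr a = Function.update (σ.arr a) i c := by simp [put]
@[simp] lemma put_arr_of_ne {a b : Arr} (i c : ℕ) (h : b ≠ a) :
    (σ.put a i c).arr b = σ.arr b := by simp [put, h]

end Store

/-- Expressions: numbers, variables, sums, input cells and array cells. -/
inductive Ex
  | num (c : ℕ)
  | var (x : Var)
  | add (e e' : Ex)
  | inp (e : Ex)
  | get (a : Arr) (e : Ex)

instance : Add Ex := ⟨Ex.add⟩

/-- The value of an expression, where `I` is the input. -/
def Ex.eval (I : ℕ → ℕ) (σ : Store) : Ex → ℕ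
  | num c => c
  | var x => σ.var x
  | add e e' => e.eval I σ + e'.eval I σ
  | inp e => I (e.eval I σ)
  | get a e => σ.arr a (e.eval I σ)

/-- Statements. `ite e e' P P'` branches on `e < e'`, and `loop x b P` runs `P` for
`x = 0, …, b - 1`. -/
inductive Stmt
  | skip
  | assign (x : Var) (e : Ex)
  | put (a : Arr) (i e : Ex)
  | seq (P P' : Stmt)
  | ite (e e' : Ex) (P P' : Stmt)
  | loop (x b : Var) (P : Stmt)

infixr:30 " ;; " => Stmt.seq

/-- Apply `f 0`, …, `f (k - 1)` in this order. -/
def iter (f : ℕ → Store → Store) : ℕ → Store → Store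
  | 0, σ => σ
  | k + 1, σ => f k (iter f k σ)

/-- The effect of a statement on the store. -/
def Stmt.den (I : ℕ → ℕ) : Stmt → Store → Store
  | skip, σ => σ
  | assign x e, σ => σ.set x (e.eval I σ)
  | put a i e, σ => σ.put a (i.eval I σ) (e.eval I σ)
  | seq P P', σ => P'.den I (P.den I σ)
  | ite e e' P P', σ => if e.eval I σ < e'.eval I σ then P.den I σ else P'.den I σ
  | loop x b P, σ => (iter (fun i τ => P.den I (τ.set x i)) (σ.var b) σ).set x (σ.var b)

/-- The variables that a statement may change. -/
def Stmt.mods : Stmt → List Var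
  | skip => []
  | assign x _ => [x]
  | put _ _ _ => []
  | seq P P' => P.mods ++ P'.mods
  | ite _ _ P P' => P.mods ++ P'.mods
  | loop x _ P => x :: P.mods

/-- The arrays that a statement may change. -/
def Stmt.amods : Stmt → List Arr
  | skip => []
  | assign _ _ => []
  | put a _ _ => [a]
  | seq P P' => P.amods ++ P'.amods
  | ite _ _ P P' => P.amods ++ P'.amods
  | loop _ _ P => P.amods

/-- The variables that bound the loops of a statement. -/
def Stmt.bounds : Stmt → List Var
  | skip => []
  | assign _ _ => []
  | put _ _ _ => []
  | seq P P' => P.bounds ++ P'.bounds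
  | ite _ _ P P' => P.bounds ++ P'.bounds
  | loop _ b P => b :: P.bounds

/-- No loop body changes the variable of the loop. -/
def Stmt.ok : Stmt → Bool
  | skip => true
  | assign _ _ => true
  | put _ _ _ => true
  | seq P P' => P.ok && P'.ok
  | ite _ _ P P' => P.ok && P'.ok
  | loop x _ P => x ∉ P.mods && P.ok

/-- `τ` differs from `σ` at most in the given variables and arrays. -/
def Agree (xs : List Var) (as : List Arr) (σ τ : Store) : Prop :=
  (∀ x ∉ xs, τ.var x = σ.var x) ∧ ∀ a ∉ as, τ.arr a = σ.arr a

lemma Agree.refl (xs : List Var) (as : List Arr) (σ : Store) : Agree xs as σ σ :=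
  ⟨fun _ _ => rfl, fun _ _ => rfl⟩

lemma Agree.trans {xs : List Var} {as : List Arr} {σ τ υ : Store} (h : Agree xs as σ τ)
    (h' : Agree xs as τ υ) : Agree xs as σ υ :=
  ⟨fun x hx => (h'.1 x hx).trans (h.1 x hx), fun a ha => (h'.2 a ha).trans (h.2 a ha)⟩

lemma Agree.mono {xs ys : List Var} {as bs : List Arr} {σ τ : Store} (h : Agree xs as σ τ)
    (hx : xs ⊆ ys) (ha : as ⊆ bs) : Agree ys bs σ τ :=
  ⟨fun x h' => h.1 x fun hh => h' (hx hh), fun a h' => h.2 a fun hh => h' (ha hh)⟩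

lemma agree_set {xs : List Var} {as : List Arr} (σ : Store) {x : Var} (c : ℕ) (h : x ∈ xs) :
    Agree xs as σ (σ.set x c) :=
  ⟨fun y hy => by
    have : y ≠ x := by rintro rfl; exact hy h
    simp [this], fun _ _ => rfl⟩

lemma agree_put {xs : List Var} {as : List Arr} (σ : Store) {a : Arr} (i c : ℕ) (h : a ∈ as) :
    Agree xs as σ (σ.put a i c) :=
  ⟨fun _ _ => rfl, fun b hb => by
    have : b ≠ a := by rintro rfl; exact hb h
    simp [this]⟩

lemma agree_iter {xs : List Var} {as : List Arr} {f : ℕ → Store → Store}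
    (hf : ∀ i τ, Agree xs as τ (f i τ)) (σ : Store) (k : ℕ) : Agree xs as σ (iter f k σ) := by
  induction k with
  | zero => exact .refl _ _ _
  | succ k ih => exact ih.trans (hf _ _)

lemma Stmt.agree_den (I : ℕ → ℕ) (P : Stmt) : ∀ σ, Agree P.mods P.amods σ (P.den I σ) := by
  induction P with
  | skip => exact fun σ => .refl _ _ _
  | assign x e => exact fun σ => agree_set _ _ (by simp [mods])
  | put a i e => exact fun σ => agree_put _ _ _ (by simp [amods])
  | seq P P' ih ih' =>
    intro σ
    exact ((ih σ).mono (by simp [mods]) (by simp [amods])).trans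
      ((ih' _).mono (by simp [mods]) (by simp [amods]))
  | ite e e' P P' ih ih' =>
    intro σ
    rw [den]
    split_ifs
    · exact (ih σ).mono (by simp [mods]) (by simp [amods])
    · exact (ih' σ).mono (by simp [mods]) (by simp [amods])
  | loop x b P ih =>
    intro σ
    refine (agree_iter (fun i τ => ?_) σ _).trans (agree_set _ _ (by simp [mods]))
    exact (agree_set _ _ (by simp [mods])).trans
      ((ih _).mono (by simp [mods]) (by simp [amods]))

lemma Stmt.den_var (I : ℕ → ℕ) (P : Stmt) (σ : Store) {x : Var} (h : x ∉ P.mods) :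
    (P.den I σ).var x = σ.var x := (P.agree_den I σ).1 x h

lemma Stmt.den_arr (I : ℕ → ℕ) (P : Stmt) (σ : Store) {a : Arr} (h : a ∉ P.amods) :
    (P.den I σ).arr a = σ.arr a := (P.agree_den I σ).2 a h

/-- The invariant rule for loops. -/
lemma Stmt.loop_rule {I : ℕ → ℕ} {x b : Var} {P : Stmt} {σ : Store} (p : ℕ → Store → Prop)
    (h0 : p 0 σ)
    (hs : ∀ i < σ.var b, ∀ τ, Agree (x :: P.mods) P.amods σ τ → p i τ →
      p (i + 1) (P.den I (τ.set x i))) :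
    ∃ τ, p (σ.var b) τ ∧ (loop x b P).den I σ = τ.set x (σ.var b) := by
  refine ⟨_, ?_, rfl⟩
  have key : ∀ k ≤ σ.var b, p k (iter (fun i τ => P.den I (τ.set x i)) k σ) := by
    intro k hk
    induction k with
    | zero => exact h0
    | succ k ih =>
      refine hs k (by omega) _ (agree_iter (fun i τ => ?_) σ k) (ih (by omega))
      exact (agree_set _ _ (by simp)).trans ((P.agree_den I _).mono (by simp) (by simp))
  exact key _ le_rfl

/-- The number of steps that the machine needs to evaluate an expression. -/
def Ex.cost : Ex → ℕ
  | num _ => 1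
  | var _ => 1
  | add e e' => e.cost + (e'.cost + 1)
  | inp e => e.cost + 2
  | get _ e => e.cost + 8

/-- A bound on the number of steps that the machine needs to run a statement, where `p` gives the
loop bounds. -/
def Stmt.cost (p : Var → ℕ) : Stmt → ℕ
  | skip => 1
  | assign _ e => e.cost + 1
  | put _ i e => i.cost + e.cost + 8
  | seq P P' => P.cost p + P'.cost p
  | ite e e' P P' => e.cost + e'.cost + 1 + (P.cost p + P'.cost p)
  | loop _ b P => p b * (P.cost p + 3) + 2

/-- Turn the index in register `2 * t + 3` into the address of that cell of the array `a`: the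
arrays are interleaved above the address in register `1`. -/
def addrProg (a : Arr) (t : ℕ) : Prog :=
  .seq (.add (2 * t + 3) (2 * t + 3) (2 * t + 3)) <|
  .seq (.add (2 * t + 3) (2 * t + 3) (2 * t + 3)) <|
  .seq (.add (2 * t + 3) (2 * t + 3) (2 * t + 3)) <|
  .seq (.add (2 * t + 3) (2 * t + 3) (2 * t + 3)) <|
  .seq (.const (2 * t + 5) a.ctorIdx) <|
  .seq (.add (2 * t + 3) (2 * t + 3) (2 * t + 5)) <|
  .add (2 * t + 3) (2 * t + 3) 1

/-- Evaluate an expression into register `2 * t + 3`, with the odd registers from there on as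
scratch space. -/
def Ex.comp : Ex → ℕ → Prog
  | num c, t => .const (2 * t + 3) c
  | var x, t => .copy (2 * t + 3) x.reg
  | add e e', t => .seq (e.comp t) <| .seq (e'.comp (t + 1)) <|
      .add (2 * t + 3) (2 * t + 3) (2 * t + 5)
  | inp e, t => .seq (e.comp t) <|
      .ifLt (2 * t + 3) 1 (.load (2 * t + 3) (2 * t + 3)) (.const (2 * t + 3) 0)
  | get a e, t => .seq (e.comp t) <| .seq (addrProg a t) <| .load (2 * t + 3) (2 * t + 3)

/-- The machine program of a statement. -/
def Stmt.comp : Stmt → Prog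
  | skip => .skip
  | assign x e => .seq (e.comp 0) (.copy x.reg 3)
  | put a i e => .seq (i.comp 0) <| .seq (addrProg a 0) <| .seq (e.comp 1) <| .store 3 5
  | seq P P' => .seq P.comp P'.comp
  | ite e e' P P' => .seq (e.comp 0) <| .seq (e'.comp 1) <| .ifLt 3 5 P.comp P'.comp
  | loop x b P => .seq (.const x.reg 0) <| .whileLt x.reg b.reg <|
      .seq P.comp <| .seq (.const 3 1) <| .add x.reg x.reg 3

/-- The machine state `S` represents the store `σ`: the input lies below the address `base`, and
the cell `i` of array `a` has the address `base + 16 * i + a.ctorIdx`. -/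
structure Rep (I : ℕ → ℕ) (base : ℕ) (σ : Store) (S : MState) : Prop where
  var : ∀ x : Var, S.reg x.reg = σ.var x
  base_eq : S.reg 1 = base
  inp : ∀ a < base, S.mem a = I a
  arr : ∀ a i, S.mem (base + 16 * i + a.ctorIdx) = σ.arr a i

lemma MState.setReg_reg (S : MState) (r x r' : ℕ) :
    (S.setReg r x).reg r' = if r' = r then x else S.reg r' := by
  simp [MState.setReg, Function.update_apply]

lemma MState.setMem_mem (S : MState) (a x a' : ℕ) :
    (S.setMem a x).mem a' = if a' = a then x else S.mem a' := by
  simp [MState.setMem, Function.update_apply]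

@[simp] lemma MState.setReg_mem (S : MState) (r x : ℕ) : (S.setReg r x).mem = S.mem := rfl

@[simp] lemma MState.setMem_reg (S : MState) (a x : ℕ) : (S.setMem a x).reg = S.reg := rfl

lemma Rep.of_eq {I : ℕ → ℕ} {base : ℕ} {σ : Store} {S S' : MState} (h : Rep I base σ S)
    (hm : S'.mem = S.mem) (hr : ∀ r, (∀ u, r ≠ 2 * u + 3) → S'.reg r = S.reg r) :
    Rep I base σ S' where
  var x := by rw [hr _ (fun u => by unfold Var.reg; omega), h.var]
  base_eq := by rw [hr _ (fun u => by omega), h.base_eq]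
  inp a ha := by rw [hm, h.inp a ha]
  arr a i := by rw [hm, h.arr]

lemma exec_addrProg (a : Arr) (t : ℕ) (S : MState) :
    ∃ S', Exec (addrProg a t) S 7 S' ∧ S'.mem = S.mem ∧
      S'.reg (2 * t + 3) = S.reg 1 + 16 * S.reg (2 * t + 3) + a.ctorIdx ∧
      ∀ r, (∀ u ≥ t, r ≠ 2 * u + 3) → S'.reg r = S.reg r := by
  refine ⟨_, .seq (.add ..) (.seq (.add ..) (.seq (.add ..) (.seq (.add ..) (.seq (.const ..)
    (.seq (.add ..) (.add ..)))))), rfl, ?_, ?_⟩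
  · simp [MState.setReg_reg]
    ring
  · intro r hr
    have h1 := hr t le_rfl
    have h2 := hr (t + 1) (by omega)
    have h3 : r ≠ 2 * t + 5 := by omega
    simp [MState.setReg_reg, h1, h3]

lemma Ex.exec_comp {I : ℕ → ℕ} {base : ℕ} (hI : ∀ a, base ≤ a → I a = 0) {σ : Store} (e : Ex) :
    ∀ (t : ℕ) (S : MState), Rep I base σ S →
    ∃ S', Exec (e.comp t) S e.cost S' ∧ S'.mem = S.mem ∧ S'.reg (2 * t + 3) = e.eval I σ ∧
      ∀ r, (∀ u ≥ t, r ≠ 2 * u + 3) → S'.reg r = S.reg r := by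
  induction e with
  | num c =>
    intro t S _
    exact ⟨_, .const .., rfl, by simp [MState.setReg_reg, eval], fun r hr => by
      simp [MState.setReg_reg, hr t le_rfl]⟩
  | var x =>
    intro t S h
    exact ⟨_, .copy .., rfl, by simp [MState.setReg_reg, eval, h.var], fun r hr => by
      simp [MState.setReg_reg, hr t le_rfl]⟩
  | add e e' ih ih' =>
    intro t S h
    obtain ⟨S₁, h₁, hm₁, hv₁, hr₁⟩ := ih t S h
    obtain ⟨S₂, h₂, hm₂, hv₂, hr₂⟩ := ih' (t + 1) S₁
      (h.of_eq hm₁ fun r hr => hr₁ r fun u _ => hr u)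
    refine ⟨_, .seq h₁ (.seq h₂ (.add ..)), hm₂.trans hm₁, ?_, fun r hr => ?_⟩
    · have h3 := hr₂ (2 * t + 3) fun u hu => by omega
      have h5 : S₂.reg (2 * t + 5) = eval I σ e' := hv₂
      simp [MState.setReg_reg, eval, h3, hv₁, h5]
    · simp only [MState.setReg_reg, hr t le_rfl, if_false]
      rw [hr₂ r fun u hu => hr u (by omega), hr₁ r hr]
  | inp e ih =>
    intro t S h
    obtain ⟨S₁, h₁, hm₁, hv₁, hr₁⟩ := ih t S h
    have hb : S₁.reg 1 = base := (h.of_eq hm₁ fun r hr => hr₁ r fun u _ => hr u).base_eq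
    by_cases hlt : S₁.reg (2 * t + 3) < S₁.reg 1
    · refine ⟨_, .seq h₁ (.ifTrue hlt (.load ..)), hm₁, ?_, fun r hr => ?_⟩
      · rw [hv₁, hb] at hlt
        simp [MState.setReg_reg, hv₁, hm₁, h.inp _ hlt, eval]
      · simp only [MState.setReg_reg, hr t le_rfl, if_false]
        rw [hr₁ r hr]
    · refine ⟨_, .seq h₁ (.ifFalse hlt (.const ..)), hm₁, ?_, fun r hr => ?_⟩
      · rw [hv₁, hb] at hlt
        simp [MState.setReg_reg, hI _ (not_lt.1 hlt), eval]
      · simp only [MState.setReg_reg, hr t le_rfl, if_false]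
        rw [hr₁ r hr]
  | get a e ih =>
    intro t S h
    obtain ⟨S₁, h₁, hm₁, hv₁, hr₁⟩ := ih t S h
    have hb : S₁.reg 1 = base := (h.of_eq hm₁ fun r hr => hr₁ r fun u _ => hr u).base_eq
    obtain ⟨S₂, h₂, hm₂, hv₂, hr₂⟩ := exec_addrProg a t S₁
    refine ⟨_, .seq h₁ (.seq h₂ (.load ..)), hm₂.trans hm₁, ?_, fun r hr => ?_⟩
    · simp [MState.setReg_reg, hv₂, hv₁, hm₂, hm₁, hb, h.arr, eval]
    · simp only [MState.setReg_reg, hr t le_rfl, if_false]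
      rw [hr₂ r hr, hr₁ r hr]

lemma Rep.set {I : ℕ → ℕ} {base : ℕ} {σ : Store} {S : MState} (h : Rep I base σ S) (x : Var)
    (c : ℕ) : Rep I base (σ.set x c) (S.setReg x.reg c) where
  var y := by
    simp only [MState.setReg_reg, Var.reg_inj]
    by_cases hy : y = x
    · subst hy; simp
    · simp [hy, h.var]
  base_eq := by
    rw [MState.setReg_reg, if_neg (by unfold Var.reg; omega), h.base_eq]
  inp := h.inp
  arr := h.arr

lemma Rep.put {I : ℕ → ℕ} {base : ℕ} {σ : Store} {S : MState} (h : Rep I base σ S) (a : Arr)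
    (i c : ℕ) : Rep I base (σ.put a i c) (S.setMem (base + 16 * i + a.ctorIdx) c) where
  var := h.var
  base_eq := h.base_eq
  inp b hb := by rw [MState.setMem_mem, if_neg (by omega), h.inp b hb]
  arr b j := by
    have ha := a.ctorIdx_lt
    have hb := b.ctorIdx_lt
    rw [MState.setMem_mem, h.arr]
    by_cases hab : b = a
    · subst hab
      rw [Store.put_arr_self, Function.update_apply]
      congr 1
      simp
    · have : b.ctorIdx ≠ a.ctorIdx := fun h' => hab (Arr.ctorIdx_inj.1 h')
      rw [Store.put_arr_of_ne _ _ _ hab, if_neg (by omega)]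

/-- The machine program of a statement computes its effect within the stated number of steps,
provided that the loop bounds do not change meanwhile. -/
theorem Stmt.exec_comp {I : ℕ → ℕ} {base : ℕ} (hI : ∀ a, base ≤ a → I a = 0) (p : Var → ℕ)
    (P : Stmt) : P.ok → (∀ b ∈ P.bounds, b ∉ P.mods) → ∀ (σ : Store) (S : MState),
    (∀ b ∈ P.bounds, σ.var b = p b) → Rep I base σ S →
    ∃ t S', Exec P.comp S t S' ∧ t ≤ P.cost p ∧ Rep I base (P.den I σ) S' := by
  induction P with
  | skip => exact fun _ _ σ S _ h => ⟨_, _, .skip _, le_rfl, h⟩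
  | assign x e =>
    intro _ _ σ S _ h
    obtain ⟨S₁, h₁, hm₁, hv₁, hr₁⟩ := e.exec_comp hI 0 S h
    refine ⟨_, _, .seq h₁ (.copy ..), le_rfl, ?_⟩
    rw [show S₁.reg 3 = e.eval I σ from hv₁]
    exact (h.of_eq hm₁ fun r hr => hr₁ r fun u _ => hr u).set x (e.eval I σ)
  | put a i e =>
    intro _ _ σ S _ h
    obtain ⟨S₁, h₁, hm₁, hv₁, hr₁⟩ := i.exec_comp hI 0 S h
    have hR₁ := h.of_eq hm₁ fun r hr => hr₁ r fun u _ => hr u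
    obtain ⟨S₂, h₂, hm₂, hv₂, hr₂⟩ := exec_addrProg a 0 S₁
    have hR₂ := hR₁.of_eq hm₂ fun r hr => hr₂ r fun u _ => hr u
    obtain ⟨S₃, h₃, hm₃, hv₃, hr₃⟩ := e.exec_comp hI 1 S₂ hR₂
    have hR₃ := hR₂.of_eq hm₃ fun r hr => hr₃ r fun u _ => hr u
    refine ⟨_, _, .seq h₁ (.seq h₂ (.seq h₃ (.store ..))), by simp only [cost]; omega, ?_⟩
    have h3 : S₃.reg 3 = base + 16 * i.eval I σ + a.ctorIdx := by
      rw [hr₃ 3 fun u hu => by omega, hv₂, hR₁.base_eq, hv₁]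
    have h5 : S₃.reg 5 = e.eval I σ := hv₃
    rw [h3, h5]
    exact hR₃.put _ _ _
  | seq P P' ih ih' =>
    intro hok hd σ S hp h
    simp only [ok, Bool.and_eq_true] at hok
    simp only [bounds, mods, List.mem_append] at hd hp
    obtain ⟨t₁, S₁, h₁, ht₁, hR₁⟩ := ih hok.1 (fun b hb hm => hd b (.inl hb) (.inl hm)) σ S
      (fun b hb => hp b (.inl hb)) h
    obtain ⟨t₂, S₂, h₂, ht₂, hR₂⟩ := ih' hok.2 (fun b hb hm => hd b (.inr hb) (.inr hm)) _ S₁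
      (fun b hb => by rw [P.den_var I σ fun hm => hd b (.inr hb) (.inl hm), hp b (.inr hb)]) hR₁
    exact ⟨_, _, .seq h₁ h₂, add_le_add ht₁ ht₂, hR₂⟩
  | ite e e' P P' ih ih' =>
    intro hok hd σ S hp h
    simp only [ok, Bool.and_eq_true] at hok
    simp only [bounds, mods, List.mem_append] at hd hp
    obtain ⟨S₁, h₁, hm₁, hv₁, hr₁⟩ := e.exec_comp hI 0 S h
    have hR₁ := h.of_eq hm₁ fun r hr => hr₁ r fun u _ => hr u
    obtain ⟨S₂, h₂, hm₂, hv₂, hr₂⟩ := e'.exec_comp hI 1 S₁ hR₁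
    have hR₂ := hR₁.of_eq hm₂ fun r hr => hr₂ r fun u _ => hr u
    have h3 : S₂.reg 3 = e.eval I σ := by rw [hr₂ 3 fun u hu => by omega]; exact hv₁
    have h5 : S₂.reg 5 = e'.eval I σ := hv₂
    simp only [den]
    by_cases hlt : e.eval I σ < e'.eval I σ
    · obtain ⟨t₃, S₃, h₃, ht₃, hR₃⟩ := ih hok.1 (fun b hb hm => hd b (.inl hb) (.inl hm)) σ S₂
        (fun b hb => hp b (.inl hb)) hR₂
      refine ⟨_, _, .seq h₁ (.seq h₂ (.ifTrue (by rwa [h3, h5]) h₃)), ?_, by rwa [if_pos hlt]⟩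
      simp only [cost]
      omega
    · obtain ⟨t₃, S₃, h₃, ht₃, hR₃⟩ := ih' hok.2 (fun b hb hm => hd b (.inr hb) (.inr hm)) σ S₂
        (fun b hb => hp b (.inr hb)) hR₂
      refine ⟨_, _, .seq h₁ (.seq h₂ (.ifFalse (by rwa [h3, h5]) h₃)), ?_, by rwa [if_neg hlt]⟩
      simp only [cost]
      omega
  | loop x b P ih =>
    intro hok hd σ S hp h
    simp only [ok, Bool.and_eq_true, decide_eq_true_eq] at hok
    simp only [bounds, mods, List.mem_cons, not_or] at hd hp
    set f : ℕ → Store → Store := fun i τ => P.den I (τ.set x i) with hf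
    have hagree : ∀ i, Agree (x :: P.mods) P.amods σ (iter f i σ) := fun i =>
      agree_iter (fun i τ => (agree_set _ _ (by simp)).trans
        ((P.agree_den I _).mono (by simp) (by simp))) σ i
    have hbx : ∀ c ∈ P.bounds, c ≠ x := fun c hc => (hd c (.inr hc)).1
    have hb : b ≠ x ∧ b ∉ P.mods := hd b (.inl rfl)
    have key : ∀ (l i : ℕ), i + l = σ.var b → ∀ S, Rep I base ((iter f i σ).set x i) S →
        ∃ t S', Exec (.whileLt x.reg b.reg <| .seq P.comp <| .seq (.const 3 1) <|
          .add x.reg x.reg 3) S t S' ∧ t ≤ l * (P.cost p + 3) + 1 ∧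
          Rep I base ((iter f (σ.var b) σ).set x (σ.var b)) S' := by
      intro l
      induction l with
      | zero =>
        intro i hi S hS
        obtain rfl : i = σ.var b := by omega
        refine ⟨1, S, .whileFalse ?_, by simp, hS⟩
        rw [hS.var, hS.var]
        simp [hb.1, (hagree _).1 b (by simp [hb])]
      | succ l ihl =>
        intro i hi S hS
        obtain ⟨t₁, S₁, h₁, ht₁, hR₁⟩ := ih hok.2 (fun c hc => (hd c (.inr hc)).2) _ S
          (fun c hc => by
            rw [Store.set_var_of_ne _ _ (hbx c hc), (hagree i).1 c
              (by simpa using hd c (.inr hc)), hp c (.inr hc)]) hS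
        have hx₁ : S₁.reg x.reg = i := by
          rw [hR₁.var, P.den_var I _ hok.1]; simp
        have hR₂ : Rep I base (P.den I ((iter f i σ).set x i)) (S₁.setReg 3 1) :=
          hR₁.of_eq rfl fun r hr => by simp [MState.setReg_reg, hr 0]
        have hR₃ := hR₂.set x (i + 1)
        obtain ⟨t₂, S₂, h₂, ht₂, hR₄⟩ := ihl (i + 1) (by omega) _ hR₃
        have hx3 : x.reg ≠ 3 := by unfold Var.reg; omega
        have hsum : (S₁.setReg 3 1).reg x.reg + (S₁.setReg 3 1).reg 3 = i + 1 := by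
          simp [MState.setReg_reg, hx3, hx₁]
        rw [← hsum] at h₂
        refine ⟨t₁ + (1 + 1) + t₂ + 1, S₂,
          .whileTrue ?_ (.seq h₁ (.seq (.const ..) (.add ..))) h₂, ?_, hR₄⟩
        · rw [hS.var, hS.var]
          simp only [Store.set_var_self, Store.set_var_of_ne _ _ hb.1,
            (hagree i).1 b (by simp [hb])]
          omega
        · rw [add_mul]
          omega
    obtain ⟨t, S', h', ht, hR⟩ := key (σ.var b) 0 (by omega) _ (h.set x 0)
    refine ⟨_, S', .seq (.const ..) h', ?_, hR⟩
    rw [cost, ← hp b (.inl rfl)]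
    omega

open WeightedLimit.Ex (var num inp get)

attribute [simp] Ex.eval Stmt.den

/-! ### Relaxing the edges of the product -/

/-- Relax the edge number `e`. -/
def relaxEdge : Stmt :=
  .assign .z (get .src (var .e)) ;;
  .assign .val (get .wgt (var .e) + get .rem (get .dst (var .e))) ;;
  .ite (get .own (var .z)) (num 1)
    (.ite (var .val) (get .acc (var .z))
      (.put .acc (var .z) (var .val) ;; .put .cho (var .z) (get .dsv (var .e)))
      .skip)
    (.ite (get .acc (var .z)) (var .val) (.put .acc (var .z) (var .val)) .skip)

/-- Compute in `acc` the weight that a move from each position costs if the rest costs `rem`, and in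
`cho` the chosen move. Player `0` may also give up, at cost `INF`. -/
def relaxProg : Stmt :=
  .loop .u .N (.ite (get .own (var .u)) (num 1)
    (.put .acc (var .u) (var .INF))
    (.put .acc (var .u) (num 0))) ;;
  .loop .e .PE relaxEdge

/-- The cost of a move along the edge `e`. -/
def Store.via (σ : Store) (e : ℕ) : ℕ := σ.arr .wgt e + σ.arr .rem (σ.arr .dst e)

lemma relaxEdge_spec (I : ℕ → ℕ) (τ : Store) (k x : ℕ) :
    (relaxEdge.den I (τ.set .e k)).arr .acc x =
      (if τ.arr .src k = x then
        (if τ.arr .own x < 1 then min (τ.via k) (τ.arr .acc x) else max (τ.via k) (τ.arr .acc x))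
      else τ.arr .acc x) ∧
    (relaxEdge.den I (τ.set .e k)).arr .cho x =
      if τ.arr .src k = x ∧ τ.arr .own x < 1 ∧ τ.via k < τ.arr .acc x then τ.arr .dsv k
      else τ.arr .cho x := by
  have ev : τ.arr .wgt k + τ.arr .rem (τ.arr .dst k) = τ.via k := rfl
  simp only [relaxEdge, Stmt.den, Ex.eval, Store.set_arr, Store.set_var_self, ev,
    ne_eq, reduceCtorEq, not_false_eq_true, Store.set_var_of_ne]
  generalize τ.via k = c
  by_cases hx : τ.arr .src k = x
  · subst hx
    by_cases h1 : τ.arr .own (τ.arr .src k) < 1 <;>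
      by_cases h2 : c < τ.arr .acc (τ.arr .src k) <;>
      by_cases h3 : τ.arr .acc (τ.arr .src k) < c <;> simp [h1, h2, h3] <;> omega
  · by_cases h1 : τ.arr .own (τ.arr .src k) < 1 <;>
      by_cases h2 : c < τ.arr .acc (τ.arr .src k) <;>
      by_cases h3 : τ.arr .acc (τ.arr .src k) < c <;>
      simp [h1, h2, h3, hx, Ne.symm hx]

/-- After the relaxation, `acc` holds the least cost of a move of Player `0`, or `INF` if this is
less, resp. the greatest cost of a move of Player `1`. -/
lemma relaxProg_spec (I : ℕ → ℕ) (σ : Store) :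
    (∀ x < σ.var .N, σ.arr .own x < 1 →
      (relaxProg.den I σ).arr .acc x ≤ σ.var .INF ∧
      (∀ e < σ.var .PE, σ.arr .src e = x → (relaxProg.den I σ).arr .acc x ≤ σ.via e) ∧
      ((relaxProg.den I σ).arr .acc x < σ.var .INF → ∃ e < σ.var .PE, σ.arr .src e = x ∧
        (relaxProg.den I σ).arr .acc x = σ.via e ∧
        (relaxProg.den I σ).arr .cho x = σ.arr .dsv e)) ∧
    (∀ x < σ.var .N, ¬ σ.arr .own x < 1 →
      (∀ e < σ.var .PE, σ.arr .src e = x → σ.via e ≤ (relaxProg.den I σ).arr .acc x) ∧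
      ((relaxProg.den I σ).arr .acc x = 0 ∨ ∃ e < σ.var .PE, σ.arr .src e = x ∧
        (relaxProg.den I σ).arr .acc x = σ.via e)) ∧
    (∀ x, (relaxProg.den I σ).arr .cho x = σ.arr .cho x ∨
      ∃ e < σ.var .PE, σ.arr .src e = x ∧ (relaxProg.den I σ).arr .cho x = σ.arr .dsv e) := by
  rw [relaxProg, Stmt.den]
  set P := Stmt.loop .u .N (.ite (get .own (var .u)) (num 1)
    (.put .acc (var .u) (var .INF))
    (.put .acc (var .u) (num 0))) with hP
  have h1 : ∀ x < σ.var .N, (P.den I σ).arr .acc x =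
      if σ.arr .own x < 1 then σ.var .INF else 0 := by
    obtain ⟨τ, hτ, he⟩ := Stmt.loop_rule (I := I) (x := .u) (b := .N) (σ := σ)
      (P := .ite (get .own (var .u)) (num 1)
        (.put .acc (var .u) (var .INF)) (.put .acc (var .u) (num 0)))
      (fun k τ => ∀ x < k, τ.arr .acc x = if σ.arr .own x < 1 then σ.var .INF else 0)
      (by simp) (by
        intro k _ τ hA ih x hx
        have e1 := hA.2 .own (by decide)
        have e2 := hA.1 .INF (by decide)
        by_cases hk : σ.arr .own k < 1
        · rcases Nat.lt_succ_iff_lt_or_eq.1 hx with hx | rfl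
          · simp [e1, hk, hx.ne, ih x hx]
          · simp [e1, e2, hk]
        · rcases Nat.lt_succ_iff_lt_or_eq.1 hx with hx | rfl
          · simp [e1, hk, hx.ne, ih x hx]
          · simp [e1, hk])
    rw [he]
    exact hτ
  have hA1 := P.agree_den I σ
  generalize P.den I σ = σ₁ at h1 hA1
  obtain ⟨τ, hτ, he⟩ := Stmt.loop_rule (I := I) (x := .e) (b := .PE) (σ := σ₁)
    (P := relaxEdge)
    (fun k τ =>
      (∀ x < σ.var .N, σ.arr .own x < 1 → τ.arr .acc x ≤ σ.var .INF ∧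
        (∀ e < k, σ.arr .src e = x → τ.arr .acc x ≤ σ.via e) ∧
        (τ.arr .acc x < σ.var .INF → ∃ e < k, σ.arr .src e = x ∧
          τ.arr .acc x = σ.via e ∧ τ.arr .cho x = σ.arr .dsv e)) ∧
      (∀ x < σ.var .N, ¬ σ.arr .own x < 1 →
        (∀ e < k, σ.arr .src e = x → σ.via e ≤ τ.arr .acc x) ∧
        (τ.arr .acc x = 0 ∨ ∃ e < k, σ.arr .src e = x ∧ τ.arr .acc x = σ.via e)) ∧
      (∀ x, τ.arr .cho x = σ.arr .cho x ∨
        ∃ e < k, σ.arr .src e = x ∧ τ.arr .cho x = σ.arr .dsv e))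
    (by
      refine ⟨fun x hx ho => ?_, fun x hx ho => ?_, fun x => ?_⟩
      · simp [h1 x hx, ho]
      · simp [h1 x hx, ho]
      · simp [hA1.2 .cho (by decide)])
    (by
      intro k _ τ hA ⟨ih0, ih1, ihc⟩
      have hA' := (hA1.mono (ys := .u :: .e :: [.z, .val]) (bs := [.acc, .cho])
        (by decide) (by decide)).trans (hA.mono (by decide) (by decide))
      have e1 := hA'.2 .src (by decide)
      have e2 := hA'.2 .wgt (by decide)
      have e3 := hA'.2 .rem (by decide)
      have e4 := hA'.2 .dst (by decide)
      have e5 := hA'.2 .own (by decide)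
      have e6 := hA'.2 .dsv (by decide)
      have ev : τ.via k = σ.via k := by simp only [Store.via, e2, e3, e4]
      have hacc := fun x => (relaxEdge_spec I τ k x).1
      have hcho := fun x => (relaxEdge_spec I τ k x).2
      simp only [e1, e5, e6, ev] at hacc hcho
      set κ := σ.arr .src k with hκ
      generalize relaxEdge.den I (τ.set .e k) = υ at hacc hcho
      refine ⟨fun x hx ho => ?_, fun x hx ho => ?_, fun x => ?_⟩
      · obtain ⟨h1, h2, h3⟩ := ih0 x hx ho
        rw [hacc, hcho]
        by_cases hx : κ = x
        · simp only [hx, ho, if_true, true_and]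
          refine ⟨by omega, fun e he hs => ?_, fun hlt => ?_⟩
          · rcases Nat.lt_succ_iff_lt_or_eq.1 he with he | rfl
            · have := h2 e he hs; omega
            · omega
          · by_cases hv : σ.via k < τ.arr .acc x
            · exact ⟨k, by omega, hx, by omega, by simp [hv]⟩
            · obtain ⟨e, he, hs, h4, h5⟩ := h3 (by omega)
              exact ⟨e, by omega, hs, by omega, by simp [hv, h5]⟩
        · simp only [hx, if_false, false_and]
          refine ⟨h1, fun e he hs => ?_, fun hlt => ?_⟩
          · rcases Nat.lt_succ_iff_lt_or_eq.1 he with he | rfl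
            · exact h2 e he hs
            · exact absurd hs hx
          · obtain ⟨e, he, h⟩ := h3 hlt
            exact ⟨e, by omega, h⟩
      · obtain ⟨h2, h3⟩ := ih1 x hx ho
        rw [hacc]
        by_cases hx : κ = x
        · simp only [hx, ho, if_true, if_false]
          refine ⟨fun e he hs => ?_, ?_⟩
          · rcases Nat.lt_succ_iff_lt_or_eq.1 he with he | rfl
            · have := h2 e he hs; omega
            · omega
          · by_cases hv : τ.arr .acc x < σ.via k
            · exact .inr ⟨k, by omega, hx, by omega⟩
            · refine h3.imp (by omega) ?_
              rintro ⟨e, he, hs, h4⟩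
              exact ⟨e, by omega, hs, by omega⟩
        · simp only [hx, if_false]
          refine ⟨fun e he hs => ?_, h3.imp_right ?_⟩
          · rcases Nat.lt_succ_iff_lt_or_eq.1 he with he | rfl
            · exact h2 e he hs
            · exact absurd hs hx
          · rintro ⟨e, he, h⟩
            exact ⟨e, by omega, h⟩
      · rw [hcho]
        split_ifs with h
        · exact .inr ⟨k, by omega, h.1, rfl⟩
        · refine (ihc x).imp_right ?_
          rintro ⟨e, he, h⟩
          exact ⟨e, by omega, h⟩)
  rw [he]
  have e1 := hA1.1 .PE (by decide)
  rw [e1] at hτ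
  exact hτ

/-! ### Settling positions in the order of their distance -/

/-- A weighted graph given by a list of `PE` edges between the positions `x < N`. The entry `dsv e`
names the move along the edge `e`, and `INF` stands for infinity. -/
structure EdgeGraph where
  N : ℕ
  PE : ℕ
  INF : ℕ
  own : ℕ → ℕ
  src : ℕ → ℕ
  dst : ℕ → ℕ
  wgt : ℕ → ℕ
  dsv : ℕ → ℕ

/-- The graph in the arrays of a store. -/
def Store.graph (σ : Store) : EdgeGraph :=
  ⟨σ.var .N, σ.var .PE, σ.var .INF, σ.arr .own, σ.arr .src, σ.arr .dst, σ.arr .wgt, σ.arr .dsv⟩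

namespace EdgeGraph

/-- Every position has an outgoing edge, and `INF` exceeds the weight of every path with at most
`N + 1` edges, as `W` bounds the weights. -/
structure Valid (g : EdgeGraph) (W : ℕ) : Prop where
  dst_lt : ∀ e < g.PE, g.dst e < g.N
  exists_src : ∀ x < g.N, ∃ e < g.PE, g.src e = x
  wgt_le : ∀ e < g.PE, g.wgt e ≤ W
  lt_INF : (g.N + 1) * W < g.INF

/-- The entries of `f` are moves along edges. -/
def IsMove (g : EdgeGraph) (f : ℕ → ℕ) : Prop :=
  ∀ x < g.N, ∃ e < g.PE, g.src e = x ∧ f x = g.dsv e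

/-- The cost `rem` that remains on arrival is correct at `x` along the move `f x`, resp. all moves,
and the rank `r` decreases unless the target `T` is reached. -/
structure Attracts (g : EdgeGraph) (T dis rem nxt r : ℕ → ℕ) : Prop where
  up0 : ∀ x < g.N, dis x < g.INF → g.own x < 1 → ∃ e < g.PE, g.src e = x ∧ nxt x = g.dsv e ∧
    g.wgt e + rem (g.dst e) ≤ dis x ∧ (¬ T (g.dst e) < 1 ∨ r (g.dst e) < r x)
  up1 : ∀ x < g.N, dis x < g.INF → ¬ g.own x < 1 → ∀ e < g.PE, g.src e = x →
    g.wgt e + rem (g.dst e) ≤ dis x ∧ (¬ T (g.dst e) < 1 ∨ r (g.dst e) < r x)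

/-- The distances of the settled positions, those with `dis x < INF`, cannot be undercut. -/
structure Resists (g : EdgeGraph) (dis rem : ℕ → ℕ) : Prop where
  lo0 : ∀ x < g.N, dis x < g.INF → g.own x < 1 → ∀ e < g.PE, g.src e = x →
    dis x ≤ g.wgt e + rem (g.dst e)
  lo1 : ∀ x < g.N, dis x < g.INF → ¬ g.own x < 1 → ∃ e < g.PE, g.src e = x ∧
    dis x ≤ g.wgt e + rem (g.dst e)

/-- Moves from the positions that are not settled cost at least `c`. -/
structure Frontier (g : EdgeGraph) (dis rem : ℕ → ℕ) (c : ℕ) : Prop where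
  fr0 : ∀ x < g.N, ¬ dis x < g.INF → g.own x < 1 → ∀ e < g.PE, g.src e = x →
    c ≤ g.wgt e + rem (g.dst e)
  fr1 : ∀ x < g.N, ¬ dis x < g.INF → ¬ g.own x < 1 → ∃ e < g.PE, g.src e = x ∧
    c ≤ g.wgt e + rem (g.dst e)

/-- The invariant after `k` phases, in which positions of distance at most `c` have been settled.
Either nothing is left to settle, or every phase has settled a position. -/
structure SettleInv (g : EdgeGraph) (W : ℕ) (T : ℕ → ℕ) (k : ℕ) (dis rem nxt r : ℕ → ℕ) (c : ℕ) :
    Prop where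
  rem_eq : ∀ x < g.N, rem x = if T x < 1 then dis x else 0
  dis_or : ∀ x < g.N, dis x ≤ c ∧ r x < k ∨ dis x = g.INF
  le_mul : c ≤ k * W
  attracts : g.Attracts T dis rem nxt r
  resists : g.Resists dis rem
  frontier : g.Frontier dis rem c
  progress : g.Frontier dis rem g.INF ∨ k ≤ ((Finset.range g.N).filter (dis · < g.INF)).card

/-- The values computed by a relaxation. -/
structure Relaxed (g : EdgeGraph) (dis rem acc cho : ℕ → ℕ) : Prop where
  le0 : ∀ x < g.N, g.own x < 1 → ∀ e < g.PE, g.src e = x → acc x ≤ g.wgt e + rem (g.dst e)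
  ex0 : ∀ x < g.N, g.own x < 1 → acc x < g.INF → ∃ e < g.PE, g.src e = x ∧
    acc x = g.wgt e + rem (g.dst e) ∧ cho x = g.dsv e
  le1 : ∀ x < g.N, ¬ g.own x < 1 → ∀ e < g.PE, g.src e = x → g.wgt e + rem (g.dst e) ≤ acc x
  ex1 : ∀ x < g.N, ¬ g.own x < 1 → ∃ e < g.PE, g.src e = x ∧ acc x = g.wgt e + rem (g.dst e)

variable {g : EdgeGraph} {W : ℕ} {T dis rem nxt acc cho r : ℕ → ℕ} {k c : ℕ}

/-- A phase that finds no position of finite cost proves that nothing is left to settle. -/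
lemma SettleInv.skip (h : g.SettleInv W T k dis rem nxt r c)
    (hR : g.Relaxed dis rem acc cho) (hb : ∀ x < g.N, ¬ dis x < g.INF → g.INF ≤ acc x) :
    g.SettleInv W T (k + 1) dis rem nxt r c where
  rem_eq := h.rem_eq
  dis_or x hx := (h.dis_or x hx).imp_left fun ⟨h1, h2⟩ => ⟨h1, by omega⟩
  le_mul := h.le_mul.trans (Nat.mul_le_mul_right _ (by omega))
  attracts := h.attracts
  resists := h.resists
  frontier := h.frontier
  progress := by
    refine .inl ⟨fun x hx hd ho e he hs => (hb x hx hd).trans (hR.le0 x hx ho e he hs),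
      fun x hx hd ho => ?_⟩
    obtain ⟨e, he, hs, h'⟩ := hR.ex1 x hx ho
    exact ⟨e, he, hs, h' ▸ hb x hx hd⟩

/-- Settling a position `b` of least cost preserves the invariant. -/
lemma SettleInv.settle (hg : g.Valid W) (h : g.SettleInv W T k dis rem nxt r c) (hk : k < g.N)
    (hR : g.Relaxed dis rem acc cho) {b : ℕ} (hbN : b < g.N) (hbd : ¬ dis b < g.INF)
    (hbI : acc b < g.INF) (hb : ∀ x < g.N, ¬ dis x < g.INF → acc b ≤ acc x) :
    g.SettleInv W T (k + 1) (Function.update dis b (acc b))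
      (if T b < 1 then Function.update rem b (acc b) else rem)
      (Function.update nxt b (cho b)) (Function.update r b k) (acc b) := by
  set rem' := if T b < 1 then Function.update rem b (acc b) else rem with hrem'
  -- The remaining cost changes only at `b`, where it was infinite.
  have hrb : T b < 1 → rem b = g.INF := fun ht => by
    rw [h.rem_eq b hbN, if_pos ht]
    rcases h.dis_or b hbN with h' | h'
    · have : g.INF ≤ c := by omega
      have h1 := h.le_mul
      have h2 := hg.lt_INF
      have h3 : k * W ≤ (g.N + 1) * W := Nat.mul_le_mul_right _ (by omega)
      omega
    · exact h'
  have hrem : ∀ y, rem' y = rem y ∨ y = b ∧ T b < 1 ∧ rem' y = acc b ∧ rem y = g.INF := by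
    intro y
    rw [hrem']
    by_cases ht : T b < 1
    · by_cases hy : y = b
      · subst hy; right; simp [ht, hrb ht]
      · left; simp [ht, hy]
    · left; simp [ht]
  have hlt : ∀ y, rem y < g.INF → rem' y = rem y := fun y hy => by
    rcases hrem y with h' | ⟨-, -, -, h'⟩
    · exact h'
    · omega
  have hck : ∀ x < g.N, dis x < g.INF → dis x ≤ c ∧ r x < k := fun x hx hd => by
    rcases h.dis_or x hx with h' | h'
    · exact h'
    · omega
  have hcI : c < g.INF := by
    have h1 := h.le_mul
    have h2 := hg.lt_INF
    have h3 : k * W ≤ (g.N + 1) * W := Nat.mul_le_mul_right _ (by omega)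
    omega
  have hcb : c ≤ acc b := by
    by_cases ho : g.own b < 1
    · obtain ⟨e, he, hs, h', -⟩ := hR.ex0 b hbN ho hbI
      exact h' ▸ h.frontier.fr0 b hbN hbd ho e he hs
    · obtain ⟨e, he, hs, h'⟩ := h.frontier.fr1 b hbN hbd ho
      exact h'.trans (hR.le1 b hbN ho e he hs)
  -- An edge of finite cost leads to a target, or to a position settled before `b`.
  have hrank : ∀ y < g.N, rem y < g.INF →
      ¬ T y < 1 ∨ Function.update r b k y = r y ∧ r y < k := fun y hy hr => by
    by_cases ht : T y < 1
    · right
      have hd := h.rem_eq y hy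
      rw [if_pos ht] at hd
      have hyb : y ≠ b := by rintro rfl; omega
      exact ⟨by simp [hyb], (hck y hy (by omega)).2⟩
    · exact .inl ht
  have hne : ∀ x, dis x < g.INF → x ≠ b := by rintro x hd rfl; exact hbd hd
  refine ⟨fun x hx => ?_, fun x hx => ?_, ?_, ⟨fun x hx hd ho => ?_, fun x hx hd ho e he hs => ?_⟩,
    ⟨fun x hx hd ho e he hs => ?_, fun x hx hd ho => ?_⟩,
    ⟨fun x hx hd ho e he hs => ?_, fun x hx hd ho => ?_⟩, ?_⟩
  · have := h.rem_eq x hx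
    rw [hrem']
    by_cases ht : T b < 1
    · by_cases hxb : x = b
      · subst hxb; simp [ht]
      · simp [ht, hxb, this]
    · by_cases hxb : x = b
      · subst hxb; simpa [ht] using this
      · simp [ht, hxb, this]
  · by_cases hxb : x = b
    · subst hxb; simp
    · simp only [Function.update_of_ne hxb]
      exact (h.dis_or x hx).imp_left fun ⟨h1, h2⟩ => ⟨by omega, by omega⟩
  · have : ∃ e < g.PE, acc b = g.wgt e + rem (g.dst e) := by
      by_cases ho : g.own b < 1
      · obtain ⟨e, he, hs, h', -⟩ := hR.ex0 b hbN ho hbI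
        exact ⟨e, he, h'⟩
      · obtain ⟨e, he, hs, h'⟩ := hR.ex1 b hbN ho
        exact ⟨e, he, h'⟩
    obtain ⟨e, he, h'⟩ := this
    have hw := hg.wgt_le e he
    have hy := hg.dst_lt e he
    have h1 := h.rem_eq _ hy
    have h2 := h.le_mul
    rw [add_mul, one_mul]
    split_ifs at h1
    · have := (hck _ hy (by omega)).1
      omega
    · omega
  · by_cases hxb : x = b
    · subst hxb
      obtain ⟨e, he, hs, h1, h2⟩ := hR.ex0 x hx ho hbI
      refine ⟨e, he, hs, by simpa using h2, ?_, ?_⟩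
      · rw [hlt _ (by omega)]
        simp [h1]
      · refine (hrank _ (hg.dst_lt e he) (by omega)).imp_right ?_
        rintro ⟨h3, h4⟩
        rw [h3]
        simpa using h4
    · simp only [Function.update_of_ne hxb] at hd ⊢
      obtain ⟨e, he, hs, h1, h2, h3⟩ := h.attracts.up0 x hx hd ho
      refine ⟨e, he, hs, h1, by rwa [hlt _ (by omega)], ?_⟩
      rcases hrank _ (hg.dst_lt e he) (by omega) with h4 | ⟨h4, -⟩
      · exact .inl h4
      · rwa [h4]
  · by_cases hxb : x = b
    · subst hxb
      have h1 := hR.le1 x hx ho e he hs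
      refine ⟨?_, ?_⟩
      · rw [hlt _ (by omega)]
        simpa using h1
      · refine (hrank _ (hg.dst_lt e he) (by omega)).imp_right ?_
        rintro ⟨h3, h4⟩
        rw [h3]
        simpa using h4
    · simp only [Function.update_of_ne hxb] at hd ⊢
      obtain ⟨h2, h3⟩ := h.attracts.up1 x hx hd ho e he hs
      refine ⟨by rwa [hlt _ (by omega)], ?_⟩
      rcases hrank _ (hg.dst_lt e he) (by omega) with h4 | ⟨h4, -⟩
      · exact .inl h4
      · rwa [h4]
  · by_cases hxb : x = b
    · subst hxb
      have := hR.le0 x hx ho e he hs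
      simp only [Function.update_self]
      rcases hrem (g.dst e) with h' | h' <;> omega
    · simp only [Function.update_of_ne hxb] at hd ⊢
      have := h.resists.lo0 x hx hd ho e he hs
      have := (hck x hx hd).1
      rcases hrem (g.dst e) with h' | h' <;> omega
  · by_cases hxb : x = b
    · subst hxb
      obtain ⟨e, he, hs, h'⟩ := hR.ex1 x hx ho
      exact ⟨e, he, hs, by simp only [Function.update_self]; rw [hlt _ (by omega), h']⟩
    · simp only [Function.update_of_ne hxb] at hd ⊢
      obtain ⟨e, he, hs, h'⟩ := h.resists.lo1 x hx hd ho
      have := (hck x hx hd).1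
      refine ⟨e, he, hs, ?_⟩
      rcases hrem (g.dst e) with h' | h' <;> omega
  · have hxb : x ≠ b := by rintro rfl; simp at hd; omega
    simp only [Function.update_of_ne hxb] at hd
    have h1 := hR.le0 x hx ho e he hs
    have h2 := hb x hx hd
    rcases hrem (g.dst e) with h' | h' <;> omega
  · have hxb : x ≠ b := by rintro rfl; simp at hd; omega
    simp only [Function.update_of_ne hxb] at hd
    obtain ⟨e, he, hs, h1⟩ := hR.ex1 x hx ho
    have h2 := hb x hx hd
    refine ⟨e, he, hs, ?_⟩
    rcases hrem (g.dst e) with h' | h' <;> omega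
  · right
    rcases h.progress with hF | hF
    · -- If nothing were left to settle, then `b` would not have finite cost.
      exfalso
      by_cases ho : g.own b < 1
      · obtain ⟨e, he, hs, h', -⟩ := hR.ex0 b hbN ho hbI
        have := hF.fr0 b hbN hbd ho e he hs
        omega
      · obtain ⟨e, he, hs, h'⟩ := hF.fr1 b hbN hbd ho
        have := hR.le1 b hbN ho e he hs
        omega
    · refine Nat.succ_le_of_lt (lt_of_le_of_lt hF (Finset.card_lt_card ?_))
      refine (Finset.ssubset_iff_of_subset fun x hx => ?_).2 ⟨b, ?_, by simp [hbd]⟩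
      · simp only [Finset.mem_filter] at hx ⊢
        rw [Function.update_of_ne (hne x hx.2)]
        exact hx
      · simp [hbN, hbI]

/-- `dis` are the distances to the targets `T` in the game on the graph, and `nxt` is an optimal
choice of moves for Player `0`. -/
structure IsDist (g : EdgeGraph) (T dis nxt : ℕ → ℕ) : Prop where
  attracts : ∃ r, g.Attracts T dis (fun x => if T x < 1 then dis x else 0) nxt r
  resists : g.Resists dis (fun x => if T x < 1 then dis x else 0)
  inf0 : ∀ x < g.N, ¬ dis x < g.INF → g.own x < 1 → ∀ e < g.PE, g.src e = x →
    T (g.dst e) < 1 ∧ ¬ dis (g.dst e) < g.INF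
  inf1 : ∀ x < g.N, ¬ dis x < g.INF → ¬ g.own x < 1 → ∃ e < g.PE, g.src e = x ∧
    T (g.dst e) < 1 ∧ ¬ dis (g.dst e) < g.INF

lemma Resists.congr {rem' : ℕ → ℕ} (hg : g.Valid W) (h : g.Resists dis rem)
    (hr : ∀ x < g.N, rem x = rem' x) : g.Resists dis rem' where
  lo0 x hx hd ho e he hs := hr _ (hg.dst_lt e he) ▸ h.lo0 x hx hd ho e he hs
  lo1 x hx hd ho := by
    obtain ⟨e, he, hs, h'⟩ := h.lo1 x hx hd ho
    exact ⟨e, he, hs, hr _ (hg.dst_lt e he) ▸ h'⟩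

lemma Attracts.congr {rem' : ℕ → ℕ} (hg : g.Valid W) (h : g.Attracts T dis rem nxt r)
    (hr : ∀ x < g.N, rem x = rem' x) : g.Attracts T dis rem' nxt r where
  up0 x hx hd ho := by
    obtain ⟨e, he, hs, h'⟩ := h.up0 x hx hd ho
    exact ⟨e, he, hs, hr _ (hg.dst_lt e he) ▸ h'⟩
  up1 x hx hd ho e he hs := hr _ (hg.dst_lt e he) ▸ h.up1 x hx hd ho e he hs

/-- As `INF` exceeds every finite distance by more than a single weight, a move of cost at least
`INF` leads to a position that is not settled. -/
lemma SettleInv.isDist (hg : g.Valid W) (h : g.SettleInv W T g.N dis rem nxt r c) :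
    g.IsDist T dis nxt := by
  have hF : g.Frontier dis rem g.INF := by
    rcases h.progress with h' | h'
    · exact h'
    · have hall : ∀ x < g.N, dis x < g.INF := by
        have := Finset.eq_of_subset_of_card_le (Finset.filter_subset (dis · < g.INF)
          (Finset.range g.N)) (by simpa using h')
        intro x hx
        have hx' : x ∈ (Finset.range g.N).filter (dis · < g.INF) := by
          rw [this]; simpa using hx
        exact (Finset.mem_filter.1 hx').2
      exact ⟨fun x hx hd => absurd (hall x hx) hd, fun x hx hd => absurd (hall x hx) hd⟩
  have hinf : ∀ e < g.PE, g.INF ≤ g.wgt e + rem (g.dst e) →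
      T (g.dst e) < 1 ∧ ¬ dis (g.dst e) < g.INF := by
    intro e he hle
    have h1 := hg.wgt_le e he
    have h2 := hg.lt_INF
    have h3 := h.rem_eq _ (hg.dst_lt e he)
    have h4 := h.le_mul
    rw [add_mul, one_mul] at h2
    split_ifs at h3 with ht
    · refine ⟨ht, fun hlt => ?_⟩
      rcases h.dis_or _ (hg.dst_lt e he) with h5 | h5 <;> omega
    · exfalso
      have : 0 ≤ g.N * W := Nat.zero_le _
      omega
  refine ⟨⟨r, h.attracts.congr hg h.rem_eq⟩, h.resists.congr hg h.rem_eq,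
    fun x hx hd ho e he hs => hinf e he (hF.fr0 x hx hd ho e he hs), fun x hx hd ho => ?_⟩
  obtain ⟨e, he, hs, h'⟩ := hF.fr1 x hx hd ho
  exact ⟨e, he, hs, hinf e he h'⟩

end EdgeGraph

/-- Let the position `u` replace `bx` if it is not settled and costs less than `best`. -/
def selectStep : Stmt :=
  .ite (get .dis (var .u)) (var .INF) .skip <|
  .ite (get .acc (var .u)) (var .best)
    (.assign .best (get .acc (var .u)) ;; .assign .bx (var .u)) .skip

/-- Find a position `bx` of least cost `best` among those that are not settled. -/
def selectProg : Stmt :=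
  .assign .best (var .INF) ;; .loop .u .N selectStep

/-- Settle the position `bx`, unless its cost is infinite. -/
def settleProg : Stmt :=
  .ite (var .best) (var .INF)
    (.put .dis (var .bx) (var .best) ;;
      .put .nxt (var .bx) (get .cho (var .bx)) ;;
      .ite (get .tgt (var .bx)) (num 1) (.put .rem (var .bx) (var .best)) .skip)
    .skip

/-- Compute the distances to the targets and optimal moves. -/
def distProg : Stmt :=
  .loop .u .N (
    .put .dis (var .u) (var .INF) ;;
    .put .nxt (var .u) (get .cho (var .u)) ;;
    .ite (get .tgt (var .u)) (num 1) (.put .rem (var .u) (var .INF))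
      (.put .rem (var .u) (num 0))) ;;
  .loop .ph .N (relaxProg ;; selectProg ;; settleProg)

lemma selectProg_spec (I : ℕ → ℕ) (σ : Store) :
    (∀ x < σ.var .N, ¬ σ.arr .dis x < σ.var .INF →
      (selectProg.den I σ).var .best ≤ σ.arr .acc x) ∧
    ((selectProg.den I σ).var .best < σ.var .INF → (selectProg.den I σ).var .bx < σ.var .N ∧
      ¬ σ.arr .dis ((selectProg.den I σ).var .bx) < σ.var .INF ∧
      (selectProg.den I σ).var .best = σ.arr .acc ((selectProg.den I σ).var .bx)) ∧
    (selectProg.den I σ).var .best ≤ σ.var .INF := by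
  obtain ⟨τ, hτ, he⟩ := Stmt.loop_rule (I := I) (x := .u) (b := .N) (P := selectStep)
    (σ := σ.set .best (σ.var .INF))
    (fun k τ => (∀ x < k, ¬ σ.arr .dis x < σ.var .INF → τ.var .best ≤ σ.arr .acc x) ∧
      (τ.var .best < σ.var .INF → τ.var .bx < k ∧ ¬ σ.arr .dis (τ.var .bx) < σ.var .INF ∧
        τ.var .best = σ.arr .acc (τ.var .bx)) ∧ τ.var .best ≤ σ.var .INF)
    (by simp) (by
      intro k _ τ hA ⟨ih1, ih2, ih3⟩
      have e1 := hA.2 .dis (by decide)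
      have e2 := hA.2 .acc (by decide)
      have e3 := hA.1 .INF (by decide)
      simp at e1 e2 e3
      by_cases h1 : σ.arr .dis k < σ.var .INF
      · simp only [selectStep, Stmt.den, Ex.eval, Store.set_arr, Store.set_var_self, e1, e3, h1,
          if_true, ne_eq, reduceCtorEq, not_false_eq_true, Store.set_var_of_ne]
        refine ⟨fun x hx hd => ?_, fun hb => ?_, ih3⟩
        · rcases Nat.lt_succ_iff_lt_or_eq.1 hx with hx | rfl
          · exact ih1 x hx hd
          · exact absurd h1 hd
        · obtain ⟨h2, h3, h4⟩ := ih2 hb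
          exact ⟨by omega, h3, h4⟩
      · by_cases h2 : σ.arr .acc k < τ.var .best
        · simp only [selectStep, Stmt.den, Ex.eval, Store.set_arr, Store.set_var_self, e1, e2, e3,
            h1, h2, if_true, if_false, ne_eq, reduceCtorEq, not_false_eq_true,
            Store.set_var_of_ne]
          refine ⟨fun x hx hd => ?_, fun _ => ⟨by omega, by simp⟩, by omega⟩
          rcases Nat.lt_succ_iff_lt_or_eq.1 hx with hx | rfl
          · have := ih1 x hx hd; omega
          · exact le_rfl
        · simp only [selectStep, Stmt.den, Ex.eval, Store.set_arr, Store.set_var_self, e1, e2, e3,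
            h1, h2, if_false, ne_eq, reduceCtorEq, not_false_eq_true, Store.set_var_of_ne]
          refine ⟨fun x hx hd => ?_, fun hb => ?_, ih3⟩
          · rcases Nat.lt_succ_iff_lt_or_eq.1 hx with hx | rfl
            · exact ih1 x hx hd
            · omega
          · obtain ⟨h2, h3, h4⟩ := ih2 hb
            exact ⟨by omega, h3, h4⟩)
  simp only [selectProg, Stmt.den, Ex.eval] at he ⊢
  rw [he]
  simpa using hτ

lemma settleProg_spec (I : ℕ → ℕ) (σ : Store) :
    (σ.var .best < σ.var .INF →
      (settleProg.den I σ).arr .dis = Function.update (σ.arr .dis) (σ.var .bx) (σ.var .best) ∧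
      (settleProg.den I σ).arr .nxt =
        Function.update (σ.arr .nxt) (σ.var .bx) (σ.arr .cho (σ.var .bx)) ∧
      (settleProg.den I σ).arr .rem = if σ.arr .tgt (σ.var .bx) < 1 then
        Function.update (σ.arr .rem) (σ.var .bx) (σ.var .best) else σ.arr .rem) ∧
    (¬ σ.var .best < σ.var .INF → settleProg.den I σ = σ) := by
  refine ⟨fun h => ?_, fun h => by simp [settleProg, h]⟩
  by_cases ht : σ.arr .tgt (σ.var .bx) < 1 <;> simp [settleProg, h, ht]

lemma Agree.graph_eq {xs : List Var} {as : List Arr} {σ τ : Store} (h : Agree xs as σ τ)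
    (hx : .N ∉ xs ∧ .PE ∉ xs ∧ .INF ∉ xs)
    (ha : .own ∉ as ∧ .src ∉ as ∧ .dst ∉ as ∧ .wgt ∉ as ∧ .dsv ∉ as) : τ.graph = σ.graph := by
  simp [Store.graph, h.1 _ hx.1, h.1 _ hx.2.1, h.1 _ hx.2.2, h.2 _ ha.1, h.2 _ ha.2.1,
    h.2 _ ha.2.2.1, h.2 _ ha.2.2.2.1, h.2 _ ha.2.2.2.2]

lemma relaxProg_relaxed (I : ℕ → ℕ) (σ : Store) {W : ℕ} (hg : σ.graph.Valid W) :
    σ.graph.Relaxed (σ.arr .dis) (σ.arr .rem) ((relaxProg.den I σ).arr .acc)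
      ((relaxProg.den I σ).arr .cho) := by
  obtain ⟨h0, h1, -⟩ := relaxProg_spec I σ
  refine ⟨fun x hx ho => (h0 x hx ho).2.1, fun x hx ho => (h0 x hx ho).2.2,
    fun x hx ho => (h1 x hx ho).1, fun x hx ho => ?_⟩
  obtain ⟨h2, h3⟩ := h1 x hx ho
  rcases h3 with h3 | h3
  · obtain ⟨e, he, hs⟩ := hg.exists_src x hx
    have h4 := h2 e he hs
    refine ⟨e, he, hs, ?_⟩
    change _ = σ.via e
    omega
  · exact h3

lemma relaxProg_isMove (I : ℕ → ℕ) (σ : Store) (h : σ.graph.IsMove (σ.arr .cho)) :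
    σ.graph.IsMove ((relaxProg.den I σ).arr .cho) := by
  intro x hx
  rcases (relaxProg_spec I σ).2.2 x with h' | h'
  · rw [h']
    exact h x hx
  · exact h'

lemma distProg_spec (I : ℕ → ℕ) (σ : Store) {W : ℕ} (hg : σ.graph.Valid W)
    (hm : σ.graph.IsMove (σ.arr .cho)) :
    σ.graph.IsDist (σ.arr .tgt) ((distProg.den I σ).arr .dis) ((distProg.den I σ).arr .nxt) ∧
      σ.graph.IsMove ((distProg.den I σ).arr .nxt) ∧
      σ.graph.IsMove ((distProg.den I σ).arr .cho) := by
  rw [distProg, Stmt.den]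
  set P := Stmt.loop .u .N (
    .put .dis (var .u) (var .INF) ;;
    .put .nxt (var .u) (get .cho (var .u)) ;;
    .ite (get .tgt (var .u)) (num 1) (.put .rem (var .u) (var .INF))
      (.put .rem (var .u) (num 0))) with hP
  have hinit : (∀ x < σ.var .N, (P.den I σ).arr .dis x = σ.var .INF ∧
      (P.den I σ).arr .nxt x = σ.arr .cho x ∧
      (P.den I σ).arr .rem x = if σ.arr .tgt x < 1 then σ.var .INF else 0) := by
    obtain ⟨τ, hτ, he⟩ := Stmt.loop_rule (I := I) (x := .u) (b := .N) (σ := σ)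
      (P := .put .dis (var .u) (var .INF) ;;
        .put .nxt (var .u) (get .cho (var .u)) ;;
        .ite (get .tgt (var .u)) (num 1) (.put .rem (var .u) (var .INF))
          (.put .rem (var .u) (num 0)))
      (fun k τ => ∀ x < k, τ.arr .dis x = σ.var .INF ∧ τ.arr .nxt x = σ.arr .cho x ∧
        τ.arr .rem x = if σ.arr .tgt x < 1 then σ.var .INF else 0)
      (by simp) (by
        intro k _ τ hA ih x hx
        have e1 := hA.2 .tgt (by decide)
        have e2 := hA.1 .INF (by decide)
        have e3 := hA.2 .cho (by decide)
        by_cases hk : σ.arr .tgt k < 1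
        · rcases Nat.lt_succ_iff_lt_or_eq.1 hx with hx | rfl
          · simpa [e1, hk, Function.update_apply, hx.ne] using ih x hx
          · simp [e1, e2, e3, hk]
        · rcases Nat.lt_succ_iff_lt_or_eq.1 hx with hx | rfl
          · simpa [e1, hk, Function.update_apply, hx.ne] using ih x hx
          · simp [e1, e2, e3, hk])
    rw [he]
    exact hτ
  have hA1 := P.agree_den I σ
  generalize P.den I σ = σ₁ at hinit hA1
  have hg1 : σ₁.graph = σ.graph := hA1.graph_eq (by decide) (by decide)
  have hN1 : σ₁.var .N = σ.graph.N := hA1.1 .N (by decide)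
  obtain ⟨τ, hτ, he⟩ := Stmt.loop_rule (I := I) (x := .ph) (b := .N) (σ := σ₁)
    (P := relaxProg ;; selectProg ;; settleProg)
    (fun k τ => (∃ r c, σ.graph.SettleInv W (σ.arr .tgt) k (τ.arr .dis) (τ.arr .rem)
      (τ.arr .nxt) r c) ∧ σ.graph.IsMove (τ.arr .nxt) ∧ σ.graph.IsMove (τ.arr .cho))
    (by
      have hd : ∀ x < σ.graph.N, ¬ σ₁.arr .dis x < σ.graph.INF := fun x hx => by
        rw [(hinit x hx).1]
        exact lt_irrefl _
      refine ⟨⟨fun _ => 0, 0, fun x hx => ?_, fun x hx => .inr (hinit x hx).1, by simp,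
        ⟨fun x hx h' => absurd h' (hd x hx), fun x hx h' => absurd h' (hd x hx)⟩,
        ⟨fun x hx h' => absurd h' (hd x hx), fun x hx h' => absurd h' (hd x hx)⟩,
        ⟨fun x hx _ _ _ _ _ => Nat.zero_le _, fun x hx _ _ => ?_⟩, .inr (Nat.zero_le _)⟩,
        fun x hx => ?_, ?_⟩
      · rw [(hinit x hx).2.2, (hinit x hx).1]
      · obtain ⟨e, he, hs⟩ := hg.exists_src x hx
        exact ⟨e, he, hs, Nat.zero_le _⟩
      · rw [(hinit x hx).2.1]
        exact hm x hx
      · rw [hA1.2 .cho (by decide)]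
        exact hm)
    (by
      rintro k hk τ hA ⟨⟨r, c, hI⟩, hmn, hmc⟩
      rw [hN1] at hk
      have hA' := (hA1.mono (ys := [.u, .ph, .best, .bx, .e, .z, .val])
        (bs := [.dis, .nxt, .rem, .acc, .cho]) (by decide) (by decide)).trans
        (hA.mono (by decide) (by decide))
      replace hA' := hA'.trans (agree_set τ (x := .ph) k (by decide))
      have hgτ : (τ.set .ph k).graph = σ.graph := hA'.graph_eq (by decide) (by decide)
      have hR := relaxProg_relaxed I (τ.set .ph k) (W := W) (hgτ ▸ hg)
      have hmc' := relaxProg_isMove I (τ.set .ph k) (hgτ ▸ hmc)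
      rw [hgτ] at hR hmc'
      simp only [Stmt.den]
      have hA2 := relaxProg.agree_den I (τ.set .ph k)
      generalize relaxProg.den I (τ.set .ph k) = σ₂ at hA2 hR hmc'
      obtain ⟨h1, h2, h3⟩ := selectProg_spec I σ₂
      have hA3 := selectProg.agree_den I σ₂
      generalize selectProg.den I σ₂ = σ₃ at hA3 h1 h2 h3
      have hA4 := (hA'.trans (hA2.mono (by decide) (by decide))).trans
        (hA3.mono (by decide) (by decide))
      have eN : σ₂.var .N = σ.graph.N :=
        (hA'.trans (hA2.mono (by decide) (by decide))).1 .N (by decide)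
      have eI : σ₂.var .INF = σ.graph.INF :=
        (hA'.trans (hA2.mono (by decide) (by decide))).1 .INF (by decide)
      have eI3 : σ₃.var .INF = σ.graph.INF := hA4.1 .INF (by decide)
      have eT : σ₃.arr .tgt = σ.arr .tgt := hA4.2 .tgt (by decide)
      have ed2 : σ₂.arr .dis = τ.arr .dis := hA2.2 .dis (by decide)
      have ed : σ₃.arr .dis = τ.arr .dis := (hA3.2 .dis (by decide)).trans ed2
      have er : σ₃.arr .rem = τ.arr .rem :=
        (hA3.2 .rem (by decide)).trans (hA2.2 .rem (by decide))
      have en : σ₃.arr .nxt = τ.arr .nxt :=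
        (hA3.2 .nxt (by decide)).trans (hA2.2 .nxt (by decide))
      have ec : σ₃.arr .cho = σ₂.arr .cho := hA3.2 .cho (by decide)
      rw [eN, eI, ed2] at h1
      rw [eN, eI, ed2] at h2
      simp only [Store.set_arr] at hR
      by_cases hb : σ₃.var .best < σ.graph.INF
      · obtain ⟨h4, h5, h6⟩ := h2 hb
        have := hI.settle hg hk hR h4 h5 (h6 ▸ hb) (h6 ▸ h1)
        obtain ⟨e1, e2, e3⟩ := (settleProg_spec I σ₃).1 (by rwa [eI3])
        rw [e1, e2, e3, ed, en, er, eT, h6, ec]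
        refine ⟨⟨_, _, this⟩, fun x hx => ?_, ?_⟩
        · by_cases hxb : x = σ₃.var .bx
          · rw [hxb, Function.update_self]
            exact hmc' _ h4
          · rw [Function.update_of_ne hxb]
            exact hmn x hx
        · rw [settleProg.den_arr I σ₃ (by decide), ec]
          exact hmc'
      · have hbI : σ₃.var .best = σ.graph.INF := by
          have := h3
          rw [eI] at this
          omega
        rw [(settleProg_spec I σ₃).2 (by rwa [eI3]), ed, er, en, ec]
        exact ⟨⟨r, c, hI.skip hR (by rwa [hbI] at h1)⟩, hmn, hmc'⟩)
  rw [he]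
  rw [hN1] at hτ
  obtain ⟨⟨r, c, hI⟩, hmn, hmc⟩ := hτ
  exact ⟨hI.isDist hg, hmn, hmc⟩

/-! ### The levels -/

/-- Remove a target `tx` of maximal distance `Dm`. -/
def maxProg : Stmt :=
  .assign .Dm (num 0) ;;
  .assign .tx (num 0) ;;
  .loop .u .N (.ite (get .tgt (var .u)) (num 1) .skip <|
    .ite (get .dis (var .u)) (var .Dm) .skip <|
      .assign .Dm (get .dis (var .u)) ;; .assign .tx (var .u)) ;;
  .put .tgt (var .tx) (num 0)

/-- Enter the current level, whose offset is `is`, as the level `lev v` of each initial vertex `v`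
for which its bound improves on the best bound `bes v` so far. -/
def bestProg : Stmt :=
  .loop .v .n (
    .assign .z (get .mul (get .stq (get .mul (var .qI) + var .v)) + var .v) ;;
    .assign .bd (get .dis (var .z)) ;;
    .ite (var .bd) (var .Dm) (.assign .bd (var .Dm)) .skip ;;
    .ite (var .bd) (get .bes (var .v))
      (.put .bes (var .v) (var .bd) ;; .put .lev (var .v) (var .is)) .skip)

/-- Write the part of the tables of the update and the next-move function that belongs to the
current level. -/
def emitProg : Stmt :=
  .loop .u .N (
    .put .out (var .o1 + var .u) (var .is + get .stq (var .u)) ;;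
    .put .out (var .o2 + var .u) (get .nxt (var .u))) ;;
  .assign .o1 (var .o1 + var .N) ;;
  .assign .o2 (var .o2 + var .N) ;;
  .assign .is (var .is + var .s)

/-- Compute and write a level. -/
def levelProg : Stmt := distProg ;; maxProg ;; bestProg ;; emitProg

/-- The index of the position of the product in which a play starts at `v`. -/
def Store.startIdx (σ : Store) (v : ℕ) : ℕ :=
  σ.arr .mul (σ.arr .stq (σ.arr .mul (σ.var .qI) + v)) + v

/-- The bound that the current level guarantees from the initial vertex `v`. -/
def Store.levelBound (σ : Store) (v : ℕ) : ℕ :=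
  max (σ.var .Dm) (σ.arr .dis (σ.startIdx v))

lemma maxProg_spec (I : ℕ → ℕ) (σ : Store) :
    (∀ x < σ.var .N, ¬ σ.arr .tgt x < 1 → σ.arr .dis x ≤ (maxProg.den I σ).var .Dm) ∧
    ((∃ x < σ.var .N, ¬ σ.arr .tgt x < 1) →
      (maxProg.den I σ).var .tx < σ.var .N ∧ ¬ σ.arr .tgt ((maxProg.den I σ).var .tx) < 1 ∧
      (maxProg.den I σ).var .Dm = σ.arr .dis ((maxProg.den I σ).var .tx)) ∧
    ((¬ ∃ x < σ.var .N, ¬ σ.arr .tgt x < 1) → (maxProg.den I σ).var .tx = 0) ∧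
    (maxProg.den I σ).arr .tgt =
      Function.update (σ.arr .tgt) ((maxProg.den I σ).var .tx) 0 := by
  obtain ⟨τ, hτ, he⟩ := Stmt.loop_rule (I := I) (x := .u) (b := .N)
    (P := .ite (get .tgt (var .u)) (num 1) .skip <|
      .ite (get .dis (var .u)) (var .Dm) .skip <|
        .assign .Dm (get .dis (var .u)) ;; .assign .tx (var .u))
    (σ := (σ.set .Dm 0).set .tx 0)
    (fun k τ => (∀ x < k, ¬ σ.arr .tgt x < 1 → σ.arr .dis x ≤ τ.var .Dm) ∧
      ((∃ x < k, ¬ σ.arr .tgt x < 1) → τ.var .tx < k ∧ ¬ σ.arr .tgt (τ.var .tx) < 1 ∧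
        τ.var .Dm = σ.arr .dis (τ.var .tx)) ∧
      ((¬ ∃ x < k, ¬ σ.arr .tgt x < 1) → τ.var .tx = 0 ∧ τ.var .Dm = 0) ∧
      τ.arr .tgt = σ.arr .tgt)
    (by simp) (by
      intro k _ τ hA ⟨ih1, ih2, ih3, ih4⟩
      have e1 := hA.2 .dis (by decide)
      simp only [Store.set_arr] at e1
      by_cases h1 : σ.arr .tgt k < 1
      · simp only [Stmt.den, Ex.eval, Store.set_arr, Store.set_var_self, ih4, h1, if_true, ne_eq,
          reduceCtorEq, not_false_eq_true, Store.set_var_of_ne]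
        have hex : (∃ x < k + 1, ¬ σ.arr .tgt x < 1) ↔ ∃ x < k, ¬ σ.arr .tgt x < 1 := by
          refine ⟨?_, fun ⟨x, hx, h⟩ => ⟨x, by omega, h⟩⟩
          rintro ⟨x, hx, h⟩
          rcases Nat.lt_succ_iff_lt_or_eq.1 hx with hx | rfl
          · exact ⟨x, hx, h⟩
          · exact absurd h1 h
        rw [hex]
        refine ⟨fun x hx ht => ?_, fun h => ?_, ih3, trivial⟩
        · rcases Nat.lt_succ_iff_lt_or_eq.1 hx with hx | rfl
          · exact ih1 x hx ht
          · exact absurd h1 ht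
        · obtain ⟨h2, h3⟩ := ih2 h
          exact ⟨by omega, h3⟩
      · have hex : ∃ x < k + 1, ¬ σ.arr .tgt x < 1 := ⟨k, by omega, h1⟩
        by_cases h2 : σ.arr .dis k < τ.var .Dm
        · simp only [Stmt.den, Ex.eval, Store.set_arr, Store.set_var_self, ih4, e1, h1, h2, if_true,
            if_false, ne_eq, reduceCtorEq, not_false_eq_true, Store.set_var_of_ne]
          refine ⟨fun x hx ht => ?_, fun _ => ?_, fun h => absurd hex h, trivial⟩
          · rcases Nat.lt_succ_iff_lt_or_eq.1 hx with hx | rfl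
            · exact ih1 x hx ht
            · omega
          · by_cases hk : ∃ x < k, ¬ σ.arr .tgt x < 1
            · obtain ⟨h3, h4⟩ := ih2 hk
              exact ⟨by omega, h4⟩
            · have := (ih3 hk).2
              omega
        · simp only [Stmt.den, Ex.eval, Store.set_arr, Store.set_var_self, ih4, e1, h1, h2,
            if_false, ne_eq, reduceCtorEq, not_false_eq_true, Store.set_var_of_ne]
          refine ⟨fun x hx ht => ?_, fun _ => ⟨by omega, by simp⟩,
            fun h => absurd hex h, trivial⟩
          rcases Nat.lt_succ_iff_lt_or_eq.1 hx with hx | rfl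
          · have := ih1 x hx ht; omega
          · exact le_rfl)
  obtain ⟨h1, h2, h3, h4⟩ := hτ
  simp only [maxProg, Stmt.den, Ex.eval] at he ⊢
  rw [he]
  refine ⟨by simpa using h1, by simpa using h2, fun h => ?_, by simp [h4]⟩
  simpa using (h3 (by simpa using h)).1

lemma bestProg_spec (I : ℕ → ℕ) (σ : Store) :
    ∀ v < σ.var .n,
      (bestProg.den I σ).arr .bes v = min (σ.levelBound v) (σ.arr .bes v) ∧
      (bestProg.den I σ).arr .lev v =
        if σ.levelBound v < σ.arr .bes v then σ.var .is else σ.arr .lev v := by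
  obtain ⟨τ, hτ, he⟩ := Stmt.loop_rule (I := I) (x := .v) (b := .n) (σ := σ)
    (P := .assign .z (get .mul (get .stq (get .mul (var .qI) + var .v)) + var .v) ;;
      .assign .bd (get .dis (var .z)) ;;
      .ite (var .bd) (var .Dm) (.assign .bd (var .Dm)) .skip ;;
      .ite (var .bd) (get .bes (var .v))
        (.put .bes (var .v) (var .bd) ;; .put .lev (var .v) (var .is)) .skip)
    (fun k τ => (∀ v < k, τ.arr .bes v = min (σ.levelBound v) (σ.arr .bes v) ∧
      τ.arr .lev v = if σ.levelBound v < σ.arr .bes v then σ.var .is else σ.arr .lev v) ∧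
      ∀ v, k ≤ v → τ.arr .bes v = σ.arr .bes v ∧ τ.arr .lev v = σ.arr .lev v)
    (by simp) (by
      intro k _ τ hA ⟨ih1, ih2⟩
      have e1 := hA.2 .dis (by decide)
      have e2 := hA.2 .mul (by decide)
      have e3 := hA.2 .stq (by decide)
      have e4 := hA.1 .qI (by decide)
      have e5 := hA.1 .Dm (by decide)
      have e6 := hA.1 .is (by decide)
      obtain ⟨e7, e8⟩ := ih2 k le_rfl
      -- The body leaves `bd` with the value of `levelBound`.
      have hbd : ∀ υ : Store, υ.var .v = k → υ.arr = τ.arr → υ.var .bd = σ.levelBound k →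
          υ.var .is = σ.var .is →
          let υ' := (Stmt.ite (var .bd) (get .bes (var .v))
            (.put .bes (var .v) (var .bd) ;; .put .lev (var .v) (var .is)) .skip).den I υ
          (∀ v < k + 1, υ'.arr .bes v = min (σ.levelBound v) (σ.arr .bes v) ∧
            υ'.arr .lev v = if σ.levelBound v < σ.arr .bes v then σ.var .is else σ.arr .lev v) ∧
          ∀ v, k + 1 ≤ v → υ'.arr .bes v = σ.arr .bes v ∧ υ'.arr .lev v = σ.arr .lev v := by
        intro υ hv ha hb hi
        simp only [Stmt.den, Ex.eval, hv, ha, hb, e7, Store.put_var, hi]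
        by_cases hlt : σ.levelBound k < σ.arr .bes k
        · simp only [hlt, if_true]
          refine ⟨fun v hvk => ?_, fun v hvk => ?_⟩
          · rcases Nat.lt_succ_iff_lt_or_eq.1 hvk with hvk | rfl
            · simpa [hvk.ne, ha] using ih1 v hvk
            · simp [hlt, hlt.le]
          · simpa [show v ≠ k by omega, ha] using ih2 v (by omega)
        · simp only [hlt, if_false, ha]
          refine ⟨fun v hvk => ?_, fun v hvk => ih2 v (by omega)⟩
          rcases Nat.lt_succ_iff_lt_or_eq.1 hvk with hvk | rfl
          · exact ih1 v hvk
          · rw [e7, e8, if_neg hlt]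
            exact ⟨by omega, rfl⟩
      simp only [Stmt.den]
      apply hbd
      · simp only [Ex.eval, Store.set_arr, Store.set_var_self, ne_eq, reduceCtorEq,
          not_false_eq_true, Store.set_var_of_ne]
        split_ifs <;> simp
      · simp only [Ex.eval, Store.set_arr, Store.set_var_self, ne_eq, reduceCtorEq,
          not_false_eq_true, Store.set_var_of_ne]
        split_ifs <;> simp
      · simp only [Ex.eval, Store.set_arr, Store.set_var_self, e1, e2, e3, e4, e5,
          ne_eq, reduceCtorEq, not_false_eq_true, Store.set_var_of_ne]
        have : σ.arr .mul (σ.arr .stq (σ.arr .mul (σ.var .qI) + k)) + k = σ.startIdx k := rfl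
        rw [this, Store.levelBound]
        split_ifs with h
        · simp [h.le]
        · simp only [Store.set_var_self]
          omega
      · simp only [Ex.eval, Store.set_arr, Store.set_var_self, ne_eq, reduceCtorEq,
          not_false_eq_true, Store.set_var_of_ne]
        split_ifs <;> simp [e6])
  simp only [bestProg]
  rw [he]
  exact hτ.1

lemma emitProg_spec (I : ℕ → ℕ) (σ : Store) (h : σ.var .o1 + σ.var .N ≤ σ.var .o2) :
    (∀ x < σ.var .N,
      (emitProg.den I σ).arr .out (σ.var .o1 + x) = σ.var .is + σ.arr .stq x ∧
      (emitProg.den I σ).arr .out (σ.var .o2 + x) = σ.arr .nxt x) ∧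
    (∀ a, (∀ x < σ.var .N, a ≠ σ.var .o1 + x ∧ a ≠ σ.var .o2 + x) →
      (emitProg.den I σ).arr .out a = σ.arr .out a) ∧
    (emitProg.den I σ).var .o1 = σ.var .o1 + σ.var .N ∧
    (emitProg.den I σ).var .o2 = σ.var .o2 + σ.var .N ∧
    (emitProg.den I σ).var .is = σ.var .is + σ.var .s := by
  obtain ⟨τ, hτ, he⟩ := Stmt.loop_rule (I := I) (x := .u) (b := .N) (σ := σ)
    (P := .put .out (var .o1 + var .u) (var .is + get .stq (var .u)) ;;
      .put .out (var .o2 + var .u) (get .nxt (var .u)))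
    (fun k τ => Agree [.u] [.out] σ τ ∧ (∀ x < k,
      τ.arr .out (σ.var .o1 + x) = σ.var .is + σ.arr .stq x ∧
      τ.arr .out (σ.var .o2 + x) = σ.arr .nxt x) ∧
      (∀ a, (∀ x < k, a ≠ σ.var .o1 + x ∧ a ≠ σ.var .o2 + x) → τ.arr .out a = σ.arr .out a))
    ⟨.refl _ _ _, by simp, by simp⟩ (by
      intro k hk τ hA ⟨_, ih1, ih2⟩
      have e1 := hA.2 .stq (by decide)
      have e2 := hA.2 .nxt (by decide)
      have e3 := hA.1 .o1 (by decide)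
      have e4 := hA.1 .o2 (by decide)
      have e5 := hA.1 .is (by decide)
      refine ⟨(hA.trans (agree_set τ (x := .u) k (by decide))).mono (by decide) (by decide)
        |>.trans (Stmt.agree_den I _ _ |>.mono (by decide) (by decide)), fun x hx => ?_,
        fun a ha => ?_⟩
      · simp only [Stmt.den, Ex.eval, Store.set_arr, Store.set_var_self, Store.put_var,
          Store.put_arr_self, e1, e2, e3, e4, e5, ne_eq, reduceCtorEq, not_false_eq_true,
          Store.set_var_of_ne, Store.put_arr_of_ne]
        rcases Nat.lt_succ_iff_lt_or_eq.1 hx with hx | rfl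
        · have := ih1 x hx
          rw [Function.update_of_ne (by omega), Function.update_of_ne (by omega),
            Function.update_of_ne (by omega), Function.update_of_ne (by omega)]
          exact this
        · rw [Function.update_of_ne (by omega), Function.update_self, Function.update_self]
          exact ⟨rfl, rfl⟩
      · simp only [Stmt.den, Ex.eval, Store.set_arr, Store.set_var_self, Store.put_var,
          Store.put_arr_self, e1, e2, e3, e4, e5, ne_eq, reduceCtorEq, not_false_eq_true,
          Store.set_var_of_ne, Store.put_arr_of_ne]
        rw [Function.update_of_ne (ha k (by omega)).2, Function.update_of_ne (ha k (by omega)).1]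
        exact ih2 a fun x hx => ha x (by omega))
  simp only [emitProg, Stmt.den, Ex.eval] at he ⊢
  rw [he]
  obtain ⟨hA, h1, h2⟩ := hτ
  refine ⟨by simpa using h1, by simpa using h2, ?_, ?_, ?_⟩
  · simp [hA.1 .o1 (by decide), hA.1 .N (by decide)]
  · simp [hA.1 .o2 (by decide), hA.1 .N (by decide)]
  · simp [hA.1 .is (by decide), hA.1 .s (by decide)]

/-- How one level transforms the store. -/
structure LevelStep (σ τ : Store) : Prop where
  isDist : σ.graph.IsDist (σ.arr .tgt) (τ.arr .dis) (τ.arr .nxt)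
  isMove_nxt : σ.graph.IsMove (τ.arr .nxt)
  isMove_cho : σ.graph.IsMove (τ.arr .cho)
  le_Dm : ∀ x < σ.var .N, ¬ σ.arr .tgt x < 1 → τ.arr .dis x ≤ τ.var .Dm
  tx_spec : (∃ x < σ.var .N, ¬ σ.arr .tgt x < 1) → τ.var .tx < σ.var .N ∧
    ¬ σ.arr .tgt (τ.var .tx) < 1 ∧ τ.var .Dm = τ.arr .dis (τ.var .tx)
  tx_eq : (¬ ∃ x < σ.var .N, ¬ σ.arr .tgt x < 1) → τ.var .tx = 0
  tgt_eq : τ.arr .tgt = Function.update (σ.arr .tgt) (τ.var .tx) 0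
  bes_lev : ∀ v < σ.var .n, τ.arr .bes v = min (τ.levelBound v) (σ.arr .bes v) ∧
    τ.arr .lev v = if τ.levelBound v < σ.arr .bes v then σ.var .is else σ.arr .lev v
  out_eq : ∀ x < σ.var .N, τ.arr .out (σ.var .o1 + x) = σ.var .is + σ.arr .stq x ∧
      τ.arr .out (σ.var .o2 + x) = τ.arr .nxt x
  out_ne : ∀ a, (∀ x < σ.var .N, a ≠ σ.var .o1 + x ∧ a ≠ σ.var .o2 + x) →
      τ.arr .out a = σ.arr .out a
  o1_eq : τ.var .o1 = σ.var .o1 + σ.var .N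
  o2_eq : τ.var .o2 = σ.var .o2 + σ.var .N
  is_eq : τ.var .is = σ.var .is + σ.var .s

lemma levelProg_spec (I : ℕ → ℕ) (σ : Store) {W : ℕ} (hg : σ.graph.Valid W)
    (hm : σ.graph.IsMove (σ.arr .cho)) (ho : σ.var .o1 + σ.var .N ≤ σ.var .o2) :
    LevelStep σ (levelProg.den I σ) := by
  obtain ⟨h1, h2, h3⟩ := distProg_spec I σ hg hm
  simp only [levelProg, Stmt.den]
  have hA1 := distProg.agree_den I σ
  generalize distProg.den I σ = σ₁ at h1 h2 h3 hA1
  obtain ⟨h4, h5, h6, h7⟩ := maxProg_spec I σ₁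
  have hA2 := maxProg.agree_den I σ₁
  generalize maxProg.den I σ₁ = σ₂ at h4 h5 h6 h7 hA2
  have h8 := bestProg_spec I σ₂
  have hA3 := bestProg.agree_den I σ₂
  generalize bestProg.den I σ₂ = σ₃ at h8 hA3
  have hA12 := (hA1.mono (ys := distProg.mods ++ maxProg.mods)
    (bs := distProg.amods ++ maxProg.amods) (by decide) (by decide)).trans
    (hA2.mono (by decide) (by decide))
  have hA13 := (hA12.mono (ys := distProg.mods ++ maxProg.mods ++ bestProg.mods)
    (bs := distProg.amods ++ maxProg.amods ++ bestProg.amods) (by decide) (by decide)).trans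
    (hA3.mono (by decide) (by decide))
  have eN : σ₃.var .N = σ.var .N := hA13.1 .N (by decide)
  have e1 : σ₃.var .o1 = σ.var .o1 := hA13.1 .o1 (by decide)
  have e2 : σ₃.var .o2 = σ.var .o2 := hA13.1 .o2 (by decide)
  have h9 := emitProg_spec I σ₃ (by rwa [eN, e1, e2])
  have hA4 := emitProg.agree_den I σ₃
  generalize emitProg.den I σ₃ = σ₄ at h9 hA4
  have hA34 := (hA3.mono (ys := bestProg.mods ++ emitProg.mods)
    (bs := bestProg.amods ++ emitProg.amods) (by decide) (by decide)).trans
    (hA4.mono (by decide) (by decide))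
  have hA24 := (hA2.mono (ys := maxProg.mods ++ (bestProg.mods ++ emitProg.mods))
    (bs := maxProg.amods ++ (bestProg.amods ++ emitProg.amods)) (by decide) (by decide)).trans
    (hA34.mono (by decide) (by decide))
  have eis : σ₃.var .is = σ.var .is := hA13.1 .is (by decide)
  have es : σ₃.var .s = σ.var .s := hA13.1 .s (by decide)
  have estq : σ₃.arr .stq = σ.arr .stq := hA13.2 .stq (by decide)
  have eout : σ₃.arr .out = σ.arr .out := hA13.2 .out (by decide)
  have enxt3 : σ₃.arr .nxt = σ₁.arr .nxt :=
    (hA3.2 .nxt (by decide)).trans (hA2.2 .nxt (by decide))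
  have enxt : σ₄.arr .nxt = σ₁.arr .nxt := hA24.2 .nxt (by decide)
  have edis : σ₄.arr .dis = σ₁.arr .dis := hA24.2 .dis (by decide)
  have edis2 : σ₂.arr .dis = σ₁.arr .dis := hA2.2 .dis (by decide)
  have echo : σ₄.arr .cho = σ₁.arr .cho := hA24.2 .cho (by decide)
  have eDm : σ₄.var .Dm = σ₂.var .Dm := hA34.1 .Dm (by decide)
  have etx : σ₄.var .tx = σ₂.var .tx := hA34.1 .tx (by decide)
  have etgt : σ₄.arr .tgt = σ₂.arr .tgt := hA34.2 .tgt (by decide)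
  have etgt1 : σ₁.arr .tgt = σ.arr .tgt := hA1.2 .tgt (by decide)
  have eN1 : σ₁.var .N = σ.var .N := hA1.1 .N (by decide)
  have ebes : σ₄.arr .bes = σ₃.arr .bes := hA4.2 .bes (by decide)
  have elev : σ₄.arr .lev = σ₃.arr .lev := hA4.2 .lev (by decide)
  have ebes2 : σ₂.arr .bes = σ.arr .bes := hA12.2 .bes (by decide)
  have elev2 : σ₂.arr .lev = σ.arr .lev := hA12.2 .lev (by decide)
  have eis2 : σ₂.var .is = σ.var .is := hA12.1 .is (by decide)
  have en2 : σ₂.var .n = σ.var .n := hA12.1 .n (by decide)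
  have ebound : σ₂.levelBound = σ₄.levelBound := by
    funext v
    simp only [Store.levelBound, Store.startIdx, eDm, edis, edis2, hA34.2 .mul (by decide),
      hA34.2 .stq (by decide), hA34.1 .qI (by decide)]
  rw [etgt1, eN1] at h4 h5 h6
  rw [etgt1] at h7
  rw [ebes2, elev2, eis2, en2, ebound] at h8
  rw [eN, e1, e2, eis, es, estq, eout, enxt3] at h9
  obtain ⟨h10, h11, h12, h13, h14⟩ := h9
  refine ⟨?_, ?_, ?_, ?_, ?_, ?_, ?_, ?_, ?_, h11, h12, h13, h14⟩
  · rwa [edis, enxt]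
  · rwa [enxt]
  · rwa [echo]
  · rwa [edis, eDm]
  · rwa [edis, eDm, etx]
  · rwa [etx]
  · rwa [etx, etgt]
  · rwa [ebes, elev]
  · rwa [enxt]

/-! ### From edge lists to the product of arena and automaton -/

/-- The number of a position of the product. -/
def posIdx {n s : ℕ} (x : Fin n × Fin s) : ℕ := x.2 * n + x.1

lemma posIdx_lt {n s : ℕ} (x : Fin n × Fin s) : posIdx x < s * n := by
  have h1 := x.1.2
  have h2 : (x.2 + 1) * n ≤ s * n := Nat.mul_le_mul_right _ x.2.2
  rw [add_mul, one_mul] at h2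
  unfold posIdx
  omega

lemma mul_add_inj {n a b a' b' : ℕ} (hb : b < n) (hb' : b' < n) (h : a * n + b = a' * n + b') :
    a = a' ∧ b = b' := by
  have hn : 0 < n := by omega
  have h1 : (a * n + b) / n = a := by
    rw [mul_comm, Nat.mul_add_div hn, Nat.div_eq_of_lt hb, add_zero]
  have h2 : (a' * n + b') / n = a' := by
    rw [mul_comm, Nat.mul_add_div hn, Nat.div_eq_of_lt hb', add_zero]
  have : a = a' := by rw [← h1, ← h2, h]
  subst this
  exact ⟨rfl, by omega⟩

lemma exists_mul_add {n s i : ℕ} (h : i < s * n) : ∃ a < s, ∃ b < n, i = a * n + b := by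
  have hn : 0 < n := by
    rcases Nat.eq_zero_or_pos n with rfl | hn
    · simp at h
    · exact hn
  exact ⟨i / n, Nat.div_lt_of_lt_mul (by rwa [mul_comm]), i % n, Nat.mod_lt _ hn, by
    rw [mul_comm]; exact (Nat.div_add_mod i n).symm⟩

lemma posIdx_inj {n s : ℕ} {x y : Fin n × Fin s} : posIdx x = posIdx y ↔ x = y := by
  refine ⟨fun h => ?_, fun h => h ▸ rfl⟩
  obtain ⟨h1, h2⟩ := mul_add_inj x.1.2 y.1.2 h
  exact Prod.ext (Fin.ext h2) (Fin.ext h1)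

lemma exists_posIdx_eq {n s i : ℕ} (h : i < s * n) : ∃ x : Fin n × Fin s, posIdx x = i := by
  obtain ⟨a, ha, b, hb, rfl⟩ := exists_mul_add h
  exact ⟨(⟨b, hb⟩, ⟨a, ha⟩), rfl⟩

/-- `g` lists the edges of the product of arena and automaton. -/
structure IsProductGraph {n k s : ℕ} (G : RegularLimitGame (Fin n) (Fin k) (Fin s))
    (g : EdgeGraph) : Prop where
  N_eq : g.N = s * n
  own_eq : ∀ x : Fin n × Fin s, g.own (posIdx x) = G.arena.owner x.1
  exists_edge : ∀ (x : Fin n × Fin s) (v : Fin n), G.arena.edge x.1 v → ∃ e < g.PE,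
    g.src e = posIdx x ∧ g.dst e = posIdx (G.succPos x v) ∧ g.wgt e = G.arena.weight x.1 v ∧
    g.dsv e = v
  of_edge : ∀ e < g.PE, ∃ (x : Fin n × Fin s) (v : Fin n), G.arena.edge x.1 v ∧
    g.src e = posIdx x ∧ g.dst e = posIdx (G.succPos x v) ∧ g.wgt e = G.arena.weight x.1 v ∧
    g.dsv e = v

/-- The number that `c` stands for in the distance tables. -/
def EdgeGraph.toENat (g : EdgeGraph) (c : ℕ) : ℕ∞ := if c < g.INF then c else ⊤

namespace EdgeGraph

variable (g : EdgeGraph)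

lemma toENat_mono : Monotone g.toENat := by
  intro a b hab
  unfold toENat
  split_ifs with h1 h2
  · exact_mod_cast hab
  · exact le_top
  · omega
  · exact le_rfl

lemma toENat_of_lt {c : ℕ} (h : c < g.INF) : g.toENat c = c := if_pos h

lemma toENat_of_not_lt {c : ℕ} (h : ¬ c < g.INF) : g.toENat c = ⊤ := if_neg h

lemma lt_of_toENat_ne_top {c : ℕ} (h : g.toENat c ≠ ⊤) : c < g.INF := by
  by_contra hc
  exact h (g.toENat_of_not_lt hc)

end EdgeGraph

section Product

variable {n k s : ℕ} {G : RegularLimitGame (Fin n) (Fin k) (Fin s)} {g : EdgeGraph}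

/-- The set of positions marked in the table `T`. -/
def markedSet (n s : ℕ) (T : ℕ → ℕ) : Set (Fin n × Fin s) := {x | ¬ T (posIdx x) < 1}

/-- The positional strategy in the table `nxt`. Entries out of range do not occur. -/
def moveOf (nxt : ℕ → ℕ) (x : Fin n × Fin s) : Fin n :=
  if h : nxt (posIdx x) < n then ⟨nxt (posIdx x), h⟩ else x.1

lemma IsProductGraph.of_src (hP : IsProductGraph G g) {x : Fin n × Fin s} {e : ℕ} (he : e < g.PE)
    (hs : g.src e = posIdx x) : ∃ v, G.arena.edge x.1 v ∧ g.dst e = posIdx (G.succPos x v) ∧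
      g.wgt e = G.arena.weight x.1 v ∧ g.dsv e = v := by
  obtain ⟨y, v, h1, h2, h3⟩ := hP.of_edge e he
  rw [hs, posIdx_inj] at h2
  subst h2
  exact ⟨v, h1, h3⟩

lemma IsProductGraph.dst_lt (hP : IsProductGraph G g) {e : ℕ} (he : e < g.PE) :
    g.dst e < g.N := by
  obtain ⟨y, v, -, -, h3, -⟩ := hP.of_edge e he
  rw [h3, hP.N_eq]
  exact posIdx_lt _

lemma IsProductGraph.exists_src (hP : IsProductGraph G g) {i : ℕ} (hi : i < g.N) :
    ∃ e < g.PE, g.src e = i := by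
  rw [hP.N_eq] at hi
  obtain ⟨x, rfl⟩ := exists_posIdx_eq hi
  obtain ⟨v, hv⟩ := G.arena.exists_edge x.1
  obtain ⟨e, he, h, -⟩ := hP.exists_edge x v hv
  exact ⟨e, he, h⟩

lemma costTo_eq (T dis : ℕ → ℕ) (y : Fin n × Fin s) :
    RegularLimitGame.costTo (markedSet n s T) (fun x => g.toENat (dis (posIdx x))) y =
      if T (posIdx y) < 1 then g.toENat (dis (posIdx y)) else 0 := by
  have hy : y ∈ markedSet n s T ↔ ¬ T (posIdx y) < 1 := Iff.rfl
  unfold RegularLimitGame.costTo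
  by_cases h : T (posIdx y) < 1
  · rw [if_neg (by rw [hy]; exact not_not.2 h), if_pos h]
  · rw [if_pos (hy.2 h), if_neg h]

lemma IsProductGraph.owner_eq_zero_iff (hP : IsProductGraph G g) (x : Fin n × Fin s) :
    G.arena.owner x.1 = 0 ↔ g.own (posIdx x) < 1 := by
  rw [hP.own_eq, Fin.ext_iff]
  simp

lemma EdgeGraph.IsDist.isLowerDist {T dis nxt : ℕ → ℕ} (h : g.IsDist T dis nxt)
    (hP : IsProductGraph G g) :
    G.IsLowerDist (markedSet n s T) (fun x => g.toENat (dis (posIdx x))) := by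
  have key : ∀ (x : Fin n × Fin s) (v : Fin n) (e : ℕ), g.dst e = posIdx (G.succPos x v) →
      g.wgt e = G.arena.weight x.1 v →
      (dis (posIdx x) < g.INF → dis (posIdx x) ≤
        g.wgt e + if T (g.dst e) < 1 then dis (g.dst e) else 0) →
      (¬ dis (posIdx x) < g.INF → T (g.dst e) < 1 ∧ ¬ dis (g.dst e) < g.INF) →
      g.toENat (dis (posIdx x)) ≤ G.arena.weight x.1 v +
        RegularLimitGame.costTo (markedSet n s T) (fun x => g.toENat (dis (posIdx x)))
          (G.succPos x v) := by
    intro x v e hd hw hlt hinf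
    rw [costTo_eq, ← hd, ← hw]
    by_cases hx : dis (posIdx x) < g.INF
    · rw [g.toENat_of_lt hx]
      have := hlt hx
      split_ifs at this ⊢ with ht
      · by_cases hy : dis (g.dst e) < g.INF
        · rw [g.toENat_of_lt hy]
          exact_mod_cast this
        · rw [g.toENat_of_not_lt hy]
          simp
      · simpa using this
    · obtain ⟨h1, h2⟩ := hinf hx
      rw [if_pos h1, g.toENat_of_not_lt h2]
      simp
  refine ⟨fun x ho v hv => ?_, fun x ho => ?_⟩
  · rw [hP.owner_eq_zero_iff] at ho
    obtain ⟨e, he, hs, hd, hw, -⟩ := hP.exists_edge x v hv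
    have hx : posIdx x < g.N := hP.N_eq ▸ posIdx_lt x
    exact key x v e hd hw (fun h' => h.resists.lo0 _ hx h' ho e he hs)
      fun h' => h.inf0 _ hx h' ho e he hs
  · rw [Ne, hP.owner_eq_zero_iff] at ho
    have hx : posIdx x < g.N := hP.N_eq ▸ posIdx_lt x
    by_cases hlt : dis (posIdx x) < g.INF
    · obtain ⟨e, he, hs, h'⟩ := h.resists.lo1 _ hx hlt ho
      obtain ⟨v, hv, hd, hw, -⟩ := hP.of_src he hs
      exact ⟨v, hv, key x v e hd hw (fun _ => h') fun h' => absurd hlt h'⟩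
    · obtain ⟨e, he, hs, h'⟩ := h.inf1 _ hx hlt ho
      obtain ⟨v, hv, hd, hw, -⟩ := hP.of_src he hs
      exact ⟨v, hv, key x v e hd hw (fun h' => absurd h' hlt) fun _ => h'⟩

lemma EdgeGraph.IsDist.isUpperDist {T dis nxt : ℕ → ℕ} (h : g.IsDist T dis nxt)
    (hP : IsProductGraph G g) :
    ∃ r, G.IsUpperDist (markedSet n s T) (fun x => g.toENat (dis (posIdx x))) (moveOf nxt) r := by
  obtain ⟨r, hr⟩ := h.attracts
  have key : ∀ (x : Fin n × Fin s) (v : Fin n) (e : ℕ), g.dst e = posIdx (G.succPos x v) →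
      g.wgt e = G.arena.weight x.1 v → dis (posIdx x) < g.INF →
      g.wgt e + (if T (g.dst e) < 1 then dis (g.dst e) else 0) ≤ dis (posIdx x) →
      (¬ T (g.dst e) < 1 ∨ r (g.dst e) < r (posIdx x)) →
      G.arena.weight x.1 v +
        RegularLimitGame.costTo (markedSet n s T) (fun x => g.toENat (dis (posIdx x)))
          (G.succPos x v) ≤ g.toENat (dis (posIdx x)) ∧
      (G.succPos x v ∈ markedSet n s T ∨ r (posIdx (G.succPos x v)) < r (posIdx x)) := by
    intro x v e hd hw hlt hle hor
    rw [costTo_eq, ← hd, ← hw, g.toENat_of_lt hlt]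
    refine ⟨?_, hor.imp (fun h' => ?_) id⟩
    · split_ifs at hle ⊢ with ht
      · rw [g.toENat_of_lt (by omega)]
        exact_mod_cast hle
      · simpa using hle
    · rw [hd] at h'
      exact h'
  refine ⟨fun x => r (posIdx x), fun x hx ho => ?_, fun x hx ho v hv => ?_⟩
  · rw [hP.owner_eq_zero_iff] at ho
    have hlt := g.lt_of_toENat_ne_top hx
    obtain ⟨e, he, hs, hn, hle, hor⟩ := hr.up0 _ (hP.N_eq ▸ posIdx_lt x) hlt ho
    obtain ⟨v, hv, hd, hw, hdv⟩ := hP.of_src he hs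
    have hmv : moveOf nxt x = v := by
      rw [moveOf, dif_pos (by rw [hn, hdv]; exact v.2)]
      exact Fin.ext (hn.trans hdv)
    rw [hmv]
    exact key x v e hd hw hlt hle hor
  · rw [Ne, hP.owner_eq_zero_iff] at ho
    have hlt := g.lt_of_toENat_ne_top hx
    obtain ⟨e, he, hs, hd, hw, -⟩ := hP.exists_edge x v hv
    obtain ⟨hle, hor⟩ := hr.up1 _ (hP.N_eq ▸ posIdx_lt x) hlt ho e he hs
    exact key x v e hd hw hlt hle hor

/-- The stores between the levels: the first level starts in `σ 0`, in which all targets are marked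
and no level has been entered. -/
structure LevelRun (G : RegularLimitGame (Fin n) (Fin k) (Fin s)) (J : ℕ) (σ : ℕ → Store) :
    Prop where
  step : ∀ i < J, LevelStep (σ i) (σ (i + 1))
  graph_eq : ∀ i ≤ J, (σ i).graph = (σ 0).graph
  n_eq : ∀ i ≤ J, (σ i).var .n = n
  s_eq : ∀ i ≤ J, (σ i).var .s = s
  start_eq : ∀ i ≤ J, ∀ v : Fin n, (σ i).startIdx v = posIdx (G.startPos v)
  product : IsProductGraph G (σ 0).graph
  tgt_iff : ∀ x : Fin n × Fin s, ¬ (σ 0).arr .tgt (posIdx x) < 1 ↔ x ∈ G.target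
  card_lt : ((Finset.range (s * n)).filter fun x => ¬ (σ 0).arr .tgt x < 1).card < J
  is_eq : (σ 0).var .is = 0
  bes_lev : ∀ v < n, (σ 0).arr .bes v = (σ 0).graph.INF ∧ (σ 0).arr .lev v = 0

variable {J : ℕ} {σ : ℕ → Store}

lemma LevelRun.is_eq_mul (h : LevelRun G J σ) : ∀ i ≤ J, (σ i).var .is = i * s := by
  intro i hi
  induction i with
  | zero => simpa using h.is_eq
  | succ i ih =>
    rw [(h.step i (by omega)).is_eq, ih (by omega), h.s_eq i (by omega), add_mul, one_mul]

lemma LevelRun.bes_spec (h : LevelRun G J σ) : ∀ i ≤ J, ∀ v < n,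
    (∀ l < i, (σ i).arr .bes v ≤ (σ (l + 1)).levelBound v) ∧
    ((σ i).arr .bes v = (σ 0).graph.INF ∧ (σ i).arr .lev v = 0 ∨
      ∃ l < i, (σ i).arr .lev v = l * s ∧ (σ i).arr .bes v = (σ (l + 1)).levelBound v) := by
  intro i hi v hv
  induction i with
  | zero => exact ⟨by simp, .inl (h.bes_lev v hv)⟩
  | succ i ih =>
    obtain ⟨h1, h2⟩ := ih (by omega)
    obtain ⟨h3, h4⟩ := (h.step i (by omega)).bes_lev v (by rw [h.n_eq i (by omega)]; exact hv)
    rw [h.is_eq_mul i (by omega)] at h4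
    refine ⟨fun l hl => ?_, ?_⟩
    · rcases Nat.lt_succ_iff_lt_or_eq.1 hl with hl | rfl
      · have := h1 l hl
        omega
      · omega
    · by_cases hlt : (σ (i + 1)).levelBound v < (σ i).arr .bes v
      · rw [if_pos hlt] at h4
        exact .inr ⟨i, by omega, h4, by omega⟩
      · rw [if_neg hlt] at h4
        have h5 : (σ (i + 1)).arr .bes v = (σ i).arr .bes v := by omega
        rw [h4, h5]
        refine h2.imp_right ?_
        rintro ⟨l, hl, h6⟩
        exact ⟨l, by omega, h6⟩

/-- Every level removes a target, as long as there is one. -/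
lemma LevelRun.card_targets (h : LevelRun G J σ) : ∀ i ≤ J,
    (∀ x < s * n, (σ i).arr .tgt x < 1) ∨
    ((Finset.range (s * n)).filter fun x => ¬ (σ i).arr .tgt x < 1).card + i < J := by
  intro i hi
  induction i with
  | zero => exact .inr h.card_lt
  | succ i ih =>
    have hs := h.step i (by omega)
    have hN : (σ i).var .N = s * n := by
      have : (σ i).graph.N = s * n := by rw [h.graph_eq i (by omega)]; exact h.product.N_eq
      exact this
    have hle : ∀ x, (σ i).arr .tgt x < 1 → (σ (i + 1)).arr .tgt x < 1 := by
      intro x hx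
      rw [hs.tgt_eq, Function.update_apply]
      split_ifs
      · exact Nat.one_pos
      · exact hx
    rcases ih (by omega) with h0 | h1
    · exact .inl fun x hx => hle x (h0 x hx)
    · by_cases hex : ∃ x < s * n, ¬ (σ i).arr .tgt x < 1
      · obtain ⟨h2, h3, -⟩ := hs.tx_spec (by rwa [hN])
        right
        have : ((Finset.range (s * n)).filter fun x => ¬ (σ (i + 1)).arr .tgt x < 1).card <
            ((Finset.range (s * n)).filter fun x => ¬ (σ i).arr .tgt x < 1).card := by
          refine Finset.card_lt_card ((Finset.ssubset_iff_of_subset fun x hx => ?_).2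
            ⟨(σ (i + 1)).var .tx, ?_, ?_⟩)
          · simp only [Finset.mem_filter] at hx ⊢
            exact ⟨hx.1, fun h' => hx.2 (hle x h')⟩
          · simp only [Finset.mem_filter, Finset.mem_range]
            exact ⟨by rwa [← hN], h3⟩
          · simp [hs.tgt_eq]
        omega
      · push Not at hex
        exact .inl fun x hx => hle x (by have := hex x hx; omega)

/-- The levels computed by the program form a chain as required for optimality. -/
theorem LevelRun.exists_isLevelChain (h : LevelRun G J σ) (hn : 0 < n) : ∃ ℓ : Fin n → ℕ,
    (∀ v : Fin n, (σ J).arr .lev v = ℓ v * s) ∧ ∃ T d D t,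
      G.IsLevelChain (J - 1) T d D t (fun i => moveOf ((σ (i + 1)).arr .nxt)) ℓ := by
  have hJ : 0 < J := lt_of_le_of_lt (Nat.zero_le _) h.card_lt
  have hs0 : 0 < s := lt_of_le_of_lt (Nat.zero_le _) (G.dfa.start).2
  set g := (σ 0).graph with hg
  have hgi : ∀ i < J, (σ i).graph = g := fun i hi => h.graph_eq i hi.le
  have hN : ∀ i < J, (σ i).var .N = s * n := fun i hi => by
    have : (σ i).graph.N = s * n := by rw [hgi i hi]; exact h.product.N_eq
    exact this
  have hℓ : ∀ v : Fin n, ∃ l < J, (σ J).arr .lev v = l * s ∧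
      ∀ i < J, g.toENat ((σ (l + 1)).levelBound v) ≤ g.toENat ((σ (i + 1)).levelBound v) := by
    intro v
    obtain ⟨h1, ⟨h2, h3⟩ | ⟨l, hl, h2, h3⟩⟩ := h.bes_spec J le_rfl v v.2
    · refine ⟨0, hJ, by simpa using h3, fun i hi => ?_⟩
      have := h1 i hi
      rw [h2] at this
      rw [g.toENat_of_not_lt (not_lt.2 this)]
      exact le_top
    · exact ⟨l, hl, h2, fun i hi => g.toENat_mono (h3 ▸ h1 i hi)⟩
  choose ℓ hℓJ hlev hmin using hℓ
  have htx : ∀ i, i < J → (σ (i + 1)).var .tx < s * n := by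
    intro i hi
    by_cases hex : ∃ x < (σ i).var .N, ¬ (σ i).arr .tgt x < 1
    · rw [← hN i hi]
      exact ((h.step i hi).tx_spec hex).1
    · rw [(h.step i hi).tx_eq hex]
      positivity
  have ht : ∀ i, ∃ x : Fin n × Fin s, i < J → posIdx x = (σ (i + 1)).var .tx := by
    intro i
    by_cases hi : i < J
    · obtain ⟨x, hx⟩ := exists_posIdx_eq (htx i hi)
      exact ⟨x, fun _ => hx⟩
    · exact ⟨(⟨0, hn⟩, ⟨0, hs0⟩), fun h' => absurd h' hi⟩
  choose t ht using ht
  have hdist : ∀ i < J, g.IsDist ((σ i).arr .tgt) ((σ (i + 1)).arr .dis)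
      ((σ (i + 1)).arr .nxt) := fun i hi => hgi i hi ▸ (h.step i hi).isDist
  refine ⟨ℓ, hlev, fun i => markedSet n s ((σ i).arr .tgt),
    fun i x => g.toENat ((σ (i + 1)).arr .dis (posIdx x)),
    fun i => g.toENat ((σ (i + 1)).var .Dm), t, ?_, fun i hi => ?_, ?_,
    fun i hi => (hdist i (by omega)).isLowerDist h.product,
    fun i hi => (hdist i (by omega)).isUpperDist h.product, fun i hi x hx => ?_,
    fun i hi hx => ?_, fun v => ?_, fun v i hi => ?_⟩
  · ext x
    exact h.tgt_iff x
  · ext x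
    simp only [markedSet, Set.mem_ofPred_eq, Set.mem_sdiff, Set.mem_singleton_iff]
    rw [(h.step i (by omega)).tgt_eq, ← ht i (by omega), Function.update_apply]
    by_cases hx : x = t i
    · simp [hx]
    · simp [hx, posIdx_inj]
  · ext x
    simp only [markedSet, Set.mem_ofPred_eq, Set.mem_empty_iff_false, iff_false, not_not]
    rcases h.card_targets (J - 1) (by omega) with h0 | h1
    · exact h0 _ (posIdx_lt x)
    · have : ((Finset.range (s * n)).filter
          fun x => ¬ (σ (J - 1)).arr .tgt x < 1).card = 0 := by omega
      rw [Finset.card_eq_zero, Finset.filter_eq_empty_iff] at this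
      exact not_not.1 (this (Finset.mem_range.2 (posIdx_lt x)))
  · exact g.toENat_mono ((h.step i (by omega)).le_Dm _ (hN i (by omega) ▸ posIdx_lt x) hx)
  · obtain ⟨-, -, h3⟩ := (h.step i (by omega)).tx_spec
      ⟨posIdx (t i), hN i (by omega) ▸ posIdx_lt _, hx⟩
    simp only [ht i (by omega), h3]
  · have := hℓJ v
    omega
  · have key : ∀ i < J, max (g.toENat ((σ (i + 1)).var .Dm))
        (g.toENat ((σ (i + 1)).arr .dis (posIdx (G.startPos v)))) =
        g.toENat ((σ (i + 1)).levelBound v) := by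
      intro i hi
      rw [Store.levelBound, h.start_eq (i + 1) (by omega), g.toENat_mono.map_max]
    rw [key _ (hℓJ v), key i (by omega)]
    exact hmin v i (by omega)

end Product

/-! ### Building the product -/

/-- `I` holds the encoding of the game `G` with the edge list `L`, followed by zeros. -/
structure IsInput {n k s : ℕ} (G : RegularLimitGame (Fin n) (Fin k) (Fin s))
    (L : List (Fin n × Fin n)) (I : ℕ → ℕ) : Prop where
  zero : I 0 = n
  one : I 1 = k
  two : I 2 = s
  three : I 3 = L.length
  four : I 4 = G.dfa.start
  own : ∀ v : Fin n, I (5 + v) = G.arena.owner v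
  col : ∀ v : Fin n, I (5 + n + v) = G.arena.color v
  acc : ∀ q : Fin s, (q ∈ G.dfa.accept → I (5 + n + n + q) = 1) ∧
    (q ∉ G.dfa.accept → I (5 + n + n + q) = 0)
  edge : ∀ j (hj : j < L.length), I (5 + n + n + s + 3 * j) = L[j].1 ∧
    I (5 + n + n + s + 3 * j + 1) = L[j].2 ∧
    I (5 + n + n + s + 3 * j + 2) = G.arena.weight L[j].1 L[j].2
  step : ∀ (q : Fin s) (c : Fin k),
    I (5 + n + n + s + 3 * L.length + q * k + c) = G.dfa.step q c
  eq_zero : ∀ a, 5 + n + n + s + 3 * L.length + s * k ≤ a → I a = 0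

/-- Read the sizes, and locate the tables of the input. -/
def readProg : Stmt :=
  .assign .n (inp (num 0)) ;;
  .assign .k (inp (num 1)) ;;
  .assign .s (inp (num 2)) ;;
  .assign .ne (inp (num 3)) ;;
  .assign .qI (inp (num 4)) ;;
  .assign .cb (num 5 + var .n) ;;
  .assign .ab (var .cb + var .n) ;;
  .assign .eb (var .ab + var .s) ;;
  .assign .tb (var .eb + var .ne + var .ne + var .ne)

/-- Tabulate the multiples of `n`. -/
def mulProg : Stmt :=
  .assign .qn (num 0) ;;
  .loop .q .s (.put .mul (var .q) (var .qn) ;; .assign .qn (var .qn + var .n)) ;;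
  .assign .N (var .qn)

/-- Tabulate the positions of the product with state `q`. -/
def posStep : Stmt :=
  .put .stq (var .qn + var .v) (inp (var .rb + inp (var .cb + var .v))) ;;
  .put .own (var .qn + var .v) (inp (num 5 + var .v)) ;;
  .put .tgt (var .qn + var .v) (inp (var .ab + var .q)) ;;
  .assign .J (var .J + inp (var .ab + var .q))

/-- Tabulate the edges of the product that leave positions with state `q`. -/
def edgeStep : Stmt :=
  .assign .z (inp (var .ep + num 1)) ;;
  .put .src (var .pe) (var .qn + inp (var .ep)) ;;
  .put .dst (var .pe) (get .mul (inp (var .rb + inp (var .cb + var .z))) + var .z) ;;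
  .put .wgt (var .pe) (inp (var .ep + num 2)) ;;
  .put .dsv (var .pe) (var .z) ;;
  .assign .ep (var .ep + num 3) ;;
  .assign .pe (var .pe + num 1)

/-- Tabulate the part of the product with state `q`. -/
def rowStep : Stmt :=
  .loop .v .n posStep ;;
  .assign .ep (var .eb) ;;
  .loop .j .ne edgeStep ;;
  .assign .qn (var .qn + var .n) ;;
  .assign .rb (var .rb + var .k)

/-- Tabulate the product. The number of levels `J` exceeds the number of targets by `1`. -/
def buildProg : Stmt :=
  .assign .qn (num 0) ;;
  .assign .rb (var .tb) ;;
  .assign .pe (num 0) ;;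
  .assign .J (num 1) ;;
  .loop .q .s rowStep ;;
  .assign .PE (var .pe)

lemma posLoop_spec (I : ℕ → ℕ) (σ : Store) :
    let τ := (Stmt.loop .v .n posStep).den I σ
    (∀ v < σ.var .n, τ.arr .stq (σ.var .qn + v) = I (σ.var .rb + I (σ.var .cb + v)) ∧
      τ.arr .own (σ.var .qn + v) = I (5 + v) ∧
      τ.arr .tgt (σ.var .qn + v) = I (σ.var .ab + σ.var .q)) ∧
    (∀ a < σ.var .qn, τ.arr .stq a = σ.arr .stq a ∧ τ.arr .own a = σ.arr .own a ∧
      τ.arr .tgt a = σ.arr .tgt a) ∧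
    τ.var .J = σ.var .J + σ.var .n * I (σ.var .ab + σ.var .q) := by
  obtain ⟨τ, hτ, he⟩ := Stmt.loop_rule (I := I) (x := .v) (b := .n) (σ := σ) (P := posStep)
    (fun i τ => (∀ v < i, τ.arr .stq (σ.var .qn + v) = I (σ.var .rb + I (σ.var .cb + v)) ∧
      τ.arr .own (σ.var .qn + v) = I (5 + v) ∧
      τ.arr .tgt (σ.var .qn + v) = I (σ.var .ab + σ.var .q)) ∧
      (∀ a < σ.var .qn, τ.arr .stq a = σ.arr .stq a ∧ τ.arr .own a = σ.arr .own a ∧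
        τ.arr .tgt a = σ.arr .tgt a) ∧
      τ.var .J = σ.var .J + i * I (σ.var .ab + σ.var .q))
    (by simp) (by
      intro i _ τ hA ⟨ih1, ih2, ih3⟩
      have e1 := hA.1 .qn (by decide)
      have e2 := hA.1 .rb (by decide)
      have e3 := hA.1 .cb (by decide)
      have e4 := hA.1 .ab (by decide)
      have e5 := hA.1 .q (by decide)
      simp only [posStep, Stmt.den, Ex.eval, Store.set_arr, Store.set_var_self,
        Store.put_var, Store.put_arr_self, e1, e2, e3, e4, e5, ih3, ne_eq, reduceCtorEq,
        not_false_eq_true, Store.set_var_of_ne, Store.put_arr_of_ne]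
      refine ⟨fun v hv => ?_, fun a ha => ?_, by ring⟩
      · rcases Nat.lt_succ_iff_lt_or_eq.1 hv with hv | rfl
        · have hne : σ.var .qn + v ≠ σ.var .qn + i := by omega
          simpa only [Function.update_of_ne hne] using ih1 v hv
        · simp
      · have hne : a ≠ σ.var .qn + i := by omega
        simpa only [Function.update_of_ne hne] using ih2 a ha)
  simp only [he]
  simpa using hτ

lemma edgeLoop_spec (I : ℕ → ℕ) (σ : Store) :
    let τ := (Stmt.loop .j .ne edgeStep).den I σ
    (∀ j < σ.var .ne, τ.arr .src (σ.var .pe + j) = σ.var .qn + I (σ.var .ep + 3 * j) ∧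
      τ.arr .dst (σ.var .pe + j) =
        σ.arr .mul (I (σ.var .rb + I (σ.var .cb + I (σ.var .ep + 3 * j + 1)))) +
          I (σ.var .ep + 3 * j + 1) ∧
      τ.arr .wgt (σ.var .pe + j) = I (σ.var .ep + 3 * j + 2) ∧
      τ.arr .dsv (σ.var .pe + j) = I (σ.var .ep + 3 * j + 1)) ∧
    (∀ a < σ.var .pe, τ.arr .src a = σ.arr .src a ∧ τ.arr .dst a = σ.arr .dst a ∧
      τ.arr .wgt a = σ.arr .wgt a ∧ τ.arr .dsv a = σ.arr .dsv a) ∧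
    τ.var .pe = σ.var .pe + σ.var .ne := by
  obtain ⟨τ, hτ, he⟩ := Stmt.loop_rule (I := I) (x := .j) (b := .ne) (σ := σ) (P := edgeStep)
    (fun i τ => (∀ j < i, τ.arr .src (σ.var .pe + j) = σ.var .qn + I (σ.var .ep + 3 * j) ∧
      τ.arr .dst (σ.var .pe + j) =
        σ.arr .mul (I (σ.var .rb + I (σ.var .cb + I (σ.var .ep + 3 * j + 1)))) +
          I (σ.var .ep + 3 * j + 1) ∧
      τ.arr .wgt (σ.var .pe + j) = I (σ.var .ep + 3 * j + 2) ∧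
      τ.arr .dsv (σ.var .pe + j) = I (σ.var .ep + 3 * j + 1)) ∧
      (∀ a < σ.var .pe, τ.arr .src a = σ.arr .src a ∧ τ.arr .dst a = σ.arr .dst a ∧
        τ.arr .wgt a = σ.arr .wgt a ∧ τ.arr .dsv a = σ.arr .dsv a) ∧
      τ.var .pe = σ.var .pe + i ∧ τ.var .ep = σ.var .ep + 3 * i)
    (by simp) (by
      intro i _ τ hA ⟨ih1, ih2, ih3, ih4⟩
      have e1 := hA.1 .qn (by decide)
      have e2 := hA.1 .rb (by decide)
      have e3 := hA.1 .cb (by decide)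
      have e4 := hA.2 .mul (by decide)
      simp only [edgeStep, Stmt.den, Ex.eval, Store.set_arr, Store.set_var_self,
        Store.put_var, Store.put_arr_self, e1, e2, e3, e4, ih3, ih4, ne_eq, reduceCtorEq,
        not_false_eq_true, Store.set_var_of_ne, Store.put_arr_of_ne]
      refine ⟨fun j hj => ?_, fun a ha => ?_, by ring, by ring⟩
      · rcases Nat.lt_succ_iff_lt_or_eq.1 hj with hj | rfl
        · have hne : σ.var .pe + j ≠ σ.var .pe + i := by omega
          simpa only [Function.update_of_ne hne] using ih1 j hj
        · simp
      · have hne : a ≠ σ.var .pe + i := by omega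
        simpa only [Function.update_of_ne hne] using ih2 a ha)
  simp only [he]
  obtain ⟨h1, h2, h3, -⟩ := hτ
  simpa using ⟨h1, h2, h3⟩

lemma mulProg_spec (I : ℕ → ℕ) (σ : Store) :
    (∀ q < σ.var .s, (mulProg.den I σ).arr .mul q = q * σ.var .n) ∧
    (mulProg.den I σ).var .N = σ.var .s * σ.var .n := by
  obtain ⟨τ, hτ, he⟩ := Stmt.loop_rule (I := I) (x := .q) (b := .s) (σ := σ.set .qn 0)
    (P := .put .mul (var .q) (var .qn) ;; .assign .qn (var .qn + var .n))
    (fun i τ => (∀ q < i, τ.arr .mul q = q * σ.var .n) ∧ τ.var .qn = i * σ.var .n)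
    (by simp) (by
      intro i _ τ hA ⟨ih1, ih2⟩
      have e1 := hA.1 .n (by decide)
      simp only [ne_eq, reduceCtorEq, not_false_eq_true, Store.set_var_of_ne] at e1
      simp only [Stmt.den, Ex.eval, Store.set_arr, Store.set_var_self,
        Store.put_var, Store.put_arr_self, e1, ih2, ne_eq, reduceCtorEq,
        not_false_eq_true, Store.set_var_of_ne]
      refine ⟨fun q hq => ?_, by ring⟩
      rcases Nat.lt_succ_iff_lt_or_eq.1 hq with hq | rfl
      · simpa [hq.ne] using ih1 q hq
      · simp)
  simp only [mulProg, Stmt.den, Ex.eval] at he ⊢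
  rw [he]
  simpa using hτ

lemma buildProg_spec (I : ℕ → ℕ) (σ : Store) :
    let τ := buildProg.den I σ
    let n := σ.var .n
    let ne := σ.var .ne
    (∀ q < σ.var .s, ∀ v < n,
      τ.arr .stq (q * n + v) = I (σ.var .tb + q * σ.var .k + I (σ.var .cb + v)) ∧
      τ.arr .own (q * n + v) = I (5 + v) ∧ τ.arr .tgt (q * n + v) = I (σ.var .ab + q)) ∧
    (∀ q < σ.var .s, ∀ j < ne,
      τ.arr .src (q * ne + j) = q * n + I (σ.var .eb + 3 * j) ∧
      τ.arr .dst (q * ne + j) = σ.arr .mul (I (σ.var .tb + q * σ.var .k +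
        I (σ.var .cb + I (σ.var .eb + 3 * j + 1)))) + I (σ.var .eb + 3 * j + 1) ∧
      τ.arr .wgt (q * ne + j) = I (σ.var .eb + 3 * j + 2) ∧
      τ.arr .dsv (q * ne + j) = I (σ.var .eb + 3 * j + 1)) ∧
    τ.var .PE = σ.var .s * ne ∧
    τ.var .J = 1 + n * ∑ q ∈ Finset.range (σ.var .s), I (σ.var .ab + q) := by
  intro τ n ne
  obtain ⟨τ', hτ, he⟩ := Stmt.loop_rule (I := I) (x := .q) (b := .s)
    (σ := (((σ.set .qn 0).set .rb (σ.var .tb)).set .pe 0).set .J 1) (P := rowStep)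
    (fun i τ =>
    (∀ q < i, ∀ v < n,
      τ.arr .stq (q * n + v) = I (σ.var .tb + q * σ.var .k + I (σ.var .cb + v)) ∧
      τ.arr .own (q * n + v) = I (5 + v) ∧ τ.arr .tgt (q * n + v) = I (σ.var .ab + q)) ∧
    (∀ q < i, ∀ j < ne,
      τ.arr .src (q * ne + j) = q * n + I (σ.var .eb + 3 * j) ∧
      τ.arr .dst (q * ne + j) = σ.arr .mul (I (σ.var .tb + q * σ.var .k +
        I (σ.var .cb + I (σ.var .eb + 3 * j + 1)))) + I (σ.var .eb + 3 * j + 1) ∧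
      τ.arr .wgt (q * ne + j) = I (σ.var .eb + 3 * j + 2) ∧
      τ.arr .dsv (q * ne + j) = I (σ.var .eb + 3 * j + 1)) ∧
    τ.var .pe = i * ne ∧
    τ.var .J = 1 + n * ∑ q ∈ Finset.range i, I (σ.var .ab + q) ∧
    τ.var .qn = i * n ∧ τ.var .rb = σ.var .tb + i * σ.var .k)
    (by simp) (by
      intro i _ τ hA ⟨ih1, ih2, ih3, ih4, ih5, ih6⟩
      have en : τ.var .n = n := hA.1 .n (by decide)
      have ene : τ.var .ne = ne := hA.1 .ne (by decide)
      have ecb : τ.var .cb = σ.var .cb := hA.1 .cb (by decide)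
      have eab : τ.var .ab = σ.var .ab := hA.1 .ab (by decide)
      have eeb : τ.var .eb = σ.var .eb := hA.1 .eb (by decide)
      have ek : τ.var .k = σ.var .k := hA.1 .k (by decide)
      have emul : τ.arr .mul = σ.arr .mul := hA.2 .mul (by decide)
      simp only [rowStep, Stmt.den, Ex.eval]
      -- Step through the loop over the positions with state `i`.
      obtain ⟨h1, h2, h3⟩ := posLoop_spec I (τ.set .q i)
      have hA1 := (Stmt.loop .v .n posStep).agree_den I (τ.set .q i)
      simp only [Stmt.den] at h1 h2 h3 hA1
      generalize (iter (fun i τ => posStep.den I (τ.set .v i)) ((τ.set .q i).var .n)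
        (τ.set .q i)).set .v ((τ.set .q i).var .n) = σ₁ at h1 h2 h3 hA1
      -- Step through the loop over the edges that leave them.
      obtain ⟨h4, h5, h6⟩ := edgeLoop_spec I (σ₁.set .ep (σ₁.var .eb))
      have hA2 := (Stmt.loop .j .ne edgeStep).agree_den I (σ₁.set .ep (σ₁.var .eb))
      simp only [Stmt.den] at h4 h5 h6 hA2
      generalize (iter (fun i τ => edgeStep.den I (τ.set .j i))
        ((σ₁.set .ep (σ₁.var .eb)).var .ne) (σ₁.set .ep (σ₁.var .eb))).set .j
        ((σ₁.set .ep (σ₁.var .eb)).var .ne) = σ₂ at h4 h5 h6 hA2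
      have f1 : ∀ x, x ∉ (Stmt.loop .v .n posStep).mods → x ≠ .q → σ₁.var x = τ.var x :=
        fun x hx hq => (hA1.1 x hx).trans (Store.set_var_of_ne _ _ hq)
      have f2 : ∀ x, x ∉ (Stmt.loop .j .ne edgeStep).mods → x ≠ .ep → σ₂.var x = σ₁.var x :=
        fun x hx hq => (hA2.1 x hx).trans (Store.set_var_of_ne _ _ hq)
      have g1 : ∀ a, a ∉ (Stmt.loop .v .n posStep).amods → σ₁.arr a = τ.arr a :=
        fun a ha => hA1.2 a ha
      have g2 : ∀ a, a ∉ (Stmt.loop .j .ne edgeStep).amods → σ₂.arr a = σ₁.arr a :=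
        fun a ha => hA2.2 a ha
      simp only [ne_eq, reduceCtorEq, not_false_eq_true, Store.set_var_of_ne, Store.set_var_self,
        Store.set_arr, en, ecb, eab, ih4, ih5, ih6] at h1 h2 h3
      simp only [ne_eq, reduceCtorEq, not_false_eq_true, Store.set_var_of_ne, Store.set_var_self,
        Store.set_arr, f1 .ne (by decide) (by decide), f1 .pe (by decide) (by decide),
        f1 .eb (by decide) (by decide), f1 .qn (by decide) (by decide),
        f1 .rb (by decide) (by decide), f1 .cb (by decide) (by decide), g1 .mul (by decide),
        g1 .src (by decide), g1 .dst (by decide), g1 .wgt (by decide), g1 .dsv (by decide),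
        emul, ene, ecb, eeb, ih3, ih5, ih6] at h4 h5 h6
      simp only [ne_eq, reduceCtorEq, not_false_eq_true, Store.set_var_of_ne, Store.set_var_self,
        Store.set_arr, g2 .stq (by decide), g2 .own (by decide), g2 .tgt (by decide), h6,
        f2 .J (by decide) (by decide), h3, f2 .qn (by decide) (by decide),
        f2 .n (by decide) (by decide), f2 .rb (by decide) (by decide),
        f2 .k (by decide) (by decide), f1 .qn (by decide) (by decide),
        f1 .n (by decide) (by decide), f1 .rb (by decide) (by decide),
        f1 .k (by decide) (by decide), ih5, ih6, en, ek, Finset.sum_range_succ]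
      refine ⟨fun q hq v hv => ?_, fun q hq j hj => ?_, by ring, by ring, by ring, by ring⟩
      · rcases Nat.lt_succ_iff_lt_or_eq.1 hq with hq | rfl
        · have : (q + 1) * n ≤ i * n := Nat.mul_le_mul_right _ hq
          rw [add_mul, one_mul] at this
          obtain ⟨h7, h8, h9⟩ := h2 (q * n + v) (by omega)
          rw [h7, h8, h9]
          exact ih1 q hq v hv
        · exact h1 v hv
      · rcases Nat.lt_succ_iff_lt_or_eq.1 hq with hq | rfl
        · have : (q + 1) * ne ≤ i * ne := Nat.mul_le_mul_right _ hq
          rw [add_mul, one_mul] at this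
          obtain ⟨h7, h8, h9, h10⟩ := h5 (q * ne + j) (by omega)
          rw [h7, h8, h9, h10]
          exact ih2 q hq j hj
        · exact h4 j hj)
  have hτ' : τ = (τ'.set .q (σ.var .s)).set .PE (τ'.var .pe) := by
    have hb : τ = ((Stmt.loop .q .s rowStep).den I
        ((((σ.set .qn 0).set .rb (σ.var .tb)).set .pe 0).set .J 1)).set .PE
        (((Stmt.loop .q .s rowStep).den I
          ((((σ.set .qn 0).set .rb (σ.var .tb)).set .pe 0).set .J 1)).var .pe) := rfl
    rw [hb, he]
    simp
  simp only [ne_eq, reduceCtorEq, not_false_eq_true, Store.set_var_of_ne] at hτ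
  obtain ⟨h1, h2, h3, h4, -, -⟩ := hτ
  rw [hτ']
  exact ⟨h1, h2, by simpa using h3, by simpa using h4⟩

/-- The arrays hold the product of the arena with the automaton. -/
structure IsBuilt {n k s : ℕ} (G : RegularLimitGame (Fin n) (Fin k) (Fin s)) (σ : Store) :
    Prop where
  n_eq : σ.var .n = n
  s_eq : σ.var .s = s
  J_eq : σ.var .J = 1 + n * G.dfa.accept.ncard
  mul_eq : ∀ q : Fin s, σ.arr .mul q = q * n
  qI_eq : σ.var .qI = G.dfa.start
  stq_eq : ∀ x : Fin n × Fin s, σ.arr .stq (posIdx x) = G.dfa.step x.2 (G.arena.color x.1)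
  tgt_iff : ∀ x : Fin n × Fin s, ¬ σ.arr .tgt (posIdx x) < 1 ↔ x ∈ G.target
  product : IsProductGraph G σ.graph

section Built

variable {n k s : ℕ} {G : RegularLimitGame (Fin n) (Fin k) (Fin s)} {σ : Store}

lemma IsBuilt.stq_start (h : IsBuilt G σ) (v : Fin n) :
    σ.arr .stq (σ.arr .mul (σ.var .qI) + v) = (G.startPos v).2 := by
  rw [h.qI_eq, h.mul_eq]
  exact h.stq_eq (v, G.dfa.start)

lemma IsBuilt.startIdx_eq (h : IsBuilt G σ) (v : Fin n) :
    σ.startIdx v = posIdx (G.startPos v) := by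
  rw [Store.startIdx, h.stq_start, h.mul_eq]
  rfl

/-- There are enough levels to remove all targets. -/
lemma IsBuilt.card_targets_lt (h : IsBuilt G σ) :
    ((Finset.range (s * n)).filter fun x => ¬ σ.arr .tgt x < 1).card < σ.var .J := by
  classical
  have hsub : ((Finset.range (s * n)).filter fun x => ¬ σ.arr .tgt x < 1) ⊆
      (Finset.univ ×ˢ (Finset.univ.filter (· ∈ G.dfa.accept))).image
        (posIdx : Fin n × Fin s → ℕ) := by
    intro i hi
    simp only [Finset.mem_filter, Finset.mem_range] at hi
    obtain ⟨x, rfl⟩ := exists_posIdx_eq hi.1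
    refine Finset.mem_image_of_mem _ ?_
    simpa [RegularLimitGame.target] using (h.tgt_iff x).1 hi.2
  have hcard := (Finset.card_le_card hsub).trans Finset.card_image_le
  rw [Finset.card_product, Finset.card_univ, Fintype.card_fin] at hcard
  have hn : (Finset.univ.filter (· ∈ G.dfa.accept)).card = G.dfa.accept.ncard := by
    rw [← Set.ncard_coe_finset]
    congr 1
    ext
    simp
  rw [hn] at hcard
  rw [h.J_eq]
  omega

end Built

/-- Tabulate the product, once the parts of the input have been located. -/
def setupProg : Stmt := mulProg ;; buildProg

lemma readProg_spec {n k s : ℕ} {G : RegularLimitGame (Fin n) (Fin k) (Fin s)}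
    {L : List (Fin n × Fin n)} {I : ℕ → ℕ} (hI : IsInput G L I) (σ : Store) :
    (readProg.den I σ).var .n = n ∧ (readProg.den I σ).var .k = k ∧
    (readProg.den I σ).var .s = s ∧ (readProg.den I σ).var .ne = L.length ∧
    (readProg.den I σ).var .qI = G.dfa.start ∧ (readProg.den I σ).var .cb = 5 + n ∧
    (readProg.den I σ).var .ab = 5 + n + n ∧ (readProg.den I σ).var .eb = 5 + n + n + s ∧
    (readProg.den I σ).var .tb = 5 + n + n + s + 3 * L.length := by
  simp only [readProg, Stmt.den, Ex.eval, Store.set_var_self, ne_eq, reduceCtorEq,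
    not_false_eq_true, Store.set_var_of_ne, hI.zero, hI.one, hI.two, hI.three, hI.four, true_and]
  omega

lemma setupProg_spec {n k s : ℕ} {G : RegularLimitGame (Fin n) (Fin k) (Fin s)}
    {L : List (Fin n × Fin n)} (hL : IsEdgeList G.arena L) {I : ℕ → ℕ} (hI : IsInput G L I)
    (σ : Store) : IsBuilt G (setupProg.den I (readProg.den I σ)) ∧
      (setupProg.den I (readProg.den I σ)).var .PE = s * L.length ∧
      (setupProg.den I (readProg.den I σ)).var .N = s * n := by
  obtain ⟨an, ak, as, ane, aqI, acb, aab, aeb, atb⟩ := readProg_spec hI σ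
  generalize readProg.den I σ = σ₀ at *
  obtain ⟨h1, h2⟩ := mulProg_spec I σ₀
  have hA := mulProg.agree_den I σ₀
  simp only [setupProg, Stmt.den]
  generalize mulProg.den I σ₀ = σ₁ at *
  obtain ⟨h3, h4, h5, h6⟩ := buildProg_spec I σ₁
  have hB := buildProg.agree_den I σ₁
  generalize buildProg.den I σ₁ = τ at *
  have en := (hA.1 .n (by decide)).trans an
  have ek := (hA.1 .k (by decide)).trans ak
  have es := (hA.1 .s (by decide)).trans as
  have ene := (hA.1 .ne (by decide)).trans ane
  have ecb := (hA.1 .cb (by decide)).trans acb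
  have eab := (hA.1 .ab (by decide)).trans aab
  have eeb := (hA.1 .eb (by decide)).trans aeb
  have etb := (hA.1 .tb (by decide)).trans atb
  rw [es, en, ecb, eab, etb, ek] at h3
  rw [es, en, ene, ecb, eeb, etb, ek] at h4
  rw [es, ene] at h5
  rw [es, en, eab] at h6
  rw [as, an] at h1 h2
  have eN : τ.var .N = s * n := (hB.1 .N (by decide)).trans h2
  have hedge : ∀ (q : Fin s) (j : ℕ) (hj : j < L.length),
      let x : Fin n × Fin s := (L[j].1, q)
      τ.arr .src (q * L.length + j) = posIdx x ∧
      τ.arr .dst (q * L.length + j) = posIdx (G.succPos x L[j].2) ∧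
      τ.arr .wgt (q * L.length + j) = G.arena.weight x.1 L[j].2 ∧
      τ.arr .dsv (q * L.length + j) = L[j].2 := by
    intro q j hj x
    obtain ⟨e1, e2, e3⟩ := hI.edge j hj
    obtain ⟨h7, h8, h9, h10⟩ := h4 q q.2 j hj
    rw [e1] at h7
    rw [e2, hI.col, hI.step, h1 _ (Fin.is_lt _)] at h8
    rw [e3] at h9
    rw [e2] at h10
    exact ⟨h7, h8, h9, h10⟩
  refine ⟨⟨(hB.1 .n (by decide)).trans en, (hB.1 .s (by decide)).trans es, ?_, fun q => ?_,
    (hB.1 .qI (by decide)).trans ((hA.1 .qI (by decide)).trans aqI), fun x => ?_, fun x => ?_,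
    ⟨eN, fun x => ?_, fun x v hv => ?_, fun e he => ?_⟩⟩, h5, eN⟩
  · classical
    rw [h6, Finset.sum_range]
    have : ∀ q : Fin s, I (5 + n + n + q) = if q ∈ G.dfa.accept then 1 else 0 := by
      intro q
      split_ifs with hq
      · exact (hI.acc q).1 hq
      · exact (hI.acc q).2 hq
    rw [Finset.sum_congr rfl fun q _ => this q, Finset.sum_boole, ← Set.ncard_coe_finset]
    simp
  · rw [hB.2 .mul (by decide), h1 q q.2]
  · refine (h3 x.2 x.2.2 x.1 x.1.2).1.trans ?_
    rw [hI.col, hI.step]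
  · have := (h3 x.2 x.2.2 x.1 x.1.2).2.2
    change ¬ τ.arr .tgt (x.2 * n + x.1) < 1 ↔ x.2 ∈ G.dfa.accept
    rw [this]
    by_cases hx : x.2 ∈ G.dfa.accept
    · simp [hx, (hI.acc _).1 hx]
    · simp [hx, (hI.acc _).2 hx]
  · exact (h3 x.2 x.2.2 x.1 x.1.2).2.1.trans (hI.own _)
  · obtain ⟨j, hj, hx⟩ := List.getElem_of_mem ((hL.2 _ _).2 hv)
    have h7 := hedge x.2 j hj
    rw [hx] at h7
    refine ⟨x.2 * L.length + j, ?_, h7⟩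
    have : (x.2 + 1) * L.length ≤ s * L.length := Nat.mul_le_mul_right _ x.2.2
    rw [add_mul, one_mul] at this
    change _ < τ.var .PE
    omega
  · change e < τ.var .PE at he
    rw [h5] at he
    obtain ⟨q, hq, j, hj, rfl⟩ := exists_mul_add he
    exact ⟨(L[j].1, ⟨q, hq⟩), L[j].2, (hL.2 _ _).1 (List.getElem_mem hj), hedge ⟨q, hq⟩ j hj⟩

/-! ### Running all levels -/

/-- Prepare the levels: `INF` exceeds the weight of every path that visits no position twice,
arbitrary moves are chosen, and the parts of the output are located. -/
def prepProg : Stmt :=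
  .assign .W (num 0) ;;
  .loop .e .PE (.assign .W (var .W + get .wgt (var .e)) ;;
    .put .cho (get .src (var .e)) (get .dsv (var .e))) ;;
  .assign .INF (var .W + num 1) ;;
  .loop .u .N (.assign .INF (var .INF + var .W)) ;;
  .loop .v .n (.put .bes (var .v) (var .INF) ;; .put .lev (var .v) (num 0)) ;;
  .assign .is (num 0) ;;
  .assign .m (num 0) ;;
  .assign .mn (num 0) ;;
  .loop .i .J (.assign .m (var .m + var .s) ;; .assign .mn (var .mn + var .N)) ;;
  .assign .o1 (num 1 + var .n) ;;
  .assign .o2 (num 1 + var .n + var .mn)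

/-- Write the number of memory states and the initialization function. -/
def finalProg : Stmt :=
  .put .out (num 0) (var .m) ;;
  .loop .v .n (.put .out (num 1 + var .v)
    (get .lev (var .v) + get .stq (get .mul (var .qI) + var .v)))

lemma weightLoop_spec (I : ℕ → ℕ) (σ : Store) :
    let τ := (Stmt.loop .e .PE (.assign .W (var .W + get .wgt (var .e)) ;;
      .put .cho (get .src (var .e)) (get .dsv (var .e)))).den I σ
    (∀ e < σ.var .PE, σ.arr .wgt e ≤ τ.var .W) ∧
    (∀ e < σ.var .PE, ∃ e' < σ.var .PE, σ.arr .src e' = σ.arr .src e ∧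
      τ.arr .cho (σ.arr .src e) = σ.arr .dsv e') := by
  obtain ⟨τ, hτ, he⟩ := Stmt.loop_rule (I := I) (x := .e) (b := .PE) (σ := σ)
    (P := .assign .W (var .W + get .wgt (var .e)) ;;
      .put .cho (get .src (var .e)) (get .dsv (var .e)))
    (fun i τ => (∀ e < i, σ.arr .wgt e ≤ τ.var .W) ∧
    (∀ e < i, ∃ e' < i, σ.arr .src e' = σ.arr .src e ∧
      τ.arr .cho (σ.arr .src e) = σ.arr .dsv e'))
    (by simp) (by
      intro i _ τ hA ⟨ih1, ih2⟩
      have e1 := hA.2 .wgt (by decide)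
      have e2 := hA.2 .src (by decide)
      have e3 := hA.2 .dsv (by decide)
      simp only [Stmt.den, Ex.eval, Store.set_arr, Store.set_var_self, Store.put_var,
        Store.put_arr_self, e1, e2, e3, ne_eq, reduceCtorEq, not_false_eq_true,
        Store.set_var_of_ne]
      refine ⟨fun e he => ?_, fun e he => ?_⟩
      · rcases Nat.lt_succ_iff_lt_or_eq.1 he with he | rfl
        · have := ih1 e he
          omega
        · omega
      · by_cases h : σ.arr .src e = σ.arr .src i
        · exact ⟨i, by omega, h.symm, by rw [h, Function.update_self]⟩
        · rcases Nat.lt_succ_iff_lt_or_eq.1 he with he | rfl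
          · obtain ⟨e', he', h'⟩ := ih2 e he
            exact ⟨e', by omega, by rwa [Function.update_of_ne h]⟩
          · exact absurd rfl h)
  simp only [he]
  simpa using hτ

lemma prepProg_spec (I : ℕ → ℕ) (σ : Store) :
    let τ := prepProg.den I σ
    (∃ W, (∀ e < σ.var .PE, σ.arr .wgt e ≤ W) ∧ (σ.var .N + 1) * W < τ.var .INF) ∧
    (∀ e < σ.var .PE, ∃ e' < σ.var .PE, σ.arr .src e' = σ.arr .src e ∧
      τ.arr .cho (σ.arr .src e) = σ.arr .dsv e') ∧
    (∀ v < σ.var .n, τ.arr .bes v = τ.var .INF ∧ τ.arr .lev v = 0) ∧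
    τ.var .is = 0 ∧ τ.var .m = σ.var .J * σ.var .s ∧ τ.var .o1 = 1 + σ.var .n ∧
    τ.var .o2 = 1 + σ.var .n + σ.var .J * σ.var .N := by
  obtain ⟨h1, h2⟩ := weightLoop_spec I (σ.set .W 0)
  have hA1 := (Stmt.loop .e .PE (.assign .W (var .W + get .wgt (var .e)) ;;
      .put .cho (get .src (var .e)) (get .dsv (var .e)))).agree_den I (σ.set .W 0)
  intro τ
  have hτ : τ = Stmt.den I (.assign .INF (var .W + num 1) ;;
    .loop .u .N (.assign .INF (var .INF + var .W)) ;;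
    .loop .v .n (.put .bes (var .v) (var .INF) ;; .put .lev (var .v) (num 0)) ;;
    .assign .is (num 0) ;;
    .assign .m (num 0) ;;
    .assign .mn (num 0) ;;
    .loop .i .J (.assign .m (var .m + var .s) ;; .assign .mn (var .mn + var .N)) ;;
    .assign .o1 (num 1 + var .n) ;;
    .assign .o2 (num 1 + var .n + var .mn))
    ((Stmt.loop .e .PE (.assign .W (var .W + get .wgt (var .e)) ;;
      .put .cho (get .src (var .e)) (get .dsv (var .e)))).den I (σ.set .W 0)) := rfl
  clear_value τ
  generalize (Stmt.loop .e .PE (.assign .W (var .W + get .wgt (var .e)) ;;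
      .put .cho (get .src (var .e)) (get .dsv (var .e)))).den I (σ.set .W 0) = σ₁ at *
  have eN : σ₁.var .N = σ.var .N := hA1.1 .N (by decide)
  have en : σ₁.var .n = σ.var .n := hA1.1 .n (by decide)
  have eJ : σ₁.var .J = σ.var .J := hA1.1 .J (by decide)
  have es : σ₁.var .s = σ.var .s := hA1.1 .s (by decide)
  simp only [Stmt.den, Ex.eval] at hτ
  -- `INF` grows by `W` for each position.
  obtain ⟨σ₂, ⟨hA2, h3⟩, he2⟩ := Stmt.loop_rule (I := I) (x := .u) (b := .N)
    (σ := σ₁.set .INF (σ₁.var .W + 1)) (P := .assign .INF (var .INF + var .W))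
    (fun i τ => Agree [.u, .INF] [] σ₁ τ ∧ τ.var .INF = (i + 1) * σ₁.var .W + 1)
    ⟨agree_set _ _ (by decide), by simp⟩ (by
      intro i _ τ hA ⟨ih1, ih2⟩
      have e1 : τ.var .W = σ₁.var .W := ih1.1 .W (by decide)
      simp only [Stmt.den, Ex.eval, Store.set_var_self, e1, ih2, ne_eq,
        reduceCtorEq, not_false_eq_true, Store.set_var_of_ne]
      exact ⟨(ih1.trans (agree_set τ i (by decide))).trans (agree_set _ _ (by decide)), by ring⟩)
  simp only [Stmt.den, Ex.eval] at he2
  rw [he2] at hτ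
  clear he2
  have hA2' : Agree [.u, .INF] [] σ₁ (σ₂.set .u ((σ₁.set .INF (σ₁.var .W + 1)).var .N)) :=
    hA2.trans (agree_set _ _ (by decide))
  have h3' : (σ₂.set .u ((σ₁.set .INF (σ₁.var .W + 1)).var .N)).var .INF =
      (σ₁.var .N + 1) * σ₁.var .W + 1 := by simpa using h3
  generalize σ₂.set .u ((σ₁.set .INF (σ₁.var .W + 1)).var .N) = σ₃ at *
  -- No level has been entered yet.
  obtain ⟨σ₄, ⟨hA4, h4⟩, he4⟩ := Stmt.loop_rule (I := I) (x := .v) (b := .n)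
    (σ := σ₃) (P := .put .bes (var .v) (var .INF) ;; .put .lev (var .v) (num 0))
    (fun i τ => Agree [.v] [.bes, .lev] σ₃ τ ∧
      ∀ v < i, τ.arr .bes v = σ₃.var .INF ∧ τ.arr .lev v = 0)
    ⟨.refl _ _ _, by simp⟩ (by
      intro i _ τ hA ⟨ih1, ih2⟩
      have e1 : τ.var .INF = σ₃.var .INF := ih1.1 .INF (by decide)
      refine ⟨(ih1.trans (agree_set τ i (by decide))).trans
        ((Stmt.agree_den I _ _).mono (by decide) (by decide)), fun v hv => ?_⟩
      simp only [Stmt.den, Ex.eval, Store.set_var_self, e1, ne_eq, Store.put_var,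
        Store.put_arr_self, reduceCtorEq, not_false_eq_true, Store.set_var_of_ne,
        Store.put_arr_of_ne, Store.set_arr]
      rcases Nat.lt_succ_iff_lt_or_eq.1 hv with hv | rfl
      · simpa [hv.ne] using ih2 v hv
      · simp)
  simp only [Stmt.den, Ex.eval] at he4
  rw [he4] at hτ
  clear he4
  have hA4' : Agree [.v] [.bes, .lev] σ₃ (σ₄.set .v (σ₃.var .n)) :=
    hA4.trans (agree_set _ _ (by decide))
  rw [show σ₄.arr = (σ₄.set .v (σ₃.var .n)).arr from rfl] at h4
  generalize σ₄.set .v (σ₃.var .n) = σ₅ at *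
  -- `m` and `mn` become the products `J * s` and `J * N`.
  obtain ⟨σ₆, ⟨hA6, h6, h7⟩, he6⟩ := Stmt.loop_rule (I := I) (x := .i) (b := .J)
    (σ := ((σ₅.set .is 0).set .m 0).set .mn 0)
    (P := .assign .m (var .m + var .s) ;; .assign .mn (var .mn + var .N))
    (fun i τ => Agree [.i, .m, .mn] [] (σ₅.set .is 0) τ ∧ τ.var .m = i * σ₅.var .s ∧
      τ.var .mn = i * σ₅.var .N)
    ⟨(agree_set _ _ (by decide)).trans (agree_set _ _ (by decide)), by simp, by simp⟩ (by
      intro i _ τ hA ⟨ih1, ih2, ih3⟩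
      have e1 : τ.var .s = σ₅.var .s := hA.1 .s (by decide)
      have e2 : τ.var .N = σ₅.var .N := hA.1 .N (by decide)
      refine ⟨(ih1.trans (agree_set τ i (by decide))).trans
        ((Stmt.agree_den I _ _).mono (by decide) (by decide)), ?_, ?_⟩
      · simp only [Stmt.den, Ex.eval, Store.set_var_self, e1, ih2, ne_eq,
          reduceCtorEq, not_false_eq_true, Store.set_var_of_ne]
        ring
      · simp only [Stmt.den, Ex.eval, Store.set_var_self, e2, ih3, ne_eq,
          reduceCtorEq, not_false_eq_true, Store.set_var_of_ne]
        ring)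
  simp only [Stmt.den, Ex.eval] at he6
  rw [he6] at hτ
  clear he6
  subst hτ
  have f1 : ∀ x ∉ [Var.u, .INF, .v], σ₅.var x = σ₁.var x := fun x hx => by
    simp only [List.mem_cons, List.not_mem_nil, or_false, not_or] at hx
    rw [hA4'.1 x (by simp [hx]), hA2'.1 x (by simp [hx])]
  have f2 : σ₆.var .INF = σ₃.var .INF := (hA6.1 .INF (by decide)).trans (hA4'.1 .INF (by decide))
  have f3 : σ₆.arr .cho = σ₁.arr .cho := ((hA6.2 .cho (by decide)).trans
    (hA4'.2 .cho (by decide))).trans (hA2'.2 .cho (by decide))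
  have f4 : σ₆.var .n = σ₅.var .n := hA6.1 .n (by decide)
  have f5 : σ₆.arr .bes = σ₅.arr .bes := hA6.2 .bes (by decide)
  have f6 : σ₆.arr .lev = σ₅.arr .lev := hA6.2 .lev (by decide)
  have f7 : σ₆.var .is = 0 := by
    rw [hA6.1 .is (by decide), Store.set_var_self]
  have f8 : σ₃.var .n = σ.var .n := (hA2'.1 .n (by decide)).trans en
  simp only [Store.set_arr, Store.set_var_self, ne_eq, reduceCtorEq, not_false_eq_true,
    Store.set_var_of_ne, f2, f3, f4, f5, f6, f7, f1 .n (by decide), f1 .J (by decide),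
    f1 .s (by decide), f1 .N (by decide), eN, en, eJ, es, h3', h6, h7, f8] at h1 h2 h4 h6 h7 ⊢
  exact ⟨⟨_, h1, by omega⟩, h2, h4, trivial, trivial, trivial, trivial⟩

section Levels

variable {n k s : ℕ} {G : RegularLimitGame (Fin n) (Fin k) (Fin s)} {σ : Store}

lemma IsBuilt.of_agree {xs : List Var} {as : List Arr} {τ : Store} (h : IsBuilt G σ)
    (hA : Agree xs as σ τ) (hx : ∀ x ∈ [Var.n, .s, .J, .qI, .N, .PE], x ∉ xs)
    (ha : ∀ a ∈ [Arr.mul, .stq, .tgt, .own, .src, .dst, .wgt, .dsv], a ∉ as) : IsBuilt G τ := by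
  have e1 : τ.arr .own = σ.arr .own := hA.2 _ (ha _ (by decide))
  have e2 : τ.arr .src = σ.arr .src := hA.2 _ (ha _ (by decide))
  have e3 : τ.arr .dst = σ.arr .dst := hA.2 _ (ha _ (by decide))
  have e4 : τ.arr .wgt = σ.arr .wgt := hA.2 _ (ha _ (by decide))
  have e5 : τ.arr .dsv = σ.arr .dsv := hA.2 _ (ha _ (by decide))
  have e6 : τ.var .N = σ.var .N := hA.1 _ (hx _ (by decide))
  have e7 : τ.var .PE = σ.var .PE := hA.1 _ (hx _ (by decide))
  refine ⟨(hA.1 _ (hx _ (by decide))).trans h.n_eq, (hA.1 _ (hx _ (by decide))).trans h.s_eq,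
    (hA.1 _ (hx _ (by decide))).trans h.J_eq, ?_, (hA.1 _ (hx _ (by decide))).trans h.qI_eq,
    ?_, ?_, ?_⟩
  · rw [hA.2 _ (ha _ (by decide))]
    exact h.mul_eq
  · rw [hA.2 _ (ha _ (by decide))]
    exact h.stq_eq
  · rw [hA.2 _ (ha _ (by decide))]
    exact h.tgt_iff
  · obtain ⟨h1, h2, h3, h4⟩ := h.product
    simp only [Store.graph] at h1 h2 h3 h4
    constructor <;> simpa only [Store.graph, e1, e2, e3, e4, e5, e6, e7]

/-- The store after `i` levels. -/
def levelStore (I : ℕ → ℕ) (σ : Store) (i : ℕ) : Store :=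
  iter (fun i τ => levelProg.den I (τ.set .i i)) i σ

lemma levelStore_agree (I : ℕ → ℕ) (σ : Store) (i : ℕ) :
    Agree (.i :: levelProg.mods) levelProg.amods σ (levelStore I σ i) :=
  agree_iter (fun _ τ => (agree_set τ _ (by decide)).trans
    ((levelProg.agree_den I _).mono (by decide) (by decide))) _ _

/-- The moves chosen on one level serve as the initial moves of the next. -/
lemma levelStore_step {I : ℕ → ℕ} {W : ℕ} (hg : σ.graph.Valid W) (hm : σ.graph.IsMove (σ.arr .cho))
    {b : ℕ} {J : ℕ} (h1 : σ.var .o1 = b) (h2 : σ.var .o2 = b + J * σ.var .N) :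
    ∀ i < J, LevelStep (levelStore I σ i) (levelStore I σ (i + 1)) := by
  have hgraph : ∀ i, (levelStore I σ i).graph = σ.graph := fun i =>
    (levelStore_agree I σ i).graph_eq (by decide) (by decide)
  have key : ∀ i, i < J → (levelStore I σ i).graph.IsMove ((levelStore I σ i).arr .cho) →
      (levelStore I σ i).var .o1 = b + i * σ.var .N →
      (levelStore I σ i).var .o2 = b + J * σ.var .N + i * σ.var .N →
      LevelStep (levelStore I σ i) (levelStore I σ (i + 1)) := by
    intro i hi hm' h1' h2'
    have hle : (i + 1) * σ.var .N ≤ J * σ.var .N := Nat.mul_le_mul_right _ hi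
    rw [add_mul, one_mul] at hle
    have hN : (levelStore I σ i).var .N = σ.var .N := (levelStore_agree I σ i).1 .N (by decide)
    have h := levelProg_spec I ((levelStore I σ i).set .i i) (W := W)
      (by change (levelStore I σ i).graph.Valid W; rwa [hgraph]) hm'
      (by
        change (levelStore I σ i).var .o1 + (levelStore I σ i).var .N ≤ (levelStore I σ i).var .o2
        omega)
    exact ⟨h.isDist, h.isMove_nxt, h.isMove_cho, h.le_Dm, h.tx_spec, h.tx_eq, h.tgt_eq, h.bes_lev,
      h.out_eq, h.out_ne, h.o1_eq, h.o2_eq, h.is_eq⟩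
  have hinv : ∀ i ≤ J, (levelStore I σ i).graph.IsMove ((levelStore I σ i).arr .cho) ∧
      (levelStore I σ i).var .o1 = b + i * σ.var .N ∧
      (levelStore I σ i).var .o2 = b + J * σ.var .N + i * σ.var .N := by
    intro i hi
    induction i with
    | zero => exact ⟨hm, by simpa [levelStore, iter] using h1, by simpa [levelStore, iter] using h2⟩
    | succ i ih =>
      obtain ⟨ih1, ih2, ih3⟩ := ih (by omega)
      have h := key i (by omega) ih1 ih2 ih3
      have hN : (levelStore I σ i).var .N = σ.var .N := (levelStore_agree I σ i).1 .N (by decide)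
      refine ⟨?_, ?_, ?_⟩
      · rw [hgraph, ← hgraph i]
        exact h.isMove_cho
      · rw [h.o1_eq, ih2, hN]
        ring
      · rw [h.o2_eq, ih3, hN]
        ring
  intro i hi
  obtain ⟨h3, h4, h5⟩ := hinv i hi.le
  exact key i hi h3 h4 h5

/-- The offsets of the output advance level by level. -/
lemma levelStore_vars {I : ℕ → ℕ} {J : ℕ}
    (h : ∀ i < J, LevelStep (levelStore I σ i) (levelStore I σ (i + 1))) :
    ∀ i ≤ J, (levelStore I σ i).var .o1 = σ.var .o1 + i * σ.var .N ∧
      (levelStore I σ i).var .o2 = σ.var .o2 + i * σ.var .N ∧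
      (levelStore I σ i).var .is = σ.var .is + i * σ.var .s := by
  intro i hi
  induction i with
  | zero => simp [levelStore, iter]
  | succ i ih =>
    obtain ⟨ih1, ih2, ih3⟩ := ih (by omega)
    have h := h i (by omega)
    have hN : (levelStore I σ i).var .N = σ.var .N := (levelStore_agree I σ i).1 .N (by decide)
    have hs : (levelStore I σ i).var .s = σ.var .s := (levelStore_agree I σ i).1 .s (by decide)
    rw [h.o1_eq, h.o2_eq, h.is_eq, ih1, ih2, ih3, hN, hs]
    exact ⟨by ring, by ring, by ring⟩

/-- The output of each level survives the later levels, as the tables of the update function end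
where the tables of the next-move function begin. -/
lemma levelStore_out {I : ℕ → ℕ} {J : ℕ}
    (h : ∀ i < J, LevelStep (levelStore I σ i) (levelStore I σ (i + 1)))
    (ho : σ.var .o2 = σ.var .o1 + J * σ.var .N) (his : σ.var .is = 0) :
    ∀ i ≤ J, ∀ l < i, ∀ x < σ.var .N,
      (levelStore I σ i).arr .out (σ.var .o1 + l * σ.var .N + x) =
        l * σ.var .s + σ.arr .stq x ∧
      (levelStore I σ i).arr .out (σ.var .o2 + l * σ.var .N + x) =
        (levelStore I σ (l + 1)).arr .nxt x := by
  intro i hi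
  induction i with
  | zero => simp
  | succ i ih =>
    intro l hl x hx
    obtain ⟨h1, h2, h3⟩ := levelStore_vars h i (by omega)
    have h := h i (by omega)
    have hN : (levelStore I σ i).var .N = σ.var .N := (levelStore_agree I σ i).1 .N (by decide)
    have hst : (levelStore I σ i).arr .stq = σ.arr .stq :=
      (levelStore_agree I σ i).2 .stq (by decide)
    rcases Nat.lt_succ_iff_lt_or_eq.1 hl with hl | rfl
    · have hne := h.out_ne
      rw [h1, h2, hN, ho] at hne
      obtain ⟨ih1, ih2⟩ := ih (by omega) l hl x hx
      have e1 : (l + 1) * σ.var .N ≤ i * σ.var .N := Nat.mul_le_mul_right _ hl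
      have e2 : (i + 1) * σ.var .N ≤ J * σ.var .N := Nat.mul_le_mul_right _ hi
      rw [add_mul, one_mul] at e1 e2
      rw [← ih1, ← ih2, ho]
      exact ⟨hne _ fun y hy => by omega, hne _ fun y hy => by omega⟩
    · have h4 := h.out_eq x (by rwa [hN])
      rw [h1, h2, h3, hst, his, zero_add] at h4
      exact h4

end Levels

/-- Compute the strategy from the product, and write it. -/
def solveProg : Stmt := prepProg ;; .loop .i .J levelProg ;; finalProg

lemma finalProg_spec (I : ℕ → ℕ) (σ : Store) :
    (finalProg.den I σ).arr .out 0 = σ.var .m ∧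
    (∀ v < σ.var .n, (finalProg.den I σ).arr .out (1 + v) =
      σ.arr .lev v + σ.arr .stq (σ.arr .mul (σ.var .qI) + v)) ∧
    (∀ a, 1 + σ.var .n ≤ a → (finalProg.den I σ).arr .out a = σ.arr .out a) := by
  obtain ⟨τ, ⟨h1, h2, h3⟩, he⟩ := Stmt.loop_rule (I := I) (x := .v) (b := .n)
    (σ := σ.put .out 0 (σ.var .m))
    (P := .put .out (num 1 + var .v)
      (get .lev (var .v) + get .stq (get .mul (var .qI) + var .v)))
    (fun i τ => τ.arr .out 0 = σ.var .m ∧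
      (∀ v < i, τ.arr .out (1 + v) =
        σ.arr .lev v + σ.arr .stq (σ.arr .mul (σ.var .qI) + v)) ∧
      (∀ a, 1 + σ.var .n ≤ a → τ.arr .out a = σ.arr .out a))
    ⟨by simp, by simp, fun a ha => by simp [show a ≠ 0 by omega]⟩ (by
      intro i hi τ hA ⟨ih1, ih2, ih3⟩
      have e1 : τ.arr .lev = σ.arr .lev := hA.2 .lev (by decide)
      have e2 : τ.arr .stq = σ.arr .stq := hA.2 .stq (by decide)
      have e3 : τ.arr .mul = σ.arr .mul := hA.2 .mul (by decide)
      have e4 : τ.var .qI = σ.var .qI := hA.1 .qI (by decide)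
      rw [Store.put_var] at hi
      simp only [Stmt.den, Ex.eval, Store.set_arr, Store.set_var_self,
        Store.put_arr_self, e1, e2, e3, e4, ne_eq, reduceCtorEq, not_false_eq_true,
        Store.set_var_of_ne]
      refine ⟨by rw [Function.update_of_ne (by omega), ih1], fun v hv => ?_, fun a ha => by
        rw [Function.update_of_ne (by omega), ih3 a ha]⟩
      rcases Nat.lt_succ_iff_lt_or_eq.1 hv with hv | rfl
      · rw [Function.update_of_ne (by omega), ih2 v hv]
      · rw [Function.update_self])
  have he' : finalProg.den I σ = τ.set .v (σ.var .n) := he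
  rw [he']
  exact ⟨h1, h2, h3⟩

/-- The program writes the tables of a strategy that follows a chain of levels. The memory state of
level `i` and state `q` is `i * s + q`. -/
theorem solveProg_spec {n k s : ℕ} {G : RegularLimitGame (Fin n) (Fin k) (Fin s)} (hn : 0 < n)
    (I : ℕ → ℕ) {σ : Store} (h : IsBuilt G σ) :
    ∃ (ℓ : Fin n → ℕ) (ch : ℕ → Fin n × Fin s → Fin n),
      (∃ T d D t, G.IsLevelChain (σ.var .J - 1) T d D t ch ℓ) ∧
      (∀ i < σ.var .J, ∀ x, G.arena.edge x.1 (ch i x)) ∧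
      (solveProg.den I σ).arr .out 0 = σ.var .J * s ∧
      (∀ v : Fin n, (solveProg.den I σ).arr .out (1 + v) = ℓ v * s + (G.startPos v).2) ∧
      (∀ i < σ.var .J, ∀ x : Fin n × Fin s,
        (solveProg.den I σ).arr .out (1 + n + i * (s * n) + posIdx x) =
          i * s + G.dfa.step x.2 (G.arena.color x.1) ∧
        (solveProg.den I σ).arr .out (1 + n + σ.var .J * (s * n) + i * (s * n) + posIdx x) =
          ch i x) ∧
      (solveProg.den I σ).var .o2 = 1 + n + σ.var .J * (s * n) + σ.var .J * (s * n) := by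
  obtain ⟨⟨W, hW, hINF⟩, hcho, hbes, his, hm, ho1, ho2⟩ := prepProg_spec I σ
  have hA := prepProg.agree_den I σ
  have hden : solveProg.den I σ = finalProg.den I
      ((levelStore I (prepProg.den I σ) ((prepProg.den I σ).var .J)).set .i
        ((prepProg.den I σ).var .J)) := rfl
  rw [hden]
  have hb : IsBuilt G (prepProg.den I σ) := h.of_agree hA (by decide) (by decide)
  clear hden
  generalize prepProg.den I σ = σ₁ at *
  have eJ : σ₁.var .J = σ.var .J := hA.1 .J (by decide)
  have en : σ.var .n = n := h.n_eq
  have es : σ.var .s = s := h.s_eq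
  have eN : σ.var .N = s * n := h.product.N_eq
  have eN1 : σ₁.var .N = s * n := hb.product.N_eq
  have esrc : σ₁.arr .src = σ.arr .src := hA.2 .src (by decide)
  have edsv : σ₁.arr .dsv = σ.arr .dsv := hA.2 .dsv (by decide)
  have ewgt : σ₁.arr .wgt = σ.arr .wgt := hA.2 .wgt (by decide)
  have ePE : σ₁.var .PE = σ.var .PE := hA.1 .PE (by decide)
  rw [en] at hbes ho1 ho2
  rw [es] at hm
  rw [eN] at ho2 hINF
  rw [eJ]
  have hvalid : σ₁.graph.Valid W := by
    refine ⟨fun e he => hb.product.dst_lt he, fun x hx => hb.product.exists_src hx,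
      fun e he => ?_, ?_⟩
    · change σ₁.arr .wgt e ≤ W
      rw [ewgt]
      exact hW e (ePE ▸ he)
    · change (σ₁.var .N + 1) * W < σ₁.var .INF
      rwa [eN1]
  have hmove : σ₁.graph.IsMove (σ₁.arr .cho) := by
    intro x hx
    obtain ⟨e, he, rfl⟩ := hvalid.exists_src x hx
    obtain ⟨e', he', h1, h2⟩ := hcho e (ePE ▸ he)
    refine ⟨e', he'.trans_eq ePE.symm, ?_, ?_⟩
    · change σ₁.arr .src e' = σ₁.arr .src e
      rw [esrc, h1]
    · change σ₁.arr .cho (σ₁.arr .src e) = σ₁.arr .dsv e'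
      rw [esrc, edsv, h2]
  have hstep := levelStore_step (I := I) hvalid hmove (J := σ.var .J) ho1 (by rw [ho2, eN1])
  have hgraph : ∀ i, (levelStore I σ₁ i).graph = σ₁.graph := fun i =>
    (levelStore_agree I σ₁ i).graph_eq (by decide) (by decide)
  have hlA := levelStore_agree I σ₁
  have hrun : LevelRun G (σ.var .J) (levelStore I σ₁) := by
    refine ⟨hstep, fun i _ => hgraph i, fun i _ => ?_, fun i _ => ?_, fun i _ v => ?_, hb.product,
      hb.tgt_iff, ?_, his, hbes⟩
    · rw [(hlA i).1 .n (by decide), hb.n_eq]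
    · rw [(hlA i).1 .s (by decide), hb.s_eq]
    · rw [← hb.startIdx_eq v]
      simp only [Store.startIdx, (hlA i).1 .qI (by decide), (hlA i).2 .mul (by decide),
        (hlA i).2 .stq (by decide)]
    · rw [← eJ]
      exact hb.card_targets_lt
  obtain ⟨ℓ, hℓ, hchain⟩ := hrun.exists_isLevelChain hn
  have hvars := levelStore_vars hstep (σ.var .J) le_rfl
  have hout := levelStore_out hstep (by rw [ho2, ho1, eN1]) his (σ.var .J) le_rfl
  obtain ⟨f1, f2, f3⟩ := finalProg_spec I ((levelStore I σ₁ (σ.var .J)).set .i (σ.var .J))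
  have fA := finalProg.agree_den I ((levelStore I σ₁ (σ.var .J)).set .i (σ.var .J))
  simp only [Store.set_arr, ne_eq, reduceCtorEq, not_false_eq_true, Store.set_var_of_ne] at f1 f2 f3
  have hln : (levelStore I σ₁ (σ.var .J)).var .n = n := by
    rw [(hlA _).1 .n (by decide), hb.n_eq]
  rw [hln] at f2 f3
  have hmv : ∀ i < σ.var .J, ∀ x : Fin n × Fin s,
      G.arena.edge x.1 (moveOf ((levelStore I σ₁ (i + 1)).arr .nxt) x) ∧
      (levelStore I σ₁ (i + 1)).arr .nxt (posIdx x) =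
        moveOf ((levelStore I σ₁ (i + 1)).arr .nxt) x := by
    intro i hi x
    obtain ⟨e, he, hsrc, hnx⟩ := (hstep i hi).isMove_nxt (posIdx x) (by
      rw [hgraph, hb.product.N_eq]
      exact posIdx_lt x)
    rw [hgraph] at he hsrc hnx
    obtain ⟨v, hv, -, -, hd⟩ := hb.product.of_src he hsrc
    rw [hd] at hnx
    have : moveOf ((levelStore I σ₁ (i + 1)).arr .nxt) x = v := by
      rw [moveOf, dif_pos (by rw [hnx]; exact v.2)]
      exact Fin.ext hnx
    rw [this]
    exact ⟨hv, hnx⟩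
  refine ⟨ℓ, _, hchain, fun i hi x => (hmv i hi x).1, ?_, fun v => ?_, fun i hi x => ?_, ?_⟩
  · rw [f1, (hlA _).1 .m (by decide), hm]
  · rw [f2 v v.2, hℓ, (hlA _).2 .stq (by decide), (hlA _).2 .mul (by decide),
      (hlA _).1 .qI (by decide), hb.stq_start]
  · obtain ⟨h1, h2⟩ := hout i hi (posIdx x) (by rw [eN1]; exact posIdx_lt x)
    rw [ho1, eN1, hb.s_eq, hb.stq_eq] at h1
    rw [ho2, eN1, (hmv i hi x).2] at h2
    rw [f3 _ (by omega), f3 _ (by omega)]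
    exact ⟨h1, h2⟩
  · rw [fA.1 .o2 (by decide), Store.set_var_of_ne _ _ (by decide), hvars.2.1, ho2, eN1]

/-! ### The encoding of the input -/

lemma length_flatMap_of_const {α : Type*} {f : α → List ℕ} {c : ℕ} (hf : ∀ x, (f x).length = c)
    (l : List α) : (l.flatMap f).length = l.length * c := by
  induction l with
  | nil => simp
  | cons x l ih => rw [List.flatMap_cons, List.length_append, ih, hf, List.length_cons]; ring

lemma getD_flatMap_of_const {α : Type*} {f : α → List ℕ} {c : ℕ} (hf : ∀ x, (f x).length = c)
    (l : List α) : ∀ (j : ℕ) (hj : j < l.length), ∀ i < c,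
    (l.flatMap f).getD (j * c + i) 0 = (f l[j]).getD i 0 := by
  induction l with
  | nil => simp
  | cons x l ih =>
    intro j hj i hi
    rw [List.flatMap_cons]
    rcases j with - | j
    · rw [List.getD_append _ _ _ _ (by rw [hf]; omega)]
      simp
    · rw [List.getD_append_right _ _ _ _ (by rw [hf, add_mul]; omega), hf,
        show (j + 1) * c + i - c = j * c + i by rw [add_mul]; omega]
      exact ih j (by simpa using hj) i hi

lemma getD_ofFn {n : ℕ} (f : Fin n → ℕ) (i : Fin n) : (List.ofFn f).getD i 0 = f i := by
  rw [List.getD_eq_getElem _ _ (by simp)]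
  simp

lemma isInput_encode {n k s : ℕ} (G : RegularLimitGame (Fin n) (Fin k) (Fin s))
    (L : List (Fin n × Fin n)) : IsInput G L fun a => (encode G L).getD a 0 := by
  classical
  set l₁ : List ℕ := List.ofFn (fun v : Fin n => (G.arena.owner v : ℕ)) with h₁
  set l₂ : List ℕ := List.ofFn (fun v : Fin n => (G.arena.color v : ℕ)) with h₂
  set l₃ : List ℕ := List.ofFn (fun q : Fin s => if q ∈ G.dfa.accept then 1 else 0) with h₃
  set l₄ : List ℕ := L.flatMap (fun p => [(p.1 : ℕ), (p.2 : ℕ), G.arena.weight p.1 p.2]) with h₄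
  set l₅ : List ℕ := (List.finRange s).flatMap
    (fun q => List.ofFn fun c : Fin k => (G.dfa.step q c : ℕ)) with h₅
  have e₁ : l₁.length = n := by simp [l₁]
  have e₂ : l₂.length = n := by simp [l₂]
  have e₃ : l₃.length = s := by simp [l₃]
  have e₄ : l₄.length = L.length * 3 := length_flatMap_of_const (by simp) L
  have e₅ : l₅.length = s * k := by
    rw [h₅, length_flatMap_of_const (c := k) (by simp), List.length_finRange]
  have key : encode G L = [n, k, s, L.length, (G.dfa.start : ℕ)] ++
      (l₁ ++ (l₂ ++ (l₃ ++ (l₄ ++ l₅)))) := by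
    simp only [encode, List.append_assoc, l₁, l₂, l₃, l₄, l₅]
  have skip : ∀ (l l' : List ℕ) (a : ℕ), (l ++ l').getD (l.length + a) 0 = l'.getD a 0 := by
    intro l l' a
    rw [List.getD_append_right _ _ _ _ (by omega), Nat.add_sub_cancel_left]
  have skip₀ : ∀ a, (encode G L).getD (5 + a) 0 = (l₁ ++ (l₂ ++ (l₃ ++ (l₄ ++ l₅)))).getD a 0 :=
    fun a => by rw [key]; exact skip [n, k, s, L.length, (G.dfa.start : ℕ)] _ a
  have skip₁ : ∀ a, (encode G L).getD (5 + n + a) 0 = (l₂ ++ (l₃ ++ (l₄ ++ l₅))).getD a 0 :=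
    fun a => by rw [add_assoc, skip₀, ← e₁, skip]
  have skip₂ : ∀ a, (encode G L).getD (5 + n + n + a) 0 = (l₃ ++ (l₄ ++ l₅)).getD a 0 :=
    fun a => by
      rw [add_assoc, skip₁]
      conv_lhs => rw [← e₂]
      rw [skip]
  have skip₃ : ∀ a, (encode G L).getD (5 + n + n + s + a) 0 = (l₄ ++ l₅).getD a 0 :=
    fun a => by
      rw [add_assoc, skip₂]
      conv_lhs => rw [← e₃]
      rw [skip]
  have skip₄ : ∀ a, (encode G L).getD (5 + n + n + s + 3 * L.length + a) 0 = l₅.getD a 0 :=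
    fun a => by rw [add_assoc, skip₃, mul_comm, ← e₄, skip]
  have row : ∀ j (hj : j < L.length), ∀ i < 3, (encode G L).getD (5 + n + n + s + (3 * j + i)) 0 =
      [(L[j].1 : ℕ), (L[j].2 : ℕ), G.arena.weight L[j].1 L[j].2].getD i 0 := by
    intro j hj i hi
    rw [skip₃, List.getD_append _ _ _ _ (by rw [e₄]; omega), mul_comm]
    exact getD_flatMap_of_const (by simp) L j hj i hi
  refine ⟨by simp [key], by simp [key], by simp [key], by simp [key], by simp [key], fun v => ?_,
    fun v => ?_, fun q => ?_, fun j hj => ⟨?_, ?_, ?_⟩, fun q c => ?_, fun a ha => ?_⟩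
  · rw [skip₀, List.getD_append _ _ _ _ (by rw [e₁]; exact v.2)]
    exact getD_ofFn _ v
  · rw [skip₁, List.getD_append _ _ _ _ (by rw [e₂]; exact v.2)]
    exact getD_ofFn _ v
  · rw [skip₂, List.getD_append _ _ _ _ (by rw [e₃]; exact q.2), h₃, getD_ofFn]
    exact ⟨fun hq => if_pos hq, fun hq => if_neg hq⟩
  · exact row j hj 0 (by omega)
  · exact row j hj 1 (by omega)
  · exact row j hj 2 (by omega)
  · rw [add_assoc _ _ (c : ℕ), skip₄, h₅,
      getD_flatMap_of_const (c := k) (by simp) _ q (by simp) c c.2, getD_ofFn]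
    simp
  · obtain ⟨b, rfl⟩ := Nat.exists_eq_add_of_le ha
    rw [add_assoc _ _ b, skip₄, List.getD_eq_default _ _ (by omega)]

/-! ### Entering and leaving the language -/

/-- Read the sizes, and add up the lengths of all parts of the input except for the transition
table in register `3`. -/
def sizesProg : Prog :=
  .seq (.const 3 0) <| .seq (.load 5 3) <| .seq (.const 3 1) <| .seq (.load 7 3) <|
  .seq (.const 3 2) <| .seq (.load 9 3) <| .seq (.const 3 3) <| .seq (.load 11 3) <|
  .seq (.const 3 5) <| .seq (.add 3 3 5) <| .seq (.add 3 3 5) <| .seq (.add 3 3 9) <|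
  .seq (.add 3 3 11) <| .seq (.add 3 3 11) <| .seq (.add 3 3 11) <| .seq (.const 13 0) <|
  .const 15 1

/-- Store the address of the first cell behind the input in register `1`. -/
def enterProg : Prog :=
  .seq sizesProg <| .seq (.whileLt 13 9 (.seq (.add 3 3 7) (.add 13 13 15))) <| .copy 1 3

lemma exec_mul_loop : ∀ (l : ℕ) (S : MState), S.reg 13 + l = S.reg 9 → S.reg 15 = 1 →
    ∃ S', Exec (.whileLt 13 9 (.seq (.add 3 3 7) (.add 13 13 15))) S (l * 3 + 1) S' ∧
      S'.mem = S.mem ∧ S'.reg 3 = S.reg 3 + l * S.reg 7 ∧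
      ∀ r, r ≠ 3 → r ≠ 13 → S'.reg r = S.reg r := by
  intro l
  induction l with
  | zero =>
    intro S h _
    exact ⟨S, by simpa using Exec.whileFalse (by omega), rfl, by simp, fun _ _ _ => rfl⟩
  | succ l ih =>
    intro S h h1
    obtain ⟨S', h2, h3, h4, h5⟩ := ih
      ((S.setReg 3 (S.reg 3 + S.reg 7)).setReg 13 (S.reg 13 + S.reg 15))
      (by simp [MState.setReg_reg]; omega) (by simpa [MState.setReg_reg] using h1)
    refine ⟨S', ?_, h3, ?_, fun r hr hr' => ?_⟩
    · have : (l + 1) * 3 + 1 = 1 + 1 + (l * 3 + 1) + 1 := by ring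
      rw [this]
      exact .whileTrue (by omega) (.seq (.add ..) (.add ..)) h2
    · rw [h4]
      simp [MState.setReg_reg]
      ring
    · rw [h5 r hr hr']
      simp [MState.setReg_reg, hr, hr']

lemma exec_sizesProg {n k s : ℕ} {G : RegularLimitGame (Fin n) (Fin k) (Fin s)}
    {L : List (Fin n × Fin n)} {I : ℕ → ℕ} (hI : IsInput G L I) :
    ∃ S, Exec sizesProg ⟨fun _ => 0, I⟩ 17 S ∧ S.mem = I ∧
      S.reg 3 = 5 + n + n + s + 3 * L.length ∧ S.reg 7 = k ∧ S.reg 9 = s ∧ S.reg 13 = 0 ∧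
      S.reg 15 = 1 ∧ ∀ x : Var, S.reg x.reg = 0 := by
  refine ⟨_, .seq (.const ..) <| .seq (.load ..) <| .seq (.const ..) <| .seq (.load ..) <|
    .seq (.const ..) <| .seq (.load ..) <| .seq (.const ..) <| .seq (.load ..) <|
    .seq (.const ..) <| .seq (.add ..) <| .seq (.add ..) <| .seq (.add ..) <|
    .seq (.add ..) <| .seq (.add ..) <| .seq (.add ..) <| .seq (.const ..) <|
    .const .., rfl, ?_, ?_, ?_, ?_, ?_, fun x => ?_⟩
  · simp [MState.setReg_reg, hI.zero, hI.two, hI.three]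
    ring
  · simp [MState.setReg_reg, hI.one]
  · simp [MState.setReg_reg, hI.two]
  · simp [MState.setReg_reg]
  · simp [MState.setReg_reg]
  · have hx : x.reg ≠ 3 ∧ x.reg ≠ 13 ∧ x.reg ≠ 5 ∧ x.reg ≠ 7 ∧ x.reg ≠ 9 ∧ x.reg ≠ 11 ∧
        x.reg ≠ 15 := by
      unfold Var.reg
      omega
    simp [MState.setReg_reg, hx]

lemma exec_enterProg {n k s : ℕ} {G : RegularLimitGame (Fin n) (Fin k) (Fin s)}
    {L : List (Fin n × Fin n)} {I : ℕ → ℕ} (hI : IsInput G L I) :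
    ∃ S', Exec enterProg ⟨fun _ => 0, I⟩ (17 + ((s * 3 + 1) + 1)) S' ∧
      Rep I (5 + n + n + s + 3 * L.length + s * k) ⟨fun _ => 0, fun _ _ => 0⟩ S' := by
  obtain ⟨S₀, h0, hm, h3, h7, h9, h13, h15, hv⟩ := exec_sizesProg hI
  obtain ⟨S, h1, h2, h4, h5⟩ := exec_mul_loop s S₀ (by omega) h15
  refine ⟨_, .seq h0 (.seq h1 (.copy ..)), fun x => ?_, ?_, fun a _ => ?_, fun a i => ?_⟩
  · have hx : x.reg ≠ 1 ∧ x.reg ≠ 3 ∧ x.reg ≠ 13 := by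
      unfold Var.reg
      omega
    rw [MState.setReg_reg, if_neg hx.1, h5 _ hx.2.1 hx.2.2, hv]
  · rw [MState.setReg_reg, if_pos rfl, h4, h3, h7]
  · rw [MState.setReg_mem, h2, hm]
  · rw [MState.setReg_mem, h2, hm]
    exact hI.eq_zero _ (by omega)

/-- Let register `0` point behind the cells in use of the array `out`, whose size is the value of
`o2`, and register `5` to the first cell of this array. -/
def locateProg : Prog :=
  .seq (.copy 3 Var.o2.reg) <| .seq (.add 3 3 3) <| .seq (.add 3 3 3) <| .seq (.add 3 3 3) <|
  .seq (.add 3 3 3) <| .seq (.add 0 3 1) <| .seq (.const 5 Arr.out.ctorIdx) <|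
  .seq (.add 5 5 1) <| .seq (.copy 7 0) <| .seq (.const 11 1) <| .const 13 16

/-- Copy the array `out` to consecutive memory cells, from the address in register `0` on. -/
def leaveProg : Prog :=
  .seq locateProg <|
  .whileLt 5 0 (.seq (.load 9 5) <| .seq (.store 7 9) <| .seq (.add 7 7 11) <| .add 5 5 13)

/-- The source pointer stays below the copied cells, so no cell is overwritten before it is read. -/
lemma exec_copy_loop {b z : ℕ} {m : ℕ → ℕ} : ∀ (l i : ℕ) (S : MState), i + l = z →
    S.reg 0 = b + 16 * z → S.reg 5 = b + 16 * i + 15 → S.reg 7 = b + 16 * z + i →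
    S.reg 11 = 1 → S.reg 13 = 16 → (∀ a < b + 16 * z, S.mem a = m a) →
    (∀ j < i, S.mem (b + 16 * z + j) = m (b + 16 * j + 15)) →
    ∃ S', Exec (.whileLt 5 0
        (.seq (.load 9 5) <| .seq (.store 7 9) <| .seq (.add 7 7 11) <| .add 5 5 13)) S
        (l * 5 + 1) S' ∧ S'.reg 0 = b + 16 * z ∧
      ∀ j < z, S'.mem (b + 16 * z + j) = m (b + 16 * j + 15) := by
  intro l
  induction l with
  | zero =>
    intro i S hi h0 h5 _ _ _ _ hm
    refine ⟨S, by simpa using Exec.whileFalse (by omega), h0, ?_⟩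
    obtain rfl : i = z := by omega
    exact hm
  | succ l ih =>
    intro i S hi h0 h5 h7 h11 h13 hlt hm
    have e : S.mem (S.reg 5) = m (b + 16 * i + 15) := by rw [h5, hlt _ (by omega)]
    obtain ⟨S', h1, h2, h3⟩ := ih (i + 1)
      ((((S.setReg 9 (S.mem (S.reg 5))).setMem (S.reg 7) (S.mem (S.reg 5))).setReg 7
        (S.reg 7 + S.reg 11)).setReg 5 (S.reg 5 + S.reg 13)) (by omega)
      (by simpa [MState.setReg_reg] using h0)
      (by simp [MState.setReg_reg]; omega) (by simp [MState.setReg_reg]; omega)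
      (by simpa [MState.setReg_reg] using h11) (by simpa [MState.setReg_reg] using h13)
      (fun a ha => by
        simp only [MState.setReg_mem, MState.setMem_mem]
        rw [if_neg (by omega), hlt a ha])
      (fun j hj => by
        simp only [MState.setReg_mem, MState.setMem_mem]
        split_ifs with h
        · obtain rfl : j = i := by omega
          exact e
        · exact hm j (by omega))
    refine ⟨S', ?_, h2, h3⟩
    have : (l + 1) * 5 + 1 = (1 + (1 + (1 + 1))) + (l * 5 + 1) + 1 := by ring
    rw [this]
    refine .whileTrue (by omega) (.seq (.load ..) ?_) h1
    refine .seq (S' := (S.setReg 9 (S.mem (S.reg 5))).setMem (S.reg 7) (S.mem (S.reg 5))) ?_ ?_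
    · convert Exec.store 7 9 _ using 2 <;> simp [MState.setReg_reg]
    · exact .seq (.add ..) (.add ..)

lemma exec_locateProg {I : ℕ → ℕ} {base : ℕ} {σ : Store} {S : MState} (h : Rep I base σ S) :
    ∃ S', Exec locateProg S 11 S' ∧ S'.mem = S.mem ∧ S'.reg 0 = base + 16 * σ.var .o2 ∧
      S'.reg 5 = base + 15 ∧ S'.reg 7 = base + 16 * σ.var .o2 ∧ S'.reg 11 = 1 ∧
      S'.reg 13 = 16 := by
  refine ⟨_, .seq (.copy ..) <| .seq (.add ..) <| .seq (.add ..) <| .seq (.add ..) <|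
    .seq (.add ..) <| .seq (.add ..) <| .seq (.const ..) <| .seq (.add ..) <| .seq (.copy ..) <|
    .seq (.const ..) <| .const .., rfl, ?_, ?_, ?_, ?_, ?_⟩
  · simp [MState.setReg_reg, h.base_eq, h.var]
    ring
  · simp [MState.setReg_reg, h.base_eq, Arr.ctorIdx, add_comm]
  · simp [MState.setReg_reg, h.base_eq, h.var]
    ring
  · simp [MState.setReg_reg]
  · simp [MState.setReg_reg]

lemma exec_leaveProg {I : ℕ → ℕ} {base : ℕ} {σ : Store} {S : MState} (h : Rep I base σ S) :
    ∃ S', Exec leaveProg S (11 + (σ.var .o2 * 5 + 1)) S' ∧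
      ∀ j < σ.var .o2, S'.mem (S'.reg 0 + j) = σ.arr .out j := by
  obtain ⟨S₀, h0, hm, h1, h5, h7, h11, h13⟩ := exec_locateProg h
  obtain ⟨S', h2, h3, h4⟩ := exec_copy_loop (b := base) (z := σ.var .o2) (m := S₀.mem) (σ.var .o2) 0
    S₀ (by simp) h1 (by simpa using h5) (by simpa using h7) h11 h13 (by simp) (by simp)
  refine ⟨S', .seq h0 h2, fun j hj => ?_⟩
  rw [h3, h4 j hj, ← h.arr .out j, hm]
  rfl

/-! ### The running time -/

/-- Each of the `J` levels takes `N` phases, and each phase looks at all edges. -/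
lemma cost_solveProg_le (p : Var → ℕ) (hJ : 1 ≤ p .J) (hn : 1 ≤ p .n) (hN : p .n ≤ p .N)
    (hPE : p .N ≤ p .PE) : solveProg.cost p ≤ 1000 * (p .J * p .N * p .PE) := by
  simp only [solveProg, prepProg, levelProg, distProg, relaxProg, relaxEdge, selectProg, selectStep,
    settleProg, maxProg, bestProg, emitProg, finalProg, Stmt.cost, Ex.cost]
  generalize p .J = J at *
  generalize p .n = n at *
  generalize p .N = N at *
  generalize p .PE = PE at *
  have h1 : 1 * 1 ≤ J * N := Nat.mul_le_mul hJ (by omega)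
  have h2 : J * N * N ≤ J * N * PE := Nat.mul_le_mul_left _ hPE
  have h3 : J * N * 1 ≤ J * N * PE := Nat.mul_le_mul_left _ (by omega)
  have h4 : 1 * PE ≤ J * N * PE := Nat.mul_le_mul_right _ (by omega)
  have h5 : J * n ≤ J * N := Nat.mul_le_mul_left _ hN
  have h6 : J * 1 ≤ J * n := Nat.mul_le_mul_left _ hn
  ring_nf at h1 h2 h3 h4 h5 h6 ⊢
  omega

lemma cost_setupProg_le (p : Var → ℕ) (hn : 1 ≤ p .n) (hs : 1 ≤ p .s) (hne : p .n ≤ p .ne) :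
    setupProg.cost p ≤ 1000 * (p .s * p .ne) := by
  simp only [setupProg, mulProg, buildProg, rowStep, posStep, edgeStep, Stmt.cost, Ex.cost]
  generalize p .n = n at *
  generalize p .s = s at *
  generalize p .ne = ne at *
  have h1 : s * n ≤ s * ne := Nat.mul_le_mul_left _ hne
  have h2 : s * 1 ≤ s * n := Nat.mul_le_mul_left _ hn
  ring_nf at h1 h2 ⊢
  omega

lemma le_length_of_isEdgeList {n : ℕ} {C : Type*} {A : Arena (Fin n) C}
    {L : List (Fin n × Fin n)} (hL : IsEdgeList A L) : n ≤ L.length := by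
  have hsub : (Finset.univ : Finset (Fin n)) ⊆ (L.map Prod.fst).toFinset := by
    intro v _
    obtain ⟨u, hu⟩ := A.exists_edge v
    simp only [List.mem_toFinset, List.mem_map]
    exact ⟨(v, u), (hL.2 _ _).2 hu, rfl⟩
  simpa using (Finset.card_le_card hsub).trans (List.toFinset_card_le _)

/-! ### The strategy in the output tables -/

lemma MemoryStructure.updStar_append {V M : Type*} (𝓜 : MemoryStructure V M) (w : List V)
    (u v : V) : 𝓜.updStar (w ++ [u]) v = 𝓜.upd (𝓜.updStar w u) v := by
  cases w <;> simp [updStar]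

section Strategy

variable {n k s J : ℕ} (G : RegularLimitGame (Fin n) (Fin k) (Fin s))

/-- The memory structure that stores the level of the initial vertex and the state of the
automaton. -/
def levelMemory (ℓ : Fin n → Fin J) : MemoryStructure (Fin n) (Fin (J * s)) where
  init v := finProdFinEquiv (ℓ v, (G.startPos v).2)
  upd x v := finProdFinEquiv ((finProdFinEquiv.symm x).1,
    G.dfa.step (finProdFinEquiv.symm x).2 (G.arena.color v))

/-- The next-move function that plays, on each level `i`, the positional strategy `ch i`. -/
def levelMove (ch : Fin J → Fin n × Fin s → Fin n) (hch : ∀ i x, G.arena.edge x.1 (ch i x)) :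
    NextMove G.arena 0 (Fin (J * s)) where
  nxt v x := ch (finProdFinEquiv.symm x).1 (v, (finProdFinEquiv.symm x).2)
  edge_nxt v x := hch (finProdFinEquiv.symm x).1 (v, (finProdFinEquiv.symm x).2)

/-- The memory keeps the level of the initial vertex and follows the automaton. -/
lemma updStar_levelMemory (ℓ : Fin n → Fin J) (ρ : ℕ → Fin n) (j : ℕ) :
    (levelMemory G ℓ).updStar (pre ρ j) (ρ j) = finProdFinEquiv (ℓ (ρ 0), (G.pos ρ j).2) := by
  induction j with
  | zero => rfl
  | succ j ih =>
    rw [pre_succ, MemoryStructure.updStar_append, ih, RegularLimitGame.pos_succ]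
    simp only [levelMemory, RegularLimitGame.succPos, Equiv.symm_apply_apply]

end Strategy

/-- The program that computes an optimal strategy. -/
def strategyProg : Prog :=
  .seq enterProg <| .seq readProg.comp <| .seq setupProg.comp <| .seq solveProg.comp leaveProg

/-- The run of the machine program, reduced to the effect of `solveProg` on a store that holds the
product. -/
lemma exec_strategyProg {n k s : ℕ} (hn : 0 < n) (G : RegularLimitGame (Fin n) (Fin k) (Fin s))
    {L : List (Fin n × Fin n)} (hL : IsEdgeList G.arena L) :
    ∃ (t : ℕ) (S : MState) (σ : Store), Exec strategyProg (inputState (encode G L)) t S ∧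
      IsBuilt G σ ∧ σ.var .PE = s * L.length ∧ t ≤ 2200 * (σ.var .J * (s * n) * (s * L.length)) ∧
      ∃ I, ∀ j < (solveProg.den I σ).var .o2,
        S.mem (S.reg 0 + j) = (solveProg.den I σ).arr .out j := by
  have hI := isInput_encode G L
  set I : ℕ → ℕ := fun a => (encode G L).getD a 0 with hIdef
  have hs : 0 < s := lt_of_le_of_lt (Nat.zero_le _) G.dfa.start.2
  have hnL := le_length_of_isEdgeList hL
  obtain ⟨S₁, h1, hR1⟩ := exec_enterProg hI
  have hz : ∀ a, 5 + n + n + s + 3 * L.length + s * k ≤ a → I a = 0 := hI.eq_zero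
  obtain ⟨t₂, S₂, h2, ht2, hR2⟩ := Stmt.exec_comp hz (fun _ => 0) readProg (by decide)
    (by decide) _ S₁ (by simp [readProg, Stmt.bounds]) hR1
  obtain ⟨hb, hPE, hN⟩ := setupProg_spec hL hI ⟨fun _ => 0, fun _ _ => 0⟩
  obtain ⟨an, -, as, ane, -⟩ := readProg_spec hI ⟨fun _ => 0, fun _ _ => 0⟩
  generalize readProg.den I ⟨fun _ => 0, fun _ _ => 0⟩ = σ₁ at *
  obtain ⟨t₃, S₃, h3, ht3, hR3⟩ := Stmt.exec_comp hz σ₁.var setupProg (by decide)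
    (by decide) σ₁ S₂ (fun _ _ => rfl) hR2
  generalize setupProg.den I σ₁ = σ₂ at *
  obtain ⟨t₄, S₄, h4, ht4, hR4⟩ := Stmt.exec_comp hz σ₂.var solveProg (by decide)
    (by decide) σ₂ S₃ (fun _ _ => rfl) hR3
  obtain ⟨S₅, h5, hout⟩ := exec_leaveProg hR4
  have ho2 : (solveProg.den I σ₂).var .o2 =
      1 + n + σ₂.var .J * (s * n) + σ₂.var .J * (s * n) := by
    obtain ⟨_, _, _, _, _, _, _, h⟩ := solveProg_spec hn I hb
    exact h
  refine ⟨_, S₅, σ₂, .seq h1 (.seq h2 (.seq h3 (.seq h4 h5))), hb, hPE, ?_, I, hout⟩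
  have hJ : 1 ≤ σ₂.var .J := by rw [hb.J_eq]; omega
  have hnN : n ≤ s * n := Nat.le_mul_of_pos_left n hs
  have hNPE : s * n ≤ s * L.length := Nat.mul_le_mul_left _ hnL
  have hc3 := cost_setupProg_le σ₁.var (by rwa [an]) (by rwa [as]) (by rwa [an, ane])
  have hc4 := cost_solveProg_le σ₂.var hJ (by rwa [hb.n_eq]) (by rwa [hb.n_eq, hN])
    (by rwa [hN, hPE])
  rw [as, ane] at hc3
  rw [hN, hPE] at hc4
  have hc2 : readProg.cost (fun _ => 0) ≤ 50 := by
    simp only [readProg, Stmt.cost, Ex.cost]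
    norm_num
  have hsN : s ≤ s * n := Nat.le_mul_of_pos_right s hn
  rw [ho2]
  generalize σ₂.var .J = J at *
  generalize s * n = N at *
  generalize s * L.length = PE at *
  have e1 : 1 * 1 ≤ J * N := Nat.mul_le_mul hJ (by omega)
  have e2 : J * N * 1 ≤ J * N * PE := Nat.mul_le_mul_left _ (by omega)
  have e3 : 1 * PE ≤ J * N * PE := Nat.mul_le_mul_right _ (by omega)
  omega

/-- The running time is dominated by `J * N` phases, each of which relaxes all `s * |E|` edges of
the product, where the number `J` of levels is at most `2 * n * max 1 |F|` and the number `N` of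
positions is `n * s`. -/
theorem strategyProg_computesOptimal {n k s : ℕ} (hn : 0 < n)
    (G : RegularLimitGame (Fin n) (Fin k) (Fin s)) {L : List (Fin n × Fin n)}
    (hL : IsEdgeList G.arena L) :
    ComputesOptimal strategyProg G L
      (4400 * (n ^ 3 * L.length * s ^ 2 * max 1 G.dfa.accept.ncard ^ 2)) := by
  obtain ⟨t, S, σ, hex, hb, hPE, ht, I, hmem⟩ := exec_strategyProg hn G hL
  obtain ⟨ℓ, ch, ⟨T, d, D, tt, hchain⟩, hedge, hout, hinit, htab, ho2⟩ := solveProg_spec hn I hb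
  have hJ : 0 < σ.var .J := by rw [hb.J_eq]; omega
  have hs : 0 < s := lt_of_le_of_lt (Nat.zero_le _) G.dfa.start.2
  rw [ho2] at hmem
  refine ⟨t, S, hex, ht.trans ?_, ?_⟩
  · rw [hb.J_eq]
    have h1 : G.dfa.accept.ncard ≤ max 1 G.dfa.accept.ncard := le_max_right _ _
    have h2 : 1 ≤ max 1 G.dfa.accept.ncard := le_max_left _ _
    generalize G.dfa.accept.ncard = f at *
    generalize max 1 f = m at *
    have h3 : 1 + n * f ≤ 2 * (n * m) := by
      have h4 : n * f ≤ n * m := Nat.mul_le_mul_left _ h1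
      have h5 : 1 * 1 ≤ n * m := Nat.mul_le_mul hn h2
      omega
    calc 2200 * ((1 + n * f) * (s * n) * (s * L.length))
        ≤ 2200 * (2 * (n * m) * (s * n) * (s * L.length)) := by gcongr
      _ = 4400 * (n ^ 2 * L.length * s ^ 2 * m ^ 1) := by ring
      _ ≤ 4400 * (n ^ 3 * L.length * s ^ 2 * m ^ 2) := by
        gcongr <;> omega
  · generalize σ.var .J = J at *
    have hℓ : ∀ v, ℓ v < J := fun v => by have := hchain.level_le v; omega
    refine ⟨J * s, levelMemory G fun v => ⟨ℓ v, hℓ v⟩,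
      levelMove G (fun i => ch i) fun i x => hedge i i.2 x, ⟨?_, fun v => ?_, fun x v => ?_,
        fun x v => ?_⟩, hchain.isOptimal fun ρ _ hc j ho => ?_⟩
    · rw [← add_zero (S.reg 0), hmem 0 (by omega), hout]
    · rw [add_assoc, hmem _ (by omega), hinit v]
      simp only [levelMemory, finProdFinEquiv_apply_val]
      ring
    · obtain ⟨⟨i, q⟩, rfl⟩ := finProdFinEquiv.surjective x
      have hlt := posIdx_lt (v, q)
      have hle : (i + 1) * (s * n) ≤ J * (s * n) := Nat.mul_le_mul_right _ i.2
      rw [add_mul, one_mul] at hle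
      rw [show S.reg 0 + 1 + n + (finProdFinEquiv (i, q) : ℕ) * n + v =
          S.reg 0 + (1 + n + i * (s * n) + posIdx (v, q)) by
        simp only [finProdFinEquiv_apply_val, posIdx]; ring, hmem _ (by omega),
        (htab i i.2 (v, q)).1]
      simp only [levelMemory, finProdFinEquiv_apply_val, Equiv.symm_apply_apply]
      ring
    · obtain ⟨⟨i, q⟩, rfl⟩ := finProdFinEquiv.surjective x
      have hlt := posIdx_lt ((v : Fin n), q)
      have hle : (i + 1) * (s * n) ≤ J * (s * n) := Nat.mul_le_mul_right _ i.2
      rw [add_mul, one_mul] at hle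
      rw [show S.reg 0 + 1 + n + J * s * n + (finProdFinEquiv (i, q) : ℕ) * n + (v : Fin n) =
          S.reg 0 + (1 + n + J * (s * n) + i * (s * n) + posIdx ((v : Fin n), q)) by
        simp only [finProdFinEquiv_apply_val, posIdx]; ring, hmem _ (by omega),
        (htab i i.2 (v, q)).2]
      simp only [levelMove, Equiv.symm_apply_apply]
    · rw [hc j ho]
      simp only [NextMove.toStrategy, updStar_levelMemory, levelMove, Equiv.symm_apply_apply]
      rfl

/-! ### Renaming the vertices and the states -/

namespace RegularLimitGame

variable {V C Q : Type*} {n s : ℕ} (G : RegularLimitGame V C Q) (e : V ≃ Fin n) (f : Q ≃ Fin s)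

/-- A copy of the game in which the vertices are numbers and serve as their own colours, and the
states are numbers. -/
def rename : RegularLimitGame (Fin n) (Fin n) (Fin s) where
  arena :=
    { owner := fun v => G.arena.owner (e.symm v)
      edge := fun u v => G.arena.edge (e.symm u) (e.symm v)
      weight := fun u v => G.arena.weight (e.symm u) (e.symm v)
      color := id
      exists_edge := fun v => by
        obtain ⟨u, hu⟩ := G.arena.exists_edge (e.symm v)
        exact ⟨e u, by simpa using hu⟩ }
  dfa :=
    { step := fun q v => f (G.dfa.step (f.symm q) (G.arena.color (e.symm v)))
      start := f G.dfa.start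
      accept := {q | f.symm q ∈ G.dfa.accept} }

lemma rename_mem_accepts (w : List V) :
    (w.map e).map (G.rename e f).arena.color ∈ (G.rename e f).dfa.accepts ↔
      w.map G.arena.color ∈ G.dfa.accepts := by
  have key : ∀ (w : List V) (q : Q),
      (G.rename e f).dfa.evalFrom (f q) ((w.map e).map (G.rename e f).arena.color) =
        f (G.dfa.evalFrom q (w.map G.arena.color)) := by
    intro w
    induction w with
    | nil => exact fun q => rfl
    | cons v w ih =>
      intro q
      simp only [List.map_cons, DFA.evalFrom_cons]
      rw [← ih]
      simp [rename]
  rw [DFA.mem_accepts, DFA.mem_accepts, DFA.eval, DFA.eval]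
  change (G.rename e f).dfa.evalFrom (f G.dfa.start) _ ∈ _ ↔ _
  rw [key]
  simp [rename]

lemma playValue_rename (ρ : ℕ → V) : (G.rename e f).playValue (e ∘ ρ) = G.playValue ρ := by
  have h1 : ∀ j, pre (e ∘ ρ) j = (pre ρ j).map e := fun j => by simp [pre]
  unfold playValue infixWeight
  simp only [h1, rename_mem_accepts]
  simp [rename]

lemma value_rename {σ : Strategy G.arena 0} {σ' : Strategy (G.rename e f).arena 0}
    (h : ∀ (w : List V) (v : V) (hv : G.arena.owner v = 0),
      σ'.next (w.map e) ⟨e v, by simpa [rename] using hv⟩ = e (σ.next w ⟨v, hv⟩)) (v : V) :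
    G.value σ v = (G.rename e f).value σ' (e v) := by
  unfold value
  refine ((Equiv.refl ℕ).arrowCongr e).iSup_congr fun ρ => ?_
  have hρ : (Equiv.refl ℕ).arrowCongr e ρ = e ∘ ρ := rfl
  rw [hρ, playValue_rename]
  refine iSup_congr_Prop ?_ fun _ => rfl
  have h1 : ∀ j, pre (e ∘ ρ) j = (pre ρ j).map e := fun j => by simp [pre]
  refine and_congr (by simp [IsPlay, rename]) (and_congr (by simp) ?_)
  constructor
  · intro hc j hj
    have h2 := hc j (by simpa [rename] using hj)
    rw [h1] at h2
    have h3 := h (pre ρ j) (ρ j) hj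
    exact e.injective (h2.trans h3)
  · intro hc j hj
    have hj' : G.arena.owner (ρ j) = 0 := by simpa [rename] using hj
    rw [h1]
    refine (congrArg e (hc j hj')).trans (h (pre ρ j) (ρ j) hj').symm

/-- The copy of a strategy in the renamed game. -/
def renameStrategy (σ : Strategy G.arena 0) : Strategy (G.rename e f).arena 0 where
  next w v := e (σ.next (w.map e.symm) ⟨e.symm v, v.2⟩)
  edge_next w v := by
    have := σ.edge_next (w.map e.symm) ⟨e.symm v, v.2⟩
    simpa [rename] using this

/-- Optimal finite-state strategies of the renamed game are optimal in the original game. -/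
lemma exists_isOptimal_of_rename {m : ℕ} {𝓜 : MemoryStructure (Fin n) (Fin m)}
    {N : NextMove (G.rename e f).arena 0 (Fin m)}
    (h : (G.rename e f).IsOptimal (N.toStrategy 𝓜)) :
    ∃ σ : Strategy G.arena 0, σ.IsFiniteState ∧ G.IsOptimal σ := by
  let 𝓜' : MemoryStructure V (Fin m) := ⟨fun v => 𝓜.init (e v), fun x v => 𝓜.upd x (e v)⟩
  have hv : ∀ v : {v // G.arena.owner v = 0}, (G.rename e f).arena.owner (e v) = 0 := fun v => by
    simpa [rename] using v.2
  let N' : NextMove G.arena 0 (Fin m) :=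
    ⟨fun v x => e.symm (N.nxt ⟨e v, hv v⟩ x), fun v x => by
      simpa [rename] using N.edge_nxt ⟨e v, hv v⟩ x⟩
  refine ⟨N'.toStrategy 𝓜', ⟨Fin m, inferInstance, 𝓜', N', rfl⟩, fun σ' v => ?_⟩
  have hstar : ∀ (w : List V) (v : V), 𝓜'.updStar w v = 𝓜.updStar (w.map e) (e v) := by
    intro w v
    cases w with
    | nil => rfl
    | cons u w => simp [MemoryStructure.updStar, 𝓜', List.foldl_map]
  rw [G.value_rename e f (σ := N'.toStrategy 𝓜') (σ' := N.toStrategy 𝓜) (fun w v hv => by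
      simp [NextMove.toStrategy, N', hstar]),
    G.value_rename e f (σ := σ') (σ' := G.renameStrategy e f σ') (fun w v hv => by
      simp [renameStrategy, Function.comp_def])]
  exact h _ _

end RegularLimitGame

lemma exists_isEdgeList {n : ℕ} {C : Type*} (A : Arena (Fin n) C) :
    ∃ L : List (Fin n × Fin n), IsEdgeList A L := by
  classical
  exact ⟨(Finset.univ.filter fun p => A.edge p.1 p.2).toList, Finset.nodup_toList _, by simp⟩

lemma exists_isOptimal_of_isEmpty {V C Q : Type*} [IsEmpty V] (G : RegularLimitGame V C Q) :
    ∃ σ : Strategy G.arena 0, σ.IsFiniteState ∧ G.IsOptimal σ := by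
  let 𝓜 : MemoryStructure V Unit := ⟨fun _ => (), fun _ _ => ()⟩
  let N : NextMove G.arena 0 Unit := ⟨fun v _ => v, fun v => isEmptyElim (v : V)⟩
  exact ⟨N.toStrategy 𝓜, ⟨Unit, inferInstance, 𝓜, N, rfl⟩, fun _ v => isEmptyElim v⟩

end WeightedLimit

theorem mainTheorem1 :
    (∀ (V C Q : Type*) [Finite V] [Finite Q]
      (G : RegularLimitGame V C Q),
      ∃ σ : Strategy G.arena 0, σ.IsFiniteState ∧ G.IsOptimal σ) ∧
    (∃ (P : Prog) (K : ℕ), ∀ (n k s : ℕ) (G : RegularLimitGame (Fin n) (Fin k) (Fin s))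
      (L : List (Fin n × Fin n)), 0 < n → IsEdgeList G.arena L →
      ComputesOptimal P G L
        (K * (n ^ 3 * L.length * s ^ 2 * max 1 G.dfa.accept.ncard ^ 2))) := by
  refine ⟨fun V C Q _ _ G => ?_, strategyProg, 4400, fun n k s G L hn hL =>
    strategyProg_computesOptimal hn G hL⟩
  rcases isEmpty_or_nonempty V with hV | hV
  · exact exists_isOptimal_of_isEmpty G
  · let e := Finite.equivFin V
    let f := Finite.equivFin Q
    obtain ⟨L, hL⟩ := exists_isEdgeList (G.rename e f).arena
    obtain ⟨_, _, _, _, _, _, _, _, h⟩ :=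
      strategyProg_computesOptimal Finite.card_pos (G.rename e f) hL
    exact G.exists_isOptimal_of_rename e f h
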